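/- For non-negative integers $m,n$ let $K_{m,n}$ be the set of Kauffman diagrams of type $(m,n)$: isotopy classes of systems of pairwise disjoint arcs in a rectangle joining in pairs $m$ marked points on the upper edge and $n$ marked points on the lower edge. For $d\in\mathbb C$ the Temperley–Lieb category $\mathcal K_d$ is the strict $\mathbb C$-linear tensor category with objects $0,1,2,\dots$, with $\mathrm{Hom}(n,m)=\mathbb C[K_{m,n}]$, with composition given by concatenation of diagrams, each closed loop being replaced by the factor $d$, and with tensor product $m\otimes n=m+n$ given by juxtaposition of diagrams. The Markov trace $\mathrm{tr}$ of an endomorphism is obtained by closing diagrams and replacing each loop by $d$. The morphisms $f\in \mathrm{Hom}(n,m)$ with $\mathrm{tr}(fg)=0$ for all $g\in\mathrm{Hom}(m,n)$ form a tensor ideal of $\mathcal K_d$, and the reduced Temperley–Lieb category $\overline{\mathcal K}_d$ is the quotient of $\mathcal K_d$ by this ideal. A C*-tensor category structure on a strict $\mathbb C$-linear tensor category (with finite-dimensional hom-spaces and $\mathrm{End}(I)=\mathbb C 1_I$) is a conjugate-linear operation $f\mapsto f^*$, $\mathrm{Hom}(X,Y)\to\mathrm{Hom}(Y,X)$, with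 $f^{**}=f$, $(fg)^*=g^*f^*$, $(f\otimes g)^*=f^*\otimes g^*$, such that every $f^*f$ with $f\in\mathrm{Hom}(X,Y)$ is of the form $g^*g$ with $g\in\mathrm{End}(X)$, and such that the hom-spaces admit complete submultiplicative norms with $\|f^*f\|=\|f\|^2$. A C*-monoidal equivalence is a linear, strictly monoidal equivalence of categories $F$ with $F(f^*)=F(f)^*$. **Proposition.** Let $d\in\mathbb C$. 1. $\mathcal K_d$ admits a C*-tensor category structure if and only if $d=\pm(q+q^{-1})$ for some real $q>0$. 2. If $d\neq 0$, then $\overline{\mathcal K}_d$ admits a C*-tensor category structure if and only if $d=\pm(q+q^{-1})$ with $q>0$ or $q=e^{i\pi/n}$ for an integer $n\ge 3$. 3. Any two C*-tensor category structures on $\mathcal K_d$ are C*-monoidally equivalent, and, if $d\ne0$, so are any two C*-tensor category structures on $\overline{\mathcal K}_d$. 4. Whenever $\mathcal K_d$, respectively $\overline{\mathcal K}_d$ with $d\neq0$, admits a C*-tensor category structure, there is one with $$D^*=\Bigl(\frac{d}{|d|}\Bigr)^{\sharp(D)}D'$$ for all diagrams $D$ (respectively, for their classes in $\overline{\mathcal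 K}_d$), where $D'$ is the reflection of $D$ in a horizontal line and the arc index $\sharp(D)$ is the number of arcs of $D$ joining two lower points minus the number of arcs joining two upper points. -/

import Mathlib

namespace TemperleyLieb

/-- `k` points `0, …, k - 1` lie in this order on a line (or on the boundary of a disc). A crossingless
perfect matching of them is an involution `σ` without fixed points among these points and without
crossing arcs `x < y < σ x < σ y`. By convention `σ` fixes all other natural numbers, so that a
matching is determined by the function `σ`. -/
structure IsPlanar (k : ℕ) (σ : ℕ → ℕ) : Prop where
  invol : ∀ x, σ (σ x) = x
  ne_self : ∀ x, x < k → σ x ≠ x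
  eq_self : ∀ x, k ≤ x → σ x = x
  noncrossing : ∀ x y, ¬ (x < y ∧ y < σ x ∧ σ x < σ y)

/-- The order embedding `ℕ → ℕ` whose image omits exactly `i` and `i + 1`. -/
def up (i x : ℕ) : ℕ := if x < i then x else x + 2
/-- The renumbering after the removal of the points `i` and `i + 1`, inverse to `up i`. -/
def down (i x : ℕ) : ℕ := if x < i then x else x - 2

/-- Join the neighbouring points `i` and `i + 1` of a matching by an arc and remove them: their former
partners (if these are not `i` and `i + 1` themselves) become partners of each other, and the
remaining points are renumbered. -/
def cap (i : ℕ) (σ : ℕ → ℕ) (x : ℕ) : ℕ :=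
  down i (if σ (up i x) = i then σ (i + 1) else if σ (up i x) = i + 1 then σ i else σ (up i x))

/-- The number (`0` or `1`) of closed loops created when `i` and `i + 1` are joined. -/
def capLoop (i : ℕ) (σ : ℕ → ℕ) : ℕ := if σ i = i + 1 then 1 else 0

/-- The order embedding `ℕ → ℕ` whose image omits exactly `p, …, p + s - 1`. -/
def shift (p s x : ℕ) : ℕ := if x < p then x else x + s

/-- Insert a matching `τ` of `s` points into a matching `σ`, immediately before the point `p` of `σ`.
If `σ` has `p` points, this places `τ` to the right of `σ`. -/
def ins (p s : ℕ) (σ τ : ℕ → ℕ) (x : ℕ) : ℕ :=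
  if x < p then shift p s (σ x)
  else if x < p + s then p + τ (x - p)
  else shift p s (σ (x - s))

/-- The matching of `2 * k` points by `k` nested arcs, `x ↦ 2 * k - 1 - x`. -/
def nest (k x : ℕ) : ℕ := if x < 2 * k then 2 * k - 1 - x else x

theorem IsPlanar.lt {k σ} (h : IsPlanar k σ) {x : ℕ} (hx : x < k) : σ x < k := by
  by_contra hc
  have h1 := h.eq_self (σ x) (by omega)
  rw [h.invol] at h1
  exact h.ne_self x hx h1.symm

theorem IsPlanar.nest (k : ℕ) : IsPlanar (2 * k) (nest k) := by
  constructor <;> intros <;> simp only [TemperleyLieb.nest] at * <;> grind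

/-- Auxiliary: `u` and `w` become partners when `i` and `i + 1` are joined. -/
def link (i : ℕ) (σ : ℕ → ℕ) (u w : ℕ) : Prop :=
  σ u = w ∨ (σ u = i ∧ σ (i + 1) = w) ∨ (σ u = i + 1 ∧ σ i = w)

theorem up_ne (i x : ℕ) : up i x ≠ i ∧ up i x ≠ i + 1 := by
  unfold up; split_ifs <;> omega

theorem exists_up {i u : ℕ} (h : u ≠ i) (h' : u ≠ i + 1) : ∃ x, up i x = u :=
  ⟨down i u, by unfold up down; split_ifs <;> omega⟩

theorem cap_iff {k i σ} (h : IsPlanar k σ) (hi : i + 2 ≤ k) (x y : ℕ) :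
    cap i σ x = y ↔ link i σ (up i x) (up i y) := by
  have h1 := h.invol
  have e0 := h.ne_self i (by omega)
  have e1 := h.ne_self (i + 1) (by omega)
  have hx := up_ne i x
  have hy := up_ne i y
  have a1 := h1 i
  have a2 := h1 (i + 1)
  have a3 := h1 (up i x)
  have key : ∀ w, w ≠ i → w ≠ i + 1 → (down i w = y ↔ w = up i y) := by
    intro w _ _; unfold up down; split_ifs <;> omega
  unfold cap link
  split_ifs with c1 c2
  · rw [key]
    · grind
    · grind
    · grind
  · rw [key]
    · grind
    · grind
    · grind
  · rw [key]
    · grind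
    · grind
    · grind

theorem IsPlanar.cap {k i σ} (h : IsPlanar (k + 2) σ) (hi : i ≤ k) : IsPlanar k (cap i σ) := by
  have hiff := cap_iff h (i := i) (by omega)
  have hl := fun x => h.lt (x := x)
  obtain ⟨h1, h2, h3, h4⟩ := h
  have a1 := h1 i
  have a2 := h1 (i + 1)
  have e0 := h2 i (by omega)
  have e1 := h2 (i + 1) (by omega)
  constructor
  · intro x
    rw [hiff]
    have := (hiff x _).1 rfl
    unfold link at *
    have a3 := h1 (up i x)
    grind
  · intro x hx h
    rw [hiff] at h
    have b := h2 (up i x) (by unfold up; split_ifs <;> omega)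
    have := up_ne i x
    unfold link at *
    have a3 := h1 (up i x)
    grind
  · intro x hx
    rw [hiff]
    left
    exact h3 _ (by unfold up; split_ifs <;> omega)
  · rintro x y ⟨c1, c2, c3⟩
    have hx := (hiff x _).1 rfl
    have hy := (hiff y _).1 rfl
    generalize TemperleyLieb.cap i σ x = x' at *
    generalize TemperleyLieb.cap i σ y = y' at *
    have mono : ∀ a b, a < b → up i a < up i b := by
      intro a b; unfold up; split_ifs <;> omega
    have d1 := mono _ _ c1
    have d2 := mono _ _ c2
    have d3 := mono _ _ c3
    have n1 := up_ne i x
    have n2 := up_ne i y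
    have n3 := up_ne i x'
    have n4 := up_ne i y'
    generalize up i x = a at *
    generalize up i y = b at *
    generalize up i x' = a' at *
    generalize up i y' = b' at *
    clear hiff mono c1 c2 c3
    have f1 := h1 a
    have f2 := h1 b
    have f3 := h1 a'
    have f4 := h1 b'
    unfold link at hx hy
    have p0 := h1 i
    have p1 := h1 (i + 1)
    rcases hx with hx | ⟨hx, hx'⟩ | ⟨hx, hx'⟩ <;> rcases hy with hy | ⟨hy, hy'⟩ | ⟨hy, hy'⟩
    · have := h4 a b
      omega
    · have q1 := h4 i a
      have q2 := h4 a (i + 1)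
      have q3 := h4 a b
      rw [hy] at f2
      omega
    · have q1 := h4 (i + 1) a
      have q2 := h4 a i
      have q3 := h4 a b
      rw [hy] at f2
      omega
    · have q1 := h4 (i + 1) b
      have q2 := h4 a b
      have q3 := h4 b a'
      rw [hx'] at p1
      omega
    · omega
    · rw [hx] at f1
      omega
    · have q1 := h4 i b
      have q2 := h4 a b
      have q3 := h4 b a'
      rw [hx'] at p0
      omega
    · rw [hx] at f1
      omega
    · grind

theorem cap_cap {k i j σ} (h : IsPlanar k σ) (hj : i + 2 ≤ j) (hk : j + 2 ≤ k) :
    cap i (cap j σ) = cap (j - 2) (cap i σ) := by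
  obtain ⟨k, rfl⟩ : ∃ l, k = l + 2 := ⟨k - 2, by omega⟩
  have A := cap_iff h (i := i) (by omega)
  have B := cap_iff h (i := j) (by omega)
  have C := cap_iff (h.cap (i := j) (by omega)) (i := i) (by omega)
  have D := cap_iff (h.cap (i := i) (by omega)) (i := j - 2) (by omega)
  funext x
  rw [C]
  have := (D x _).1 rfl
  generalize TemperleyLieb.cap (j - 2) (TemperleyLieb.cap i σ) x = y at *
  unfold link at this ⊢
  simp only [A, B] at this ⊢
  have U : ∀ x, up i (up (j - 2) x) = up j (up i x) := by
    intro x; unfold up; split_ifs <;> omega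
  have e1 : up i (j - 2) = j := by unfold up; split_ifs <;> omega
  have e2 : up i (j - 2 + 1) = j + 1 := by unfold up; split_ifs <;> omega
  have e3 : up j i = i := by unfold up; split_ifs <;> omega
  have e4 : up j (i + 1) = i + 1 := by unfold up; split_ifs <;> omega
  rw [U, U, e1, e2] at this
  rw [e3, e4]
  have hx : ∀ x, up j (up i x) ≠ i ∧ up j (up i x) ≠ i + 1 ∧ up j (up i x) ≠ j ∧ up j (up i x) ≠ j + 1 := by
    intro x; unfold up; split_ifs <;> omega
  have hxx := hx x
  have hyy := hx y
  generalize up j (up i x) = a at *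
  generalize up j (up i y) = b at *
  have f1 := h.invol a
  have f2 := h.invol b
  have f3 := h.invol i
  have f4 := h.invol (i+1)
  have f5 := h.invol j
  have f6 := h.invol (j+1)
  have g3 := h.ne_self i (by omega)
  have g4 := h.ne_self (i+1) (by omega)
  have g5 := h.ne_self j (by omega)
  have g6 := h.ne_self (j+1) (by omega)
  clear A B C D h hx U e1 e2 e3 e4
  unfold link at *
  grind

theorem cap_loop {k i j σ} (h : IsPlanar k σ) (hj : i + 2 ≤ j) (hk : j + 2 ≤ k) :
   capLoop j σ + capLoop i (cap j σ) = capLoop i σ + capLoop (j - 2) (cap i σ) := by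
  have A := cap_iff h (i := i) (by omega)
  have B := cap_iff h (i := j) (by omega)
  have C := A (j - 2) (j - 2 + 1)
  have D := B i (i + 1)
  classical
  simp only [capLoop]
  rw [if_congr C rfl rfl, if_congr D rfl rfl]
  have e1 : up i (j - 2) = j := by unfold up; split_ifs <;> omega
  have e2 : up i (j - 2 + 1) = j + 1 := by unfold up; split_ifs <;> omega
  have e3 : up j i = i := by unfold up; split_ifs <;> omega
  have e4 : up j (i + 1) = i + 1 := by unfold up; split_ifs <;> omega
  rw [e1, e2, e3, e4]
  have f3 := h.invol i
  have f4 := h.invol (i+1)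
  have f5 := h.invol j
  have f6 := h.invol (j+1)
  have g3 := h.ne_self i (by omega)
  have g4 := h.ne_self (i+1) (by omega)
  have g5 := h.ne_self j (by omega)
  have g6 := h.ne_self (j+1) (by omega)
  clear A B C D h e1 e2 e3 e4
  unfold link
  grind

theorem ins_shift (p s : ℕ) (σ τ : ℕ → ℕ) (x : ℕ) :
    ins p s σ τ (shift p s x) = shift p s (σ x) := by
  unfold ins
  by_cases hx : x < p
  · have : shift p s x = x := by simp [shift, hx]
    simp [this, hx]
  · have : shift p s x = x + s := by simp [shift, hx]
    rw [this, if_neg (by omega), if_neg (by omega), Nat.add_sub_cancel]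

theorem ins_add {p s : ℕ} (σ τ : ℕ → ℕ) {v : ℕ} (hv : v < s) :
    ins p s σ τ (p + v) = p + τ v := by
  unfold ins
  rw [if_neg (by omega), if_pos (by omega), Nat.add_sub_cancel_left]

theorem shift_or (p s x : ℕ) : (∃ u, x = shift p s u) ∨ ∃ v < s, x = p + v := by
  by_cases h1 : x < p
  · exact .inl ⟨x, by simp [shift, h1]⟩
  by_cases h2 : x < p + s
  · exact .inr ⟨x - p, by omega, by omega⟩
  · exact .inl ⟨x - s, by unfold shift; split_ifs <;> omega⟩

theorem IsPlanar.ins {k p s σ τ} (h : IsPlanar k σ) (h' : IsPlanar s τ) (hp : p ≤ k) :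
    IsPlanar (k + s) (ins p s σ τ) := by
  have hl := fun x => h'.lt (x := x)
  constructor
  · intro x
    obtain ⟨u, rfl⟩ | ⟨v, hv, rfl⟩ := shift_or p s x
    · rw [ins_shift, ins_shift, h.invol]
    · rw [ins_add _ _ hv, ins_add _ _ (hl _ hv), h'.invol]
  · intro x hx
    obtain ⟨u, rfl⟩ | ⟨v, hv, rfl⟩ := shift_or p s x
    · rw [ins_shift]
      have := h.ne_self u (by revert hx; unfold shift; split_ifs <;> omega)
      unfold shift
      split_ifs <;> omega
    · rw [ins_add _ _ hv]
      have := h'.ne_self v hv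
      omega
  · intro x hx
    obtain ⟨u, rfl⟩ | ⟨v, hv, rfl⟩ := shift_or p s x
    · rw [ins_shift, h.eq_self u (by revert hx; unfold shift; split_ifs <;> omega)]
    · omega
  · intro x y
    obtain ⟨u, rfl⟩ | ⟨v, hv, rfl⟩ := shift_or p s x <;>
      obtain ⟨u', rfl⟩ | ⟨v', hv', rfl⟩ := shift_or p s y
    · rw [ins_shift, ins_shift]
      have := h.noncrossing u u'
      unfold shift
      split_ifs <;> omega
    · rw [ins_shift, ins_add _ _ hv']
      have := hl _ hv'
      unfold shift
      split_ifs <;> omega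
    · rw [ins_shift, ins_add _ _ hv]
      have := hl _ hv
      unfold shift
      split_ifs <;> omega
    · rw [ins_add _ _ hv, ins_add _ _ hv']
      have := h'.noncrossing v v'
      omega

theorem cap_ins_left {k p s i σ τ} (h : IsPlanar k σ) (h' : IsPlanar s τ) (hp : p ≤ k)
    (hi : i + 2 ≤ p) :
    cap i (ins p s σ τ) = ins (p - 2) s (cap i σ) τ ∧ capLoop i (ins p s σ τ) = capLoop i σ := by
  have A := cap_iff (h.ins h' hp) (i := i) (by omega)
  have B := cap_iff h (i := i) (by omega)
  have e0 : shift p s i = i := by simp [shift, show i < p by omega]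
  have e1 : shift p s (i + 1) = i + 1 := by simp [shift, show i + 1 < p by omega]
  have f0 := ins_shift p s σ τ i
  have f1 := ins_shift p s σ τ (i + 1)
  rw [e0] at f0
  rw [e1] at f1
  have inj : ∀ a b, shift p s a = shift p s b ↔ a = b := by
    intro a b; unfold shift; split_ifs <;> omega
  constructor
  · funext x
    rw [A]
    obtain ⟨u, rfl⟩ | ⟨v, hv, rfl⟩ := shift_or (p - 2) s x
    · rw [ins_shift]
      have := (B u _).1 rfl
      have U : ∀ u, up i (shift (p - 2) s u) = shift p s (up i u) := by
        intro u; unfold up shift; split_ifs <;> omega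
      rw [U, U]
      unfold link at *
      rw [ins_shift, f0, f1, inj, inj, inj]
      have i0 := inj (σ (up i u)) i
      have i1 := inj (σ (up i u)) (i + 1)
      rw [e0] at i0
      rw [e1] at i1
      rw [i0, i1]
      exact this
    · rw [ins_add _ _ hv]
      left
      have := h'.lt hv
      have U : ∀ v, up i (p - 2 + v) = p + v := by
        intro v; unfold up; split_ifs <;> omega
      rw [U, U, ins_add _ _ hv]
  · unfold capLoop
    rw [f0]
    have := inj (σ i) (i + 1)
    rw [e1] at this
    simp only [this]

theorem cap_ins_right {k p s i σ τ} (h : IsPlanar k σ) (h' : IsPlanar s τ) (hp : p ≤ i)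
    (hi : i + 2 ≤ k) :
    cap (i + s) (ins p s σ τ) = ins p s (cap i σ) τ ∧
      capLoop (i + s) (ins p s σ τ) = capLoop i σ := by
  have A := cap_iff (h.ins h' (p := p) (by omega)) (i := i + s) (by omega)
  have B := cap_iff h (i := i) (by omega)
  have e0 : shift p s i = i + s := by simp [shift, show ¬ i < p by omega]
  have e1 : shift p s (i + 1) = i + s + 1 := by
    simp [shift, show ¬ i + 1 < p by omega]; omega
  have f0 := ins_shift p s σ τ i
  have f1 := ins_shift p s σ τ (i + 1)
  rw [e0] at f0
  rw [e1] at f1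
  have inj : ∀ a b, shift p s a = shift p s b ↔ a = b := by
    intro a b; unfold shift; split_ifs <;> omega
  constructor
  · funext x
    rw [A]
    obtain ⟨u, rfl⟩ | ⟨v, hv, rfl⟩ := shift_or p s x
    · rw [ins_shift]
      have := (B u _).1 rfl
      have U : ∀ u, up (i + s) (shift p s u) = shift p s (up i u) := by
        intro u; unfold up shift; split_ifs <;> omega
      rw [U, U]
      unfold link at *
      rw [ins_shift, f0, f1, inj, inj, inj]
      have i0 := inj (σ (up i u)) i
      have i1 := inj (σ (up i u)) (i + 1)
      rw [e0] at i0
      rw [e1] at i1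
      rw [i0, i1]
      exact this
    · rw [ins_add _ _ hv]
      left
      have := h'.lt hv
      have U : ∀ v, v < s → up (i + s) (p + v) = p + v := by
        intro v _; unfold up; split_ifs <;> omega
      rw [U _ hv, U _ this, ins_add _ _ hv]
  · unfold capLoop
    rw [f0]
    have := inj (σ i) (i + 1)
    rw [e1] at this
    simp only [this]

theorem cap_ins_mid {k p s i σ τ} (h : IsPlanar k σ) (h' : IsPlanar s τ) (hp : p ≤ k)
    (hi : i + 2 ≤ s) :
    cap (p + i) (ins p s σ τ) = ins p (s - 2) σ (cap i τ) ∧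
      capLoop (p + i) (ins p s σ τ) = capLoop i τ := by
  have A := cap_iff (h.ins h' hp) (i := p + i) (by omega)
  have B := cap_iff h' (i := i) (by omega)
  have f0 := ins_add (p := p) σ τ (v := i) (s := s) (by omega)
  have f1 := ins_add (p := p) σ τ (v := i + 1) (s := s) (by omega)
  rw [← add_assoc] at f1
  constructor
  · funext x
    rw [A]
    obtain ⟨u, rfl⟩ | ⟨v, hv, rfl⟩ := shift_or p (s - 2) x
    · rw [ins_shift]
      left
      have U : ∀ u, up (p + i) (shift p (s - 2) u) = shift p s u := by
        intro u; unfold up shift; split_ifs <;> omega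
      rw [U, U, ins_shift]
    · rw [ins_add _ _ hv]
      have := (B v _).1 rfl
      have U : ∀ v, up (p + i) (p + v) = p + up i v := by
        intro v; unfold up; split_ifs <;> omega
      have hv' : up i v < s := by unfold up; split_ifs <;> omega
      rw [U, U]
      unfold link at *
      rw [f0, f1, ins_add _ _ hv']
      omega
  · unfold capLoop
    rw [f0]
    simp only [add_assoc, Nat.add_left_cancel_iff]

theorem nest_succ {r v : ℕ} (hv : v < 2 * r) : nest (r + 1) (1 + v) = 1 + nest r v := by
  unfold nest; split_ifs <;> omega

theorem nest_lt {r v : ℕ} (hv : v < 2 * r) : nest r v < 2 * r := by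
  unfold nest; split_ifs; omega

theorem cap_ins_nest {k p r σ} (h : IsPlanar k σ) (hp : p < k) :
    cap (p + 2 * r + 1) (ins p (2 * r + 2) σ (nest (r + 1))) = ins (p + 1) (2 * r) σ (nest r) ∧
      capLoop (p + 2 * r + 1) (ins p (2 * r + 2) σ (nest (r + 1))) = 0 := by
  have hn : IsPlanar (2 * r + 2) (nest (r + 1)) := IsPlanar.nest (r + 1)
  have A := cap_iff (h.ins hn (p := p) (by omega)) (i := p + 2 * r + 1) (by omega)
  have f0 := ins_add (p := p) σ (nest (r + 1)) (v := 2 * r + 1) (s := 2 * r + 2) (by omega)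
  have f1 := ins_shift p (2 * r + 2) σ (nest (r + 1)) p
  have f2 := ins_add (p := p) σ (nest (r + 1)) (v := 0) (s := 2 * r + 2) (by omega)
  have e1 : shift p (2 * r + 2) p = p + 2 * r + 1 + 1 := by simp [shift]; omega
  have e2 : nest (r + 1) (2 * r + 1) = 0 := by unfold nest; split_ifs <;> omega
  have e3 : nest (r + 1) 0 = 2 * r + 1 := by unfold nest; split_ifs <;> omega
  rw [e2, ← add_assoc] at f0
  rw [e1] at f1
  rw [e3] at f2
  simp only [add_zero] at f0 f2
  have hne := h.ne_self p hp
  have hi := h.invol p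
  constructor
  · funext x
    rw [A]
    obtain ⟨u, rfl⟩ | ⟨v, hv, rfl⟩ := shift_or (p + 1) (2 * r) x
    · rw [ins_shift]
      have U : ∀ u, u ≠ p → up (p + 2 * r + 1) (shift (p + 1) (2 * r) u) =
          shift p (2 * r + 2) u := by
        intro u _; unfold up shift; split_ifs <;> omega
      have U' : up (p + 2 * r + 1) (shift (p + 1) (2 * r) p) = p := by
        unfold up shift; split_ifs <;> omega
      unfold link
      by_cases h1 : u = p
      · subst h1
        rw [U', U _ hne, f2, f1]
        exact .inr (.inl ⟨by omega, rfl⟩)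
      by_cases h2 : σ u = p
      · rw [h2, U', U _ h1, ins_shift, h2, e1, f0]
        exact .inr (.inr ⟨rfl, rfl⟩)
      · rw [U _ h1, U _ h2, ins_shift]
        exact .inl rfl
    · rw [ins_add _ _ hv]
      left
      have hv' := nest_lt hv
      have U : ∀ v, v < 2 * r → up (p + 2 * r + 1) (p + 1 + v) = p + (1 + v) := by
        intro v _; unfold up; split_ifs <;> omega
      rw [U _ hv, U _ hv', ins_add _ _ (by omega), nest_succ hv]
  · unfold capLoop
    rw [f0, if_neg (by omega)]

theorem cap_ins_nest' {k q r σ} (h : IsPlanar k σ) (hq : q < k) :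
    cap q (ins (q + 1) (2 * r + 2) σ (nest (r + 1))) = ins q (2 * r) σ (nest r) ∧
      capLoop q (ins (q + 1) (2 * r + 2) σ (nest (r + 1))) = 0 := by
  have hn : IsPlanar (2 * r + 2) (nest (r + 1)) := IsPlanar.nest (r + 1)
  have A := cap_iff (h.ins hn (p := q + 1) (by omega)) (i := q) (by omega)
  have f0 := ins_shift (q + 1) (2 * r + 2) σ (nest (r + 1)) q
  have f1 := ins_add (p := q + 1) σ (nest (r + 1)) (v := 0) (s := 2 * r + 2) (by omega)
  have f2 := ins_add (p := q + 1) σ (nest (r + 1)) (v := 2 * r + 1) (s := 2 * r + 2) (by omega)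
  have e1 : shift (q + 1) (2 * r + 2) q = q := by simp [shift]
  have e2 : nest (r + 1) (2 * r + 1) = 0 := by unfold nest; split_ifs <;> omega
  have e3 : nest (r + 1) 0 = 2 * r + 1 := by unfold nest; split_ifs <;> omega
  rw [e1] at f0
  rw [e3] at f1
  rw [e2] at f2
  simp only [add_zero] at f1 f2
  have hne := h.ne_self q hq
  have hi := h.invol q
  constructor
  · funext x
    rw [A]
    obtain ⟨u, rfl⟩ | ⟨v, hv, rfl⟩ := shift_or q (2 * r) x
    · rw [ins_shift]
      have U : ∀ u, u ≠ q → up q (shift q (2 * r) u) = shift (q + 1) (2 * r + 2) u := by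
        intro u _; unfold up shift; split_ifs <;> omega
      have U' : up q (shift q (2 * r) q) = q + 1 + (2 * r + 1) := by
        unfold up shift; split_ifs <;> omega
      unfold link
      by_cases h1 : u = q
      · subst h1
        rw [U', U _ hne, f2, f0]
        exact .inr (.inr ⟨rfl, rfl⟩)
      by_cases h2 : σ u = q
      · rw [h2, U', U _ h1, ins_shift, h2, e1, f1]
        exact .inr (.inl ⟨rfl, rfl⟩)
      · rw [U _ h1, U _ h2, ins_shift]
        exact .inl rfl
    · rw [ins_add _ _ hv]
      left
      have hv' := nest_lt hv
      have U : ∀ v, up q (q + v) = q + 1 + (1 + v) := by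
        intro v; unfold up; split_ifs <;> omega
      rw [U, U, ins_add _ _ (by omega), nest_succ hv]
  · unfold capLoop
    rw [f0, if_neg]
    unfold shift; split_ifs <;> omega

theorem ins_ins_mid {p q s t} (σ τ ρ : ℕ → ℕ) (hq : q ≤ s) :
    ins p (s + t) σ (ins q t τ ρ) = ins (p + q) t (ins p s σ τ) ρ := by
  funext x
  obtain ⟨u, rfl⟩ | ⟨v, hv, rfl⟩ := shift_or (p + q) t x
  · rw [ins_shift]
    obtain ⟨w, rfl⟩ | ⟨w, hw, rfl⟩ := shift_or p s u
    · have U : ∀ w, shift (p + q) t (shift p s w) = shift p (s + t) w := by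
        intro w; unfold shift; split_ifs <;> omega
      rw [ins_shift, U, U, ins_shift]
    · have U : ∀ w, shift (p + q) t (p + w) = p + shift q t w := by
        intro w; unfold shift; split_ifs <;> omega
      rw [ins_add _ _ hw, U, U, ins_add _ _ (by unfold shift; split_ifs <;> omega), ins_shift]
  · rw [ins_add _ _ hv, add_assoc, ins_add _ _ (by omega), ins_add _ _ hv, add_assoc]

theorem ins_ins_comm {p q s t} (σ τ ρ : ℕ → ℕ) (hq : p ≤ q) (hτ : ∀ w < s, τ w < s) :
    ins p s (ins q t σ ρ) τ = ins (q + s) t (ins p s σ τ) ρ := by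
  funext x
  have U : ∀ w, shift (q + s) t (shift p s w) = shift p s (shift q t w) := by
    intro w; unfold shift; split_ifs <;> omega
  obtain ⟨u, rfl⟩ | ⟨v, hv, rfl⟩ := shift_or (q + s) t x
  · rw [ins_shift]
    obtain ⟨w, rfl⟩ | ⟨w, hw, rfl⟩ := shift_or p s u
    · rw [ins_shift, U, U, ins_shift, ins_shift]
    · have U' : ∀ w < s, shift (q + s) t (p + w) = p + w := by
        intro w _; unfold shift; split_ifs <;> omega
      rw [ins_add _ _ hw, U' _ hw, ins_add _ _ hw]
      rw [U' _ (hτ w hw)]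
  · have U' : ∀ v, q + s + v = shift p s (q + v) := by
      intro v; unfold shift; split_ifs <;> omega
    rw [ins_add _ _ hv, U', U', ins_shift, ins_add _ _ hv]

theorem ins_zero (p : ℕ) (σ τ : ℕ → ℕ) : ins p 0 σ τ = σ := by
  funext x
  unfold ins shift
  split_ifs <;> first | rfl | omega

theorem ins_nest_zero {s : ℕ} {τ : ℕ → ℕ} (h : IsPlanar s τ) (σ : ℕ → ℕ) (hσ : ∀ x, σ x = x) :
    ins 0 s σ τ = τ := by
  funext x
  have := h.eq_self x
  unfold ins shift
  simp only [hσ, Nat.sub_zero, zero_add]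
  split_ifs <;> omega

/-- Join each point `p + j`, `j < n`, with the point `p + 2 * n - 1 - j` (the nested pattern),
starting with the innermost, adjacent pair, and remove these points. -/
def glue (p : ℕ) : ℕ → (ℕ → ℕ) → ℕ → ℕ
  | 0, σ => σ
  | n + 1, σ => glue p n (cap (p + n) σ)

/-- The total number of closed loops created by `glue`. -/
def glueLoops (p : ℕ) : ℕ → (ℕ → ℕ) → ℕ
  | 0, _ => 0
  | n + 1, σ => capLoop (p + n) σ + glueLoops p n (cap (p + n) σ)

theorem IsPlanar.glue {k p n σ} (h : IsPlanar (k + 2 * n) σ) (hp : p ≤ k) :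
    IsPlanar k (glue p n σ) := by
  induction n generalizing σ with
  | zero => exact h
  | succ n ih => exact ih (IsPlanar.cap (k := k + 2 * n) h (by omega))

theorem glue_ins_left {k p s i n σ τ} (h : IsPlanar (k + 2 * n) σ) (h' : IsPlanar s τ)
    (hp : p ≤ k) (hi : i ≤ p) :
    glue i n (ins (p + 2 * n) s σ τ) = ins p s (glue i n σ) τ ∧
      glueLoops i n (ins (p + 2 * n) s σ τ) = glueLoops i n σ := by
  induction n generalizing σ with
  | zero => exact ⟨rfl, rfl⟩
  | succ n ih =>
    obtain ⟨e1, e2⟩ := cap_ins_left (p := p + 2 * (n + 1)) (i := i + n) h h' (by omega) (by omega)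
    obtain ⟨e3, e4⟩ := ih (IsPlanar.cap (k := k + 2 * n) (i := i + n) h (by omega))
    simp only [TemperleyLieb.glue, glueLoops]
    rw [e1, e2, show p + 2 * (n + 1) - 2 = p + 2 * n by omega, e3, e4]
    exact ⟨rfl, rfl⟩

theorem glue_ins_right {k p s i n σ τ} (h : IsPlanar (k + 2 * n) σ) (h' : IsPlanar s τ)
    (hp : p ≤ i) (hi : i ≤ k) :
    glue (i + s) n (ins p s σ τ) = ins p s (glue i n σ) τ ∧
      glueLoops (i + s) n (ins p s σ τ) = glueLoops i n σ := by
  induction n generalizing σ with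
  | zero => exact ⟨rfl, rfl⟩
  | succ n ih =>
    obtain ⟨e1, e2⟩ := cap_ins_right (p := p) (i := i + n) h h' (by omega) (by omega)
    obtain ⟨e3, e4⟩ := ih (IsPlanar.cap (k := k + 2 * n) (i := i + n) h (by omega))
    simp only [TemperleyLieb.glue, glueLoops]
    rw [show i + s + n = i + n + s by omega, e1, e2, e3, e4]
    exact ⟨rfl, rfl⟩

theorem glue_ins_mid {k p s i n σ τ} (h : IsPlanar k σ) (h' : IsPlanar (s + 2 * n) τ)
    (hp : p ≤ k) (hi : i ≤ s) :
    glue (p + i) n (ins p (s + 2 * n) σ τ) = ins p s σ (glue i n τ) ∧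
      glueLoops (p + i) n (ins p (s + 2 * n) σ τ) = glueLoops i n τ := by
  induction n generalizing τ with
  | zero => exact ⟨rfl, rfl⟩
  | succ n ih =>
    obtain ⟨e1, e2⟩ := cap_ins_mid (p := p) (i := i + n) h h' (by omega) (by omega)
    obtain ⟨e3, e4⟩ := ih (IsPlanar.cap (k := s + 2 * n) (i := i + n) h' (by omega))
    simp only [TemperleyLieb.glue, glueLoops]
    rw [add_assoc, e1, e2, show s + 2 * (n + 1) - 2 = s + 2 * n by omega, e3, e4]
    exact ⟨rfl, rfl⟩

theorem glue_cap {k i j n σ} (h : IsPlanar (k + 2 * n + 2) σ) (hi : i + 2 * n ≤ j) (hj : j ≤ k + 2 * n) :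
    glue i n (cap j σ) = cap (j - 2 * n) (glue i n σ) ∧
      capLoop j σ + glueLoops i n (cap j σ) =
        glueLoops i n σ + capLoop (j - 2 * n) (glue i n σ) := by
  induction n generalizing σ j with
  | zero => exact ⟨rfl, by simp [TemperleyLieb.glue, glueLoops]⟩
  | succ n ih =>
    have e1 := cap_cap (i := i + n) (j := j) h (by omega) (by omega)
    have e2 := cap_loop (i := i + n) (j := j) h (by omega) (by omega)
    obtain ⟨e3, e4⟩ := ih (j := j - 2) (IsPlanar.cap (k := k + 2 * n + 2) (i := i + n) h (by omega)) (by omega) (by omega)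
    simp only [TemperleyLieb.glue, glueLoops]
    rw [show j - 2 * (n + 1) = j - 2 - 2 * n by omega, ← e3, e1]
    refine ⟨rfl, ?_⟩
    omega

theorem glue_glue {k i j n m σ} (h : IsPlanar (k + 2 * n + 2 * m) σ) (hi : i ≤ j) (hj : j ≤ k) :
    glue i n (glue (j + 2 * n) m σ) = glue j m (glue i n σ) ∧
      glueLoops (j + 2 * n) m σ + glueLoops i n (glue (j + 2 * n) m σ) =
        glueLoops i n σ + glueLoops j m (glue i n σ) := by
  induction m generalizing σ with
  | zero => exact ⟨rfl, by simp [TemperleyLieb.glue, glueLoops]⟩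
  | succ m ih =>
    obtain ⟨e1, e2⟩ := glue_cap (k := k + 2 * m) (i := i) (n := n) (j := j + 2 * n + m)
      (σ := σ) (by convert h using 1; omega) (by omega) (by omega)
    obtain ⟨e3, e4⟩ := ih (IsPlanar.cap (k := k + 2 * n + 2 * m) (i := j + 2 * n + m) h (by omega))
    simp only [TemperleyLieb.glue, glueLoops]
    rw [show j + 2 * n + m - 2 * n = j + m by omega] at e1 e2
    rw [e3, e1]
    refine ⟨rfl, ?_⟩
    rw [e1] at e4
    omega

theorem glue_nest_left {k p r σ} (h : IsPlanar k σ) (hp : p + r ≤ k) :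
    glue (p + r) r (ins p (2 * r) σ (nest r)) = σ ∧
      glueLoops (p + r) r (ins p (2 * r) σ (nest r)) = 0 := by
  induction r generalizing p with
  | zero => exact ⟨ins_zero _ _ _, rfl⟩
  | succ r ih =>
    obtain ⟨e1, e2⟩ := cap_ins_nest (r := r) h (p := p) (by omega)
    obtain ⟨e3, e4⟩ := ih (p := p + 1) (by omega)
    simp only [TemperleyLieb.glue, glueLoops]
    rw [show p + (r + 1) + r = p + 2 * r + 1 by omega, show 2 * (r + 1) = 2 * r + 2 by omega,
      e1, e2, show p + (r + 1) = p + 1 + r by omega, e3, e4]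
    exact ⟨rfl, rfl⟩

theorem glue_nest_right {k p r σ} (h : IsPlanar k σ) (hp : p + r ≤ k) :
    glue p r (ins (p + r) (2 * r) σ (nest r)) = σ ∧
      glueLoops p r (ins (p + r) (2 * r) σ (nest r)) = 0 := by
  induction r with
  | zero => exact ⟨ins_zero _ _ _, rfl⟩
  | succ r ih =>
    obtain ⟨e1, e2⟩ := cap_ins_nest' (r := r) h (q := p + r) (by omega)
    obtain ⟨e3, e4⟩ := ih (by omega)
    simp only [TemperleyLieb.glue, glueLoops]
    rw [← add_assoc, show 2 * (r + 1) = 2 * r + 2 by omega, e1, e2, e3, e4]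
    exact ⟨rfl, rfl⟩

theorem glue_add (p m n : ℕ) (σ : ℕ → ℕ) :
    glue p (m + n) σ = glue p m (glue (p + m) n σ) ∧
      glueLoops p (m + n) σ = glueLoops (p + m) n σ + glueLoops p m (glue (p + m) n σ) := by
  induction n generalizing σ with
  | zero => exact ⟨rfl, by simp [glue, glueLoops]⟩
  | succ n ih =>
    obtain ⟨e1, e2⟩ := ih (cap (p + m + n) σ)
    rw [show m + (n + 1) = m + n + 1 from rfl]
    simp only [glue, glueLoops]
    rw [← add_assoc p m n, e1, e2]
    exact ⟨rfl, by omega⟩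

theorem ins_end {k s σ τ} (h : IsPlanar k σ) (h' : IsPlanar s τ) :
    ins k s σ τ = ins 0 k τ σ := by
  funext x
  have h1 := h.lt (x := x)
  have h2 := h'.lt (x := x - k)
  have h3 := h.eq_self (x - s)
  have h4 := h'.eq_self (x - k)
  unfold ins shift
  simp only [Nat.sub_zero, zero_add]
  split_ifs <;> omega

theorem ins_nest_nest (a b : ℕ) : ins a (2 * b) (nest a) (nest b) = nest (a + b) := by
  funext x
  unfold ins shift nest
  split_ifs <;> omega

section Raw
variable {a b c e a' b' c' : ℕ} {σ τ ρ σ' τ' : ℕ → ℕ}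

theorem raw_assoc (hσ : IsPlanar (a + b) σ) (hτ : IsPlanar (b + c) τ) (hρ : IsPlanar (c + e) ρ) :
    glue a c (ins (a + c) (c + e) (glue a b (ins (a + b) (b + c) σ τ)) ρ) =
      glue a b (ins (a + b) (b + e) σ (glue b c (ins (b + c) (c + e) τ ρ))) ∧
    glueLoops a b (ins (a + b) (b + c) σ τ) +
      glueLoops a c (ins (a + c) (c + e) (glue a b (ins (a + b) (b + c) σ τ)) ρ) =
    glueLoops b c (ins (b + c) (c + e) τ ρ) +
      glueLoops a b (ins (a + b) (b + e) σ (glue b c (ins (b + c) (c + e) τ ρ))) := by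
  have h1 : IsPlanar (a + c + 2 * b) (ins (a + b) (b + c) σ τ) := by
    convert hσ.ins hτ le_rfl using 1; omega
  have h2 : IsPlanar (b + e + 2 * c) (ins (b + c) (c + e) τ ρ) := by
    convert hτ.ins hρ le_rfl using 1; omega
  have h3 : IsPlanar (a + e + 2 * b + 2 * c)
      (ins (a + b + (b + c)) (c + e) (ins (a + b) (b + c) σ τ) ρ) := by
    convert (hσ.ins hτ le_rfl).ins hρ le_rfl using 1; omega
  obtain ⟨e1, e2⟩ := glue_ins_left (p := a + c) (i := a) h1 hρ le_rfl (by omega)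
  obtain ⟨e3, e4⟩ := glue_ins_mid (p := a + b) (i := b) hσ h2 le_rfl (by omega)
  obtain ⟨e5, e6⟩ := glue_glue (i := a) (j := a) h3 le_rfl (by omega)
  have e7 := ins_ins_mid (p := a + b) (q := b + c) (s := b + c) (t := c + e) σ τ ρ le_rfl
  rw [show b + e + 2 * c = b + c + (c + e) by omega, e7] at e3 e4
  rw [show a + c + 2 * b = a + b + (b + c) by omega] at e1 e2
  rw [show a + b + b = a + 2 * b by omega] at e3 e4
  rw [← e1, ← e3, ← e5]
  refine ⟨rfl, ?_⟩
  omega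

theorem raw_nest_left (hσ : IsPlanar (a + b) σ) :
    glue a a (ins (a + a) (a + b) (nest a) σ) = σ ∧
      glueLoops a a (ins (a + a) (a + b) (nest a) σ) = 0 := by
  have h := IsPlanar.nest a
  rw [two_mul] at h
  have := glue_nest_left (p := 0) (r := a) hσ (by omega)
  rw [two_mul, zero_add] at this
  rw [ins_end h hσ]
  exact this

theorem raw_nest_right (hσ : IsPlanar (a + b) σ) :
    glue a b (ins (a + b) (b + b) σ (nest b)) = σ ∧
      glueLoops a b (ins (a + b) (b + b) σ (nest b)) = 0 := by
  have := glue_nest_right (p := a) (r := b) hσ (by omega)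
  rwa [two_mul] at this

theorem raw_interchange (hσ : IsPlanar (a + b) σ) (hτ : IsPlanar (b + c) τ)
    (hσ' : IsPlanar (a' + b') σ') (hτ' : IsPlanar (b' + c') τ') :
    glue (a + a') (b + b') (ins (a + a' + (b + b')) (b + b' + (c + c'))
        (ins a (a' + b') σ σ') (ins b (b' + c') τ τ')) =
      ins a (a' + c') (glue a b (ins (a + b) (b + c) σ τ))
        (glue a' b' (ins (a' + b') (b' + c') σ' τ')) ∧
    glueLoops (a + a') (b + b') (ins (a + a' + (b + b')) (b + b' + (c + c'))
        (ins a (a' + b') σ σ') (ins b (b' + c') τ τ')) =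
      glueLoops a b (ins (a + b) (b + c) σ τ) +
        glueLoops a' b' (ins (a' + b') (b' + c') σ' τ') := by
  have h1 : IsPlanar (a + c + 2 * b) (ins (a + b) (b + c) σ τ) := by
    convert hσ.ins hτ le_rfl using 1; omega
  have h1' : IsPlanar (a' + c' + 2 * b') (ins (a' + b') (b' + c') σ' τ') := by
    convert hσ'.ins hτ' le_rfl using 1; omega
  have h2 : IsPlanar (a + c + (b' + c') + 2 * b)
      (ins (a + 2 * b) (b' + c') (ins (a + b) (b + c) σ τ) τ') := by
    convert h1.ins hτ' (p := a + 2 * b) (by omega) using 1; omega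
  have J : ins (a + a' + (b + b')) (b + b' + (c + c')) (ins a (a' + b') σ σ')
      (ins b (b' + c') τ τ') =
      ins a (a' + b') (ins (a + 2 * b) (b' + c') (ins (a + b) (b + c) σ τ) τ') σ' := by
    have e1 := ins_ins_mid (p := a + b) (q := b) (s := b + c) (t := b' + c') σ τ τ' (by omega)
    have e2 := ins_ins_comm (p := a) (q := a + b) (s := a' + b') (t := b + c + (b' + c'))
      σ σ' (ins b (b' + c') τ τ') (by omega) (fun w hw => hσ'.lt hw)
    rw [show a + a' + (b + b') = a + b + (a' + b') by omega,
      show b + b' + (c + c') = b + c + (b' + c') by omega, ← e2, e1,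
      show a + b + b = a + 2 * b by omega]
  have h3 : IsPlanar (a + c) (glue a b (ins (a + b) (b + c) σ τ)) := h1.glue (by omega)
  obtain ⟨g1, g2⟩ := glue_ins_right (p := a) (i := a) h2 hσ' le_rfl (by omega)
  obtain ⟨g3, g4⟩ := glue_ins_left (p := a) (i := a) h1 hτ' (by omega) le_rfl
  obtain ⟨g5, g6⟩ := glue_ins_mid (p := a) (i := a') h3 h1' (by omega) (by omega)
  have e3 := ins_ins_comm (p := a) (q := a) (s := a' + b') (t := b' + c')
      (glue a b (ins (a + b) (b + c) σ τ)) σ' τ' le_rfl (fun w hw => hσ'.lt hw)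
  have e4 := ins_ins_mid (p := a) (q := a' + b') (s := a' + b') (t := b' + c')
      (glue a b (ins (a + b) (b + c) σ τ)) σ' τ' le_rfl
  rw [← e4] at e3
  rw [show a' + c' + 2 * b' = a' + b' + (b' + c') by omega] at g5 g6
  obtain ⟨k1, k2⟩ := glue_add (a + a') b' b
    (ins a (a' + b') (ins (a + 2 * b) (b' + c') (ins (a + b) (b + c) σ τ) τ') σ')
  rw [show a + a' + b' = a + (a' + b') by omega] at k1 k2
  rw [J, add_comm b b', k1, k2, g1, g2, g3, g4, e3, g5, g6]
  exact ⟨rfl, rfl⟩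

end Raw

/-- Kauffman diagrams with `m` upper and `n` lower points, up to isotopy. Going around the boundary of
the rectangle, the upper points from left to right have the numbers `0, …, m - 1`, then the lower
points from right to left have the numbers `m, …, m + n - 1`; a diagram is a crossingless perfect
matching of these points. -/
def KauffmanDiagram (m n : ℕ) : Type := {σ : ℕ → ℕ // IsPlanar (m + n) σ}

namespace KauffmanDiagram

/-- `n` vertical strings. -/
def one (n : ℕ) : KauffmanDiagram n n := ⟨nest n, by rw [← two_mul]; exact IsPlanar.nest n⟩

/-- Concatenation, `D` above `E`: the `j`-th lower point of `D` is joined with the `j`-th upper point of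
`E`; closed loops are removed. -/
def comp {a b c : ℕ} (D : KauffmanDiagram a b) (E : KauffmanDiagram b c) : KauffmanDiagram a c :=
  ⟨glue a b (ins (a + b) (b + c) D.1 E.1), by
    refine IsPlanar.glue (k := a + c) ?_ (by omega)
    convert D.2.ins E.2 le_rfl using 1
    omega⟩

/-- The number of closed loops removed in the concatenation of `D` (above) and `E` (below). -/
def loops {a b c : ℕ} (D : KauffmanDiagram a b) (E : KauffmanDiagram b c) : ℕ :=
  glueLoops a b (ins (a + b) (b + c) D.1 E.1)

/-- Juxtaposition, `D` to the left of the second diagram. -/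
def tensor {a b a' b' : ℕ} (D : KauffmanDiagram a b) (D' : KauffmanDiagram a' b') : KauffmanDiagram (a + a') (b + b') :=
  ⟨ins a (a' + b') D.1 D'.1, by
    convert D.2.ins D'.2 (p := a) (by omega) using 1
    omega⟩

/-- The number of loops of the closed diagram obtained from `D` by joining, for each `j`, the `j`-th
upper point with the `j`-th lower point by nested curves around one side of the rectangle. -/
def closureLoops {n : ℕ} (D : KauffmanDiagram n n) : ℕ := glueLoops 0 n D.1

/-- The reflection of a diagram with respect to a horizontal line. -/
def reflect {m n : ℕ} (D : KauffmanDiagram m n) : KauffmanDiagram n m :=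
  ⟨fun x => if x < m + n then m + n - 1 - D.1 (m + n - 1 - x) else x, by
    obtain ⟨σ, h⟩ := D
    have hl := fun x => h.lt (x := x)
    constructor
    · intro x
      by_cases hx : x < m + n
      · have := hl (m + n - 1 - x) (by omega)
        simp only [hx, if_true]
        rw [if_pos (by omega), show m + n - 1 - (m + n - 1 - σ (m + n - 1 - x)) = σ (m + n - 1 - x) by omega,
          h.invol]
        omega
      · simp [hx]
    · intro x hx
      have hx : x < m + n := by omega
      have := hl (m + n - 1 - x) (by omega)
      have := h.ne_self (m + n - 1 - x) (by omega)
      simp only [hx, if_true]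
      omega
    · intro x hx
      rw [if_neg (by omega)]
    · intro x y
      have h1 := h.noncrossing
      by_cases hx : x < m + n <;> by_cases hy : y < m + n
      · have h3 := hl (m + n - 1 - x) (by omega)
        have h4 := hl (m + n - 1 - y) (by omega)
        simp only [hx, hy, if_true]
        have := h1 (σ (m + n - 1 - y)) (σ (m + n - 1 - x))
        rw [h.invol, h.invol] at this
        omega
      · simp only [hx, hy, if_true, if_false]
        omega
      · simp only [hx, hy, if_true, if_false]
        omega
      · simp only [hx, hy, if_false]
        omega⟩

/-- The arc index: the number of arcs between lower points (copies of `ε`, a morphism from `X ⊗ X` to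
the unit object) minus the number of arcs between upper points (copies of `δ`). -/
def arcIndex {m n : ℕ} (D : KauffmanDiagram m n) : ℤ :=
  ((Finset.Ico m (m + n)).filter fun x => x < D.1 x).card -
    ((Finset.range m).filter fun x => x < D.1 x ∧ D.1 x < m).card

end KauffmanDiagram

open CategoryTheory MonoidalCategory

noncomputable section

/-- The bilinear extension of a map defined on pairs of basis elements. -/
def bilinearExt {α β γ : Type} (φ : α → β → (γ →₀ ℂ)) :
    (α →₀ ℂ) →ₗ[ℂ] (β →₀ ℂ) →ₗ[ℂ] (γ →₀ ℂ) :=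
  Finsupp.lift _ ℂ α fun a => Finsupp.lift _ ℂ β (φ a)

theorem bilinearExt_single {α β γ : Type} (φ : α → β → (γ →₀ ℂ)) (a : α) (b : β) (x y : ℂ) :
    bilinearExt φ (Finsupp.single a x) (Finsupp.single b y) = x • y • φ a b := by
  simp [bilinearExt]

/-- The bilinear concatenation, in which each closed loop is replaced by the factor `d`. -/
def compHom (d : ℂ) (a b c : ℕ) : (KauffmanDiagram a b →₀ ℂ) →ₗ[ℂ] (KauffmanDiagram b c →₀ ℂ) →ₗ[ℂ] (KauffmanDiagram a c →₀ ℂ) :=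
  bilinearExt fun D E => Finsupp.single (D.comp E) (d ^ D.loops E)

theorem compHom_single (d : ℂ) {a b c : ℕ} (D : KauffmanDiagram a b) (E : KauffmanDiagram b c) (x y : ℂ) :
    compHom d a b c (Finsupp.single D x) (Finsupp.single E y) =
      Finsupp.single (D.comp E) (x * y * d ^ D.loops E) := by
  rw [compHom, bilinearExt_single, Finsupp.smul_single, Finsupp.smul_single, smul_eq_mul,
    smul_eq_mul, mul_assoc]

theorem compHom_one (d : ℂ) {a b : ℕ} (f : KauffmanDiagram a b →₀ ℂ) :
    compHom d a b b f (Finsupp.single (KauffmanDiagram.one b) 1) = f := by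
  induction f using Finsupp.induction_linear with
  | zero => simp
  | add f g hf hg => rw [map_add, LinearMap.add_apply, hf, hg]
  | single D x =>
    obtain ⟨e1, e2⟩ := raw_nest_right D.2
    have h1 : D.comp (KauffmanDiagram.one b) = D := Subtype.ext e1
    have h2 : D.loops (KauffmanDiagram.one b) = 0 := e2
    rw [compHom_single, h1, h2]
    simp

theorem one_compHom (d : ℂ) {a b : ℕ} (f : KauffmanDiagram a b →₀ ℂ) :
    compHom d a a b (Finsupp.single (KauffmanDiagram.one a) 1) f = f := by
  induction f using Finsupp.induction_linear with
  | zero => simp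
  | add f g hf hg => rw [map_add, hf, hg]
  | single D x =>
    obtain ⟨e1, e2⟩ := raw_nest_left D.2
    have h1 : (KauffmanDiagram.one a).comp D = D := Subtype.ext e1
    have h2 : (KauffmanDiagram.one a).loops D = 0 := e2
    rw [compHom_single, h1, h2]
    simp

theorem compHom_assoc (d : ℂ) {a b c e : ℕ} (f : KauffmanDiagram a b →₀ ℂ) (g : KauffmanDiagram b c →₀ ℂ) (h : KauffmanDiagram c e →₀ ℂ) :
    compHom d a c e (compHom d a b c f g) h = compHom d a b e f (compHom d b c e g h) := by
  induction f using Finsupp.induction_linear with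
  | zero => simp
  | add f f' hf hf' => simp only [map_add, LinearMap.add_apply, hf, hf']
  | single D x =>
  induction g using Finsupp.induction_linear with
  | zero => simp
  | add f f' hf hf' => simp only [map_add, LinearMap.add_apply, hf, hf']
  | single E y =>
  induction h using Finsupp.induction_linear with
  | zero => simp
  | add f f' hf hf' => simp only [map_add, hf, hf']
  | single F z =>
    obtain ⟨e1, e2⟩ := raw_assoc D.2 E.2 F.2
    have h1 : (D.comp E).comp F = D.comp (E.comp F) := Subtype.ext e1
    have h2 : D.loops E + (D.comp E).loops F = E.loops F + D.loops (E.comp F) := e2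
    simp only [compHom_single, h1]
    congr 1
    have h3 := congrArg (d ^ ·) h2
    simp only [pow_add] at h3
    linear_combination (x * y * z) * h3

/-- The bilinear extension of the juxtaposition of diagrams. -/
def tensorMap (a b a' b' : ℕ) :
    (KauffmanDiagram a b →₀ ℂ) →ₗ[ℂ] (KauffmanDiagram a' b' →₀ ℂ) →ₗ[ℂ] (KauffmanDiagram (a + a') (b + b') →₀ ℂ) :=
  bilinearExt fun D D' => Finsupp.single (D.tensor D') 1

theorem tensorMap_single {a b a' b' : ℕ} (D : KauffmanDiagram a b) (D' : KauffmanDiagram a' b') (x y : ℂ) :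
    tensorMap a b a' b' (Finsupp.single D x) (Finsupp.single D' y) =
      Finsupp.single (D.tensor D') (x * y) := by
  rw [tensorMap, bilinearExt_single, Finsupp.smul_single, Finsupp.smul_single, smul_eq_mul,
    smul_eq_mul, mul_one]

theorem tensorMap_one (a b : ℕ) :
    tensorMap a a b b (Finsupp.single (KauffmanDiagram.one a) 1) (Finsupp.single (KauffmanDiagram.one b) 1) =
      Finsupp.single (KauffmanDiagram.one (a + b)) 1 := by
  have h : (KauffmanDiagram.one a).tensor (KauffmanDiagram.one b) = KauffmanDiagram.one (a + b) := by
    refine Subtype.ext ?_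
    change ins a (b + b) (nest a) (nest b) = nest (a + b)
    rw [← two_mul, ins_nest_nest]
  rw [tensorMap_single, h, mul_one]

theorem tensorMap_comp (d : ℂ) {a b c a' b' c' : ℕ} (f : KauffmanDiagram a b →₀ ℂ) (g : KauffmanDiagram b c →₀ ℂ)
    (f' : KauffmanDiagram a' b' →₀ ℂ) (g' : KauffmanDiagram b' c' →₀ ℂ) :
    compHom d _ _ _ (tensorMap a b a' b' f f') (tensorMap b c b' c' g g') =
      tensorMap a c a' c' (compHom d a b c f g) (compHom d a' b' c' f' g') := by
  induction f using Finsupp.induction_linear with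
  | zero => simp
  | add _ _ hf hf' => simp only [map_add, LinearMap.add_apply, hf, hf']
  | single D x =>
  induction g using Finsupp.induction_linear with
  | zero => simp
  | add _ _ hf hf' => simp only [map_add, LinearMap.add_apply, hf, hf']
  | single E y =>
  induction f' using Finsupp.induction_linear with
  | zero => simp
  | add _ _ hf hf' => simp only [map_add, LinearMap.add_apply, hf, hf']
  | single D' x' =>
  induction g' using Finsupp.induction_linear with
  | zero => simp
  | add _ _ hf hf' => simp only [map_add, hf, hf']
  | single E' y' =>
    obtain ⟨e1, e2⟩ := raw_interchange D.2 E.2 D'.2 E'.2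
    have h1 : (D.tensor D').comp (E.tensor E') = (D.comp E).tensor (D'.comp E') := Subtype.ext e1
    have h2 : (D.tensor D').loops (E.tensor E') = D.loops E + D'.loops E' := e2
    simp only [compHom_single, tensorMap_single, h1, h2, pow_add]
    congr 1
    ring

/-- The objects of the Temperley–Lieb category with parameter `d`: the natural numbers. A morphism from
`n` to `m` is a formal complex linear combination of diagrams with `m` upper and `n` lower points. -/
@[ext]
structure TL (d : ℂ) where
  strands : ℕ

variable {d : ℂ}

instance : Category (TL d) where
  Hom X Y := KauffmanDiagram Y.strands X.strands →₀ ℂ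
  id X := Finsupp.single (KauffmanDiagram.one X.strands) 1
  comp f g := compHom d _ _ _ g f
  id_comp f := compHom_one d f
  comp_id f := one_compHom d f
  assoc f g h := (compHom_assoc d h g f).symm

theorem TL.id_def (X : TL d) : 𝟙 X = Finsupp.single (KauffmanDiagram.one X.strands) (1 : ℂ) := rfl

theorem TL.comp_def {X Y Z : TL d} (f : X ⟶ Y) (g : Y ⟶ Z) :
    f ≫ g = compHom d Z.strands Y.strands X.strands g f := rfl

instance : Preadditive (TL d) where
  homGroup X Y := inferInstanceAs (AddCommGroup (KauffmanDiagram Y.strands X.strands →₀ ℂ))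
  add_comp X Y Z f f' g := (compHom d Z.strands Y.strands X.strands g).map_add f f'
  comp_add X Y Z f g g' := LinearMap.map_add₂ (compHom d Z.strands Y.strands X.strands) g g' f

instance : Linear ℂ (TL d) where
  homModule X Y := inferInstanceAs (Module ℂ (KauffmanDiagram Y.strands X.strands →₀ ℂ))
  smul_comp X Y Z r f g := (compHom d Z.strands Y.strands X.strands g).map_smul r f
  comp_smul X Y Z f r g := LinearMap.map_smul₂ (compHom d Z.strands Y.strands X.strands) r g f

/-- A diagram as a morphism, from its lower to its upper points. -/
def diagram (d : ℂ) {m n : ℕ} (D : KauffmanDiagram m n) : (⟨n⟩ : TL d) ⟶ ⟨m⟩ :=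
  Finsupp.single D (1 : ℂ)

instance : MonoidalCategoryStruct (TL d) where
  tensorObj X Y := ⟨X.strands + Y.strands⟩
  tensorUnit := ⟨0⟩
  tensorHom f g := tensorMap _ _ _ _ f g
  whiskerLeft X {Y Z} f := tensorMap X.strands X.strands Z.strands Y.strands
    (Finsupp.single (KauffmanDiagram.one X.strands) 1) f
  whiskerRight {X Y} f Z := tensorMap Y.strands X.strands Z.strands Z.strands
    f (Finsupp.single (KauffmanDiagram.one Z.strands) 1)
  associator X Y Z := eqToIso (TL.ext (Nat.add_assoc _ _ _))
  leftUnitor X := eqToIso (TL.ext (Nat.zero_add _))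
  rightUnitor X := eqToIso (TL.ext (Nat.add_zero _))

theorem TL.tensor_assoc (X Y Z : TL d) : (X ⊗ Y) ⊗ Z = X ⊗ (Y ⊗ Z) := TL.ext (Nat.add_assoc _ _ _)

theorem TL.unit_tensor (X : TL d) : 𝟙_ (TL d) ⊗ X = X := TL.ext (Nat.zero_add _)

theorem TL.tensor_unit (X : TL d) : X ⊗ 𝟙_ (TL d) = X := TL.ext (Nat.add_zero _)

theorem TL.associator_hom (X Y Z : TL d) :
    (α_ X Y Z).hom = eqToHom (TL.tensor_assoc X Y Z) := rfl

theorem TL.leftUnitor_hom (X : TL d) : (λ_ X).hom = eqToHom (TL.unit_tensor X) := rfl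

theorem TL.rightUnitor_hom (X : TL d) : (ρ_ X).hom = eqToHom (TL.tensor_unit X) := rfl

theorem TL.tensor_def {X Y X' Y' : TL d} (f : X ⟶ Y) (g : X' ⟶ Y') :
    f ⊗ₘ g = tensorMap Y.strands X.strands Y'.strands X'.strands f g := rfl

theorem TL.comp_eqToHom_eq {X Y X' Y' : TL d} (hX : X = X') (hY : Y = Y')
    (D : KauffmanDiagram Y.strands X.strands) (D' : KauffmanDiagram Y'.strands X'.strands) (h : D.1 = D'.1) (x : ℂ) :
    (show X ⟶ Y from Finsupp.single D x) ≫ eqToHom hY =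
      eqToHom hX ≫ (show X' ⟶ Y' from Finsupp.single D' x) := by
  subst hX hY
  obtain rfl : D = D' := Subtype.ext h
  simp

theorem TL.tensor_eqToHom {X X' Y Y' : TL d} (h : X = X') (h' : Y = Y') :
    eqToHom h ⊗ₘ eqToHom h' = eqToHom (congrArg₂ (· ⊗ ·) h h') := by
  subst h h'
  exact tensorMap_one _ _

theorem TL.hom_induction {X Y : TL d} {P : (X ⟶ Y) → Prop} (f : X ⟶ Y) (zero : P 0)
    (add : ∀ f g, P f → P g → P (f + g))
    (single : ∀ (D : KauffmanDiagram Y.strands X.strands) (x : ℂ), P (Finsupp.single D x)) : P f :=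
  Finsupp.induction_linear (motive := P) f zero add single

theorem TL.tensor_zero {X Y X' Y' : TL d} (f : X ⟶ Y) : f ⊗ₘ (0 : X' ⟶ Y') = 0 :=
  (tensorMap Y.strands X.strands Y'.strands X'.strands f).map_zero

theorem TL.zero_tensor {X Y X' Y' : TL d} (f : X ⟶ Y) : (0 : X' ⟶ Y') ⊗ₘ f = 0 :=
  LinearMap.map_zero₂ (tensorMap Y'.strands X'.strands Y.strands X.strands) f

theorem TL.tensor_add {X Y X' Y' : TL d} (f : X ⟶ Y) (g g' : X' ⟶ Y') :
    f ⊗ₘ (g + g') = f ⊗ₘ g + f ⊗ₘ g' :=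
  (tensorMap Y.strands X.strands Y'.strands X'.strands f).map_add g g'

theorem TL.add_tensor {X Y X' Y' : TL d} (f f' : X ⟶ Y) (g : X' ⟶ Y') :
    (f + f') ⊗ₘ g = f ⊗ₘ g + f' ⊗ₘ g :=
  LinearMap.map_add₂ (tensorMap Y.strands X.strands Y'.strands X'.strands) f f' g

theorem TL.associator_naturality {X₁ X₂ X₃ Y₁ Y₂ Y₃ : TL d} (f : X₁ ⟶ Y₁) (g : X₂ ⟶ Y₂)
    (h : X₃ ⟶ Y₃) :
    ((f ⊗ₘ g) ⊗ₘ h) ≫ (α_ Y₁ Y₂ Y₃).hom = (α_ X₁ X₂ X₃).hom ≫ (f ⊗ₘ (g ⊗ₘ h)) := by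
  induction f using TL.hom_induction with
  | zero => simp only [TL.zero_tensor, Limits.zero_comp, Limits.comp_zero]
  | add f f' hf hf' =>
    simp only [TL.add_tensor, Preadditive.add_comp, Preadditive.comp_add, hf, hf']
  | single D x =>
  induction g using TL.hom_induction with
  | zero => simp only [TL.zero_tensor, TL.tensor_zero, Limits.zero_comp, Limits.comp_zero]
  | add f f' hf hf' =>
    simp only [TL.add_tensor, TL.tensor_add, Preadditive.add_comp, Preadditive.comp_add, hf, hf']
  | single E y =>
  induction h using TL.hom_induction with
  | zero => simp only [TL.tensor_zero, Limits.zero_comp, Limits.comp_zero]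
  | add f f' hf hf' =>
    simp only [TL.tensor_add, Preadditive.add_comp, Preadditive.comp_add, hf, hf']
  | single F z =>
    have e1 : (show X₁ ⟶ Y₁ from Finsupp.single D x) ⊗ₘ
        ((show X₂ ⟶ Y₂ from Finsupp.single E y) ⊗ₘ (show X₃ ⟶ Y₃ from Finsupp.single F z)) =
        Finsupp.single (D.tensor (E.tensor F)) (x * y * z) := by
      simp only [TL.tensor_def, tensorMap_single, mul_assoc]
    have e2 : ((show X₁ ⟶ Y₁ from Finsupp.single D x) ⊗ₘ
        (show X₂ ⟶ Y₂ from Finsupp.single E y)) ⊗ₘ (show X₃ ⟶ Y₃ from Finsupp.single F z) =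
        Finsupp.single ((D.tensor E).tensor F) (x * y * z) := by
      simp only [TL.tensor_def, tensorMap_single]
    refine (congrArg (· ≫ _) e2).trans (.trans ?_ (congrArg (_ ≫ ·) e1).symm)
    refine TL.comp_eqToHom_eq (TL.tensor_assoc _ _ _) (TL.tensor_assoc _ _ _) _ _ ?_ _
    have := ins_ins_mid (p := Y₁.strands) (q := Y₂.strands) (s := Y₂.strands + X₂.strands)
      (t := Y₃.strands + X₃.strands) D.1 E.1 F.1 (by omega)
    change ins (Y₁.strands + Y₂.strands) _ (ins _ _ D.1 E.1) F.1 =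
      ins _ (Y₂.strands + Y₃.strands + (X₂.strands + X₃.strands)) D.1 (ins _ _ E.1 F.1)
    rw [← this, show Y₂.strands + Y₃.strands + (X₂.strands + X₃.strands) =
      Y₂.strands + X₂.strands + (Y₃.strands + X₃.strands) by omega]

theorem TL.leftUnitor_naturality {X Y : TL d} (f : X ⟶ Y) :
    (𝟙 (𝟙_ (TL d)) ⊗ₘ f) ≫ (λ_ Y).hom = (λ_ X).hom ≫ f := by
  induction f using TL.hom_induction with
  | zero => simp only [TL.tensor_zero, Limits.zero_comp, Limits.comp_zero]
  | add f f' hf hf' =>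
    simp only [TL.tensor_add, Preadditive.add_comp, Preadditive.comp_add, hf, hf']
  | single D x =>
    have e : 𝟙 (𝟙_ (TL d)) ⊗ₘ (show X ⟶ Y from Finsupp.single D x) =
        Finsupp.single ((KauffmanDiagram.one 0).tensor D) (1 * x) := tensorMap_single _ _ _ _
    rw [one_mul] at e
    refine (congrArg (· ≫ _) e).trans ?_
    refine TL.comp_eqToHom_eq (TL.unit_tensor _) (TL.unit_tensor _) _ _ ?_ _
    exact ins_nest_zero D.2 _ (fun x => by simp [nest, KauffmanDiagram.one])

theorem TL.rightUnitor_naturality {X Y : TL d} (f : X ⟶ Y) :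
    (f ⊗ₘ 𝟙 (𝟙_ (TL d))) ≫ (ρ_ Y).hom = (ρ_ X).hom ≫ f := by
  induction f using TL.hom_induction with
  | zero => simp only [TL.zero_tensor, Limits.zero_comp, Limits.comp_zero]
  | add f f' hf hf' =>
    simp only [TL.add_tensor, Preadditive.add_comp, Preadditive.comp_add, hf, hf']
  | single D x =>
    have e : (show X ⟶ Y from Finsupp.single D x) ⊗ₘ 𝟙 (𝟙_ (TL d)) =
        Finsupp.single (D.tensor (KauffmanDiagram.one 0)) (x * 1) := tensorMap_single _ _ _ _
    rw [mul_one] at e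
    refine (congrArg (· ≫ _) e).trans ?_
    refine TL.comp_eqToHom_eq (TL.tensor_unit _) (TL.tensor_unit _) _ _ ?_ _
    exact ins_zero _ _ _

instance : MonoidalCategory (TL d) :=
  MonoidalCategory.ofTensorHom
    (id_tensorHom_id := fun _ _ => tensorMap_one _ _)
    (tensorHom_comp_tensorHom := fun f₁ f₂ g₁ g₂ => tensorMap_comp d g₁ f₁ g₂ f₂)
    (id_tensorHom := fun _ {_ _} _ => rfl)
    (tensorHom_id := fun _ _ => rfl)
    (associator_naturality := TL.associator_naturality)
    (leftUnitor_naturality := TL.leftUnitor_naturality)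
    (rightUnitor_naturality := TL.rightUnitor_naturality)
    (pentagon := fun W X Y Z => by
      simp only [TL.associator_hom, ← eqToHom_refl _ rfl, TL.tensor_eqToHom, eqToHom_trans])
    (triangle := fun X Y => by
      simp only [TL.associator_hom, TL.leftUnitor_hom, TL.rightUnitor_hom, ← eqToHom_refl _ rfl,
        TL.tensor_eqToHom, eqToHom_trans])

instance : MonoidalPreadditive (TL d) where
  whiskerLeft_zero {X Y Z} := (tensorMap X.strands X.strands Z.strands Y.strands
    (Finsupp.single (KauffmanDiagram.one X.strands) 1)).map_zero
  zero_whiskerRight {X Y Z} := LinearMap.map_zero₂ (tensorMap _ _ _ _) _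
  whiskerLeft_add f g := LinearMap.map_add (tensorMap _ _ _ _ _) f g
  add_whiskerRight f g := LinearMap.map_add₂ (tensorMap _ _ _ _) f g _

instance : MonoidalLinear ℂ (TL d) where
  whiskerLeft_smul X _ _ r f := LinearMap.map_smul (tensorMap _ _ _ _ _) r f
  smul_whiskerRight r _ _ f Z := LinearMap.map_smul₂ (tensorMap _ _ _ _) r f _

section Quot
universe v u
variable (C : Type u) [Category.{v} C] [Preadditive C] [Linear ℂ C] [MonoidalCategory C]

/-- A tensor ideal of a linear monoidal category: subspaces of the hom-spaces that are stable under
composition and tensor product with arbitrary morphisms. -/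
structure TensorIdeal where
  carrier : ∀ X Y : C, Submodule ℂ (X ⟶ Y)
  comp_mem : ∀ {X Y Z : C} {f : X ⟶ Y} (g : Y ⟶ Z), f ∈ carrier X Y → f ≫ g ∈ carrier X Z
  mem_comp : ∀ {X Y Z : C} (f : X ⟶ Y) {g : Y ⟶ Z}, g ∈ carrier Y Z → f ≫ g ∈ carrier X Z
  tensor_mem : ∀ {X Y X' Y' : C} {f : X ⟶ Y} (g : X' ⟶ Y'), f ∈ carrier X Y →
    f ⊗ₘ g ∈ carrier (X ⊗ X') (Y ⊗ Y')
  mem_tensor : ∀ {X Y X' Y' : C} (f : X ⟶ Y) {g : X' ⟶ Y'}, g ∈ carrier X' Y' →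
    f ⊗ₘ g ∈ carrier (X ⊗ X') (Y ⊗ Y')

variable {C}

/-- The smallest tensor ideal that contains the given morphisms. -/
def TensorIdeal.generate (S : ∀ X Y : C, Set (X ⟶ Y)) : TensorIdeal C where
  carrier X Y := ⨅ (I : TensorIdeal C) (_ : ∀ X Y, S X Y ⊆ I.carrier X Y), I.carrier X Y
  comp_mem g hf := by
    simp only [Submodule.mem_iInf] at hf ⊢
    exact fun I hI => I.comp_mem g (hf I hI)
  mem_comp f _ hg := by
    simp only [Submodule.mem_iInf] at hg ⊢
    exact fun I hI => I.mem_comp f (hg I hI)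
  tensor_mem g hf := by
    simp only [Submodule.mem_iInf] at hf ⊢
    exact fun I hI => I.tensor_mem g (hf I hI)
  mem_tensor f _ hg := by
    simp only [Submodule.mem_iInf] at hg ⊢
    exact fun I hI => I.mem_tensor f (hg I hI)

/-- The quotient of a linear monoidal category by a tensor ideal: it has the same objects, its
hom-spaces are the quotient spaces, and the operations are induced. -/
@[ext]
structure TensorQuotient (I : TensorIdeal C) where
  obj : C

namespace TensorQuotient
variable {I : TensorIdeal C}

instance : Quiver (TensorQuotient I) where
  Hom X Y := (X.obj ⟶ Y.obj) ⧸ I.carrier X.obj Y.obj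

/-- The class of a morphism in the quotient. -/
def homMk {X Y : C} (f : X ⟶ Y) : (⟨X⟩ : TensorQuotient I) ⟶ ⟨Y⟩ :=
  Submodule.Quotient.mk (p := I.carrier X Y) f

instance (X Y : TensorQuotient I) : AddCommGroup (X ⟶ Y) :=
  inferInstanceAs (AddCommGroup ((X.obj ⟶ Y.obj) ⧸ I.carrier X.obj Y.obj))

instance (X Y : TensorQuotient I) : Module ℂ (X ⟶ Y) :=
  inferInstanceAs (Module ℂ ((X.obj ⟶ Y.obj) ⧸ I.carrier X.obj Y.obj))

theorem mk_surj {X Y : TensorQuotient I} (f : X ⟶ Y) : ∃ g : X.obj ⟶ Y.obj, homMk g = f :=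
  Submodule.Quotient.mk_surjective _ f

theorem mk_eq_mk {X Y : C} {f g : X ⟶ Y} :
    (homMk f : (⟨X⟩ : TensorQuotient I) ⟶ ⟨Y⟩) = homMk g ↔ f - g ∈ I.carrier X Y :=
  Submodule.Quotient.eq _

theorem mk_add {X Y : C} (f g : X ⟶ Y) :
    (homMk (f + g) : (⟨X⟩ : TensorQuotient I) ⟶ ⟨Y⟩) = homMk f + homMk g := rfl

theorem mk_smul {X Y : C} (r : ℂ) (f : X ⟶ Y) :
    (homMk (r • f) : (⟨X⟩ : TensorQuotient I) ⟶ ⟨Y⟩) = r • homMk f := rfl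

instance : CategoryStruct (TensorQuotient I) where
  id X := homMk (𝟙 X.obj)
  comp {X Y Z} := Quotient.map₂ (fun f g => f ≫ g) (by
    intro f f' hf g g' hg
    have hf := (Submodule.quotientRel_def _).1 hf
    have hg := (Submodule.quotientRel_def _).1 hg
    refine (Submodule.quotientRel_def _).2 ?_
    have := (I.carrier X.obj Z.obj).add_mem (I.comp_mem g hf) (I.mem_comp f' hg)
    simpa [Preadditive.sub_comp, Preadditive.comp_sub] using this)

theorem mk_comp {X Y Z : C} (f : X ⟶ Y) (g : Y ⟶ Z) :
    (homMk (f ≫ g) : (⟨X⟩ : TensorQuotient I) ⟶ ⟨Z⟩) = homMk f ≫ homMk g := rfl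

instance : Category (TensorQuotient I) where
  id_comp f := by
    obtain ⟨f, rfl⟩ := mk_surj f
    exact congrArg homMk (Category.id_comp f)
  comp_id f := by
    obtain ⟨f, rfl⟩ := mk_surj f
    exact congrArg homMk (Category.comp_id f)
  assoc f g h := by
    obtain ⟨f, rfl⟩ := mk_surj f
    obtain ⟨g, rfl⟩ := mk_surj g
    obtain ⟨h, rfl⟩ := mk_surj h
    exact congrArg homMk (Category.assoc f g h)

instance : Preadditive (TensorQuotient I) where
  add_comp X Y Z f f' g := by
    obtain ⟨f, rfl⟩ := mk_surj f
    obtain ⟨f', rfl⟩ := mk_surj f'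
    obtain ⟨g, rfl⟩ := mk_surj g
    exact congrArg homMk (Preadditive.add_comp _ _ _ f f' g)
  comp_add X Y Z f g g' := by
    obtain ⟨f, rfl⟩ := mk_surj f
    obtain ⟨g, rfl⟩ := mk_surj g
    obtain ⟨g', rfl⟩ := mk_surj g'
    exact congrArg homMk (Preadditive.comp_add _ _ _ f g g')

instance : Linear ℂ (TensorQuotient I) where
  smul_comp X Y Z r f g := by
    obtain ⟨f, rfl⟩ := mk_surj f
    obtain ⟨g, rfl⟩ := mk_surj g
    exact congrArg homMk (Linear.smul_comp _ _ _ r f g)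
  comp_smul X Y Z f r g := by
    obtain ⟨f, rfl⟩ := mk_surj f
    obtain ⟨g, rfl⟩ := mk_surj g
    exact congrArg homMk (Linear.comp_smul _ _ _ f r g)

/-- The class of an isomorphism in the quotient. -/
def mkIso {X Y : C} (e : X ≅ Y) : (⟨X⟩ : TensorQuotient I) ≅ ⟨Y⟩ where
  hom := homMk e.hom
  inv := homMk e.inv
  hom_inv_id := congrArg homMk e.hom_inv_id
  inv_hom_id := congrArg homMk e.inv_hom_id

variable [MonoidalPreadditive C]

/-- The induced tensor product of morphisms. -/
def tensorHom {X Y X' Y' : TensorQuotient I} : (X ⟶ Y) → (X' ⟶ Y') →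
    ((⟨X.obj ⊗ X'.obj⟩ : TensorQuotient I) ⟶ ⟨Y.obj ⊗ Y'.obj⟩) :=
  Quotient.map₂ (fun f g => f ⊗ₘ g) (by
    intro f f' hf g g' hg
    have hf := (Submodule.quotientRel_def _).1 hf
    have hg := (Submodule.quotientRel_def _).1 hg
    refine (Submodule.quotientRel_def _).2 ?_
    have := (I.carrier _ _).add_mem (I.tensor_mem g hf) (I.mem_tensor f' hg)
    have e : f ⊗ₘ g - f' ⊗ₘ g' = (f - f') ⊗ₘ g + f' ⊗ₘ (g - g') := by
      have h1 := MonoidalPreadditive.add_tensor (f - f') f' g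
      have h2 := MonoidalPreadditive.tensor_add f' (g - g') g'
      rw [sub_add_cancel] at h1 h2
      rw [h1, h2]
      abel
    rwa [e])

instance : MonoidalCategoryStruct (TensorQuotient I) where
  tensorObj X Y := ⟨X.obj ⊗ Y.obj⟩
  tensorUnit := ⟨𝟙_ C⟩
  tensorHom f g := tensorHom f g
  whiskerLeft X _ _ f := tensorHom (𝟙 X) f
  whiskerRight f Y := tensorHom f (𝟙 Y)
  associator X Y Z := mkIso (α_ X.obj Y.obj Z.obj)
  leftUnitor X := mkIso (λ_ X.obj)
  rightUnitor X := mkIso (ρ_ X.obj)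

theorem mk_tensor {X Y X' Y' : C} (f : X ⟶ Y) (g : X' ⟶ Y') :
    (homMk (f ⊗ₘ g) : (⟨X ⊗ X'⟩ : TensorQuotient I) ⟶ ⟨Y ⊗ Y'⟩) = homMk f ⊗ₘ homMk g := rfl

instance : MonoidalCategory (TensorQuotient I) :=
  MonoidalCategory.ofTensorHom
    (id_tensorHom_id := fun X Y => congrArg homMk (id_tensorHom_id X.obj Y.obj))
    (tensorHom_comp_tensorHom := fun f₁ f₂ g₁ g₂ => by
      obtain ⟨f₁, rfl⟩ := mk_surj f₁
      obtain ⟨f₂, rfl⟩ := mk_surj f₂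
      obtain ⟨g₁, rfl⟩ := mk_surj g₁
      obtain ⟨g₂, rfl⟩ := mk_surj g₂
      exact congrArg homMk (tensorHom_comp_tensorHom f₁ f₂ g₁ g₂))
    (id_tensorHom := fun _ {_ _} _ => rfl)
    (tensorHom_id := fun _ _ => rfl)
    (associator_naturality := fun f g h => by
      obtain ⟨f, rfl⟩ := mk_surj f
      obtain ⟨g, rfl⟩ := mk_surj g
      obtain ⟨h, rfl⟩ := mk_surj h
      exact congrArg homMk (associator_naturality f g h))
    (leftUnitor_naturality := fun f => by
      obtain ⟨f, rfl⟩ := mk_surj f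
      refine congrArg homMk (?_ : (𝟙 _ ⊗ₘ f) ≫ _ = _ ≫ f)
      rw [id_tensorHom]
      exact leftUnitor_naturality f)
    (rightUnitor_naturality := fun f => by
      obtain ⟨f, rfl⟩ := mk_surj f
      refine congrArg homMk (?_ : (f ⊗ₘ 𝟙 _) ≫ _ = _ ≫ f)
      rw [tensorHom_id]
      exact rightUnitor_naturality f)
    (pentagon := fun W X Y Z => by
      have := pentagon W.obj X.obj Y.obj Z.obj
      rw [← tensorHom_id, ← id_tensorHom] at this
      exact congrArg homMk this)
    (triangle := fun X Y => by
      have := triangle X.obj Y.obj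
      rw [← tensorHom_id, ← id_tensorHom] at this
      exact congrArg homMk this)

instance : MonoidalPreadditive (TensorQuotient I) where
  whiskerLeft_zero := congrArg homMk (MonoidalPreadditive.tensor_zero _)
  zero_whiskerRight := congrArg homMk (MonoidalPreadditive.zero_tensor _)
  whiskerLeft_add f g := by
    obtain ⟨f, rfl⟩ := mk_surj f
    obtain ⟨g, rfl⟩ := mk_surj g
    exact congrArg homMk (MonoidalPreadditive.tensor_add _ f g)
  add_whiskerRight f g := by
    obtain ⟨f, rfl⟩ := mk_surj f
    obtain ⟨g, rfl⟩ := mk_surj g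
    exact congrArg homMk (MonoidalPreadditive.add_tensor f g _)

instance [MonoidalLinear ℂ C] : MonoidalLinear ℂ (TensorQuotient I) where
  whiskerLeft_smul X _ _ r f := by
    obtain ⟨f, rfl⟩ := mk_surj f
    refine congrArg homMk (?_ : 𝟙 X.obj ⊗ₘ (r • f) = r • (𝟙 X.obj ⊗ₘ f))
    rw [id_tensorHom, id_tensorHom, MonoidalLinear.whiskerLeft_smul]
  smul_whiskerRight r _ _ f Z := by
    obtain ⟨f, rfl⟩ := mk_surj f
    refine congrArg homMk (?_ : (r • f) ⊗ₘ 𝟙 Z.obj = r • (f ⊗ₘ 𝟙 Z.obj))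
    rw [tensorHom_id, tensorHom_id, MonoidalLinear.smul_whiskerRight]

end TensorQuotient
end Quot

section Reduced

/-- The Markov trace on the endomorphisms of an object of the Temperley–Lieb category: a diagram is
closed completely and each loop is replaced by `d`. -/
def markovTrace {d : ℂ} (X : TL d) : (X ⟶ X) →ₗ[ℂ] ℂ :=
  Finsupp.linearCombination ℂ fun D : KauffmanDiagram X.strands X.strands => d ^ D.closureLoops

/-- The negligible morphisms `f : X ⟶ Y`, those with `tr (f ∘ g) = 0` for all `g : Y ⟶ X`. -/
def negligible {d : ℂ} (X Y : TL d) : Set (X ⟶ Y) :=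
  {f | ∀ g : Y ⟶ X, markovTrace Y (g ≫ f) = 0}

/-- The tensor ideal of negligible morphisms. (The negligible morphisms already form a tensor ideal;
passing to the ideal that they generate only serves to have this built into the definition.) -/
def negligibleIdeal (d : ℂ) : TensorIdeal (TL d) :=
  TensorIdeal.generate negligible

/-- The reduced Temperley–Lieb category: the quotient by the negligible morphisms. -/
abbrev ReducedTL (d : ℂ) : Type := TensorQuotient (negligibleIdeal d)

end Reduced

section CStar
universe v u v' u'
variable (C : Type u) [Category.{v} C] [Preadditive C] [Linear ℂ C] [MonoidalCategory C]

/-- Tensor categories: strict linear monoidal categories with finite-dimensional hom-spaces in which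
the endomorphisms of the unit object are exactly the scalars. -/
structure IsTensorCategory : Prop where
  finite_hom : ∀ X Y : C, Module.Finite ℂ (X ⟶ Y)
  end_unit : ∀ f : 𝟙_ C ⟶ 𝟙_ C, ∃! c : ℂ, f = c • 𝟙 (𝟙_ C)
  tensor_assoc : ∀ X Y Z : C, ∃ h : (X ⊗ Y) ⊗ Z = X ⊗ (Y ⊗ Z), (α_ X Y Z).hom = eqToHom h
  unit_tensor : ∀ X : C, ∃ h : 𝟙_ C ⊗ X = X, (λ_ X).hom = eqToHom h
  tensor_unit : ∀ X : C, ∃ h : X ⊗ 𝟙_ C = X, (ρ_ X).hom = eqToHom h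

variable {C}

/-- The family `nrm` consists of complete norms on the hom-spaces that are submultiplicative and
satisfy the C*-identity with respect to `star`. -/
structure IsCStarNorm (star : ∀ {X Y : C}, (X ⟶ Y) → (Y ⟶ X))
    (nrm : ∀ {X Y : C}, (X ⟶ Y) → ℝ) : Prop where
  nonneg : ∀ {X Y : C} (f : X ⟶ Y), 0 ≤ nrm f
  eq_zero : ∀ {X Y : C} (f : X ⟶ Y), nrm f = 0 → f = 0
  add_le : ∀ {X Y : C} (f g : X ⟶ Y), nrm (f + g) ≤ nrm f + nrm g
  smul : ∀ {X Y : C} (c : ℂ) (f : X ⟶ Y), nrm (c • f) = ‖c‖ * nrm f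
  complete : ∀ {X Y : C} (u : ℕ → (X ⟶ Y)),
    (∀ ε : ℝ, 0 < ε → ∃ N : ℕ, ∀ m n : ℕ, N ≤ m → N ≤ n → nrm (u m - u n) < ε) →
    ∃ f : X ⟶ Y, ∀ ε : ℝ, 0 < ε → ∃ N : ℕ, ∀ n : ℕ, N ≤ n → nrm (u n - f) < ε
  comp_le : ∀ {X Y Z : C} (f : X ⟶ Y) (g : Y ⟶ Z), nrm (f ≫ g) ≤ nrm f * nrm g
  cstar : ∀ {X Y : C} (f : X ⟶ Y), nrm (f ≫ star f) = nrm f ^ 2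

variable (C)

/-- A structure of C*-tensor category on a linear monoidal category: a star operation (a conjugate
linear, involutive, antimultiplicative operation on morphisms) that makes it a C*-category, for some
(necessarily unique) norms, and that is compatible with the monoidal structure. In `positive`,
`f ≫ star f` is the endomorphism `f* f` of `X`. -/
structure CStarTensorStructure where
  star : ∀ {X Y : C}, (X ⟶ Y) → (Y ⟶ X)
  star_add : ∀ {X Y : C} (f g : X ⟶ Y), star (f + g) = star f + star g
  star_smul : ∀ {X Y : C} (c : ℂ) (f : X ⟶ Y), star (c • f) = (starRingEnd ℂ c) • star f
  star_star : ∀ {X Y : C} (f : X ⟶ Y), star (star f) = f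
  star_comp : ∀ {X Y Z : C} (f : X ⟶ Y) (g : Y ⟶ Z), star (f ≫ g) = star g ≫ star f
  exists_norm : ∃ nrm : ∀ {X Y : C}, (X ⟶ Y) → ℝ, IsCStarNorm star nrm
  positive : ∀ {X Y : C} (f : X ⟶ Y), ∃ g : X ⟶ X, f ≫ star f = g ≫ star g
  star_tensor : ∀ {X Y X' Y' : C} (f : X ⟶ Y) (g : X' ⟶ Y'),
    star (f ⊗ₘ g) = star f ⊗ₘ star g
  star_associator : ∀ X Y Z : C, star (α_ X Y Z).hom = (α_ X Y Z).inv
  star_leftUnitor : ∀ X : C, star (λ_ X).hom = (λ_ X).inv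
  star_rightUnitor : ∀ X : C, star (ρ_ X).hom = (ρ_ X).inv

/-- The linear monoidal category `C` is a tensor category that admits a structure of C*-tensor
category (on the given linear monoidal structure). -/
def IsCStarTensorCategory : Prop :=
  IsTensorCategory C ∧ Nonempty (CStarTensorStructure C)

variable {C}
variable {D : Type u'} [Category.{v'} D] [Preadditive D] [Linear ℂ D] [MonoidalCategory D]

/-- (Strictly) monoidal functors. -/
structure IsStrictMonoidal (F : C ⥤ D) : Prop where
  obj_unit : F.obj (𝟙_ C) = 𝟙_ D
  obj_tensor : ∀ X Y : C, F.obj (X ⊗ Y) = F.obj X ⊗ F.obj Y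
  map_tensor : ∀ {X Y X' Y' : C} (f : X ⟶ Y) (g : X' ⟶ Y'),
    F.map (f ⊗ₘ g) =
      eqToHom (obj_tensor X X') ≫ (F.map f ⊗ₘ F.map g) ≫ eqToHom (obj_tensor Y Y').symm

/-- C*-monoidal equivalence of two C*-tensor categories: there is a linear monoidal functor that is an
equivalence of categories and preserves the star operations. -/
def CStarTensorStructure.Equivalent (s : CStarTensorStructure C) (t : CStarTensorStructure D) :
    Prop :=
  ∃ F : C ⥤ D, F.IsEquivalence ∧ IsStrictMonoidal F ∧
    (∀ {X Y : C} (f g : X ⟶ Y), F.map (f + g) = F.map f + F.map g) ∧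
    (∀ {X Y : C} (c : ℂ) (f : X ⟶ Y), F.map (c • f) = c • F.map f) ∧
    ∀ {X Y : C} (f : X ⟶ Y), F.map (s.star f) = t.star (F.map f)

end CStar

end

end TemperleyLieb

/-! Existence rests on a path model of diagrams. The regions between the arcs of a planar matching
are labelled by integers, labels on the two sides of an arc differing by one, and each arc gets a
weight built from a function `lam` with `c * (lam (u + 1) + lam (u - 1)) = d * lam u` and c = ±1.
The labels read along the boundary form a walk, and every matching has a coefficient `amp` at every
walk. When a bend is straightened the weights cancel (`b_mul_a`), and the removal of a loop yields d
by the eigenvector equation (`b_mul_a_add`). So the joining of points acts on coefficients as it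
does on diagrams (`T_amp`), and the loop pairing becomes a weighted sum over walks
(`pow_pairLoops`). If `lam` is positive on a set of vertices and vanishes at the neighbours of this
set, all closed walks of k steps inside the set have weights of the same sign c^(k/2), so that up to
sign the Markov trace of f* f is a weighted sum of squares (`trace_form`). Its kernel consists of
the morphisms whose coefficients vanish on the walks inside the set, and this is the negligible
ideal (`negligible_eq`).

The function `lam` is u ↦ [u + 1], the quantum numbers with d = cD. For D ≥ 2 they are positive for
all u ≥ 0. Coefficients at Dyck paths are unitriangular (`eq_zero_of_eval`), so the kernel is zero
and the category itself equals its reduced quotient. For D = 2cos(π/n) they are positive on 0, …, n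
- 2 and vanish at -1 and n - 1, which serves the reduced category only. A star operation with
positive faithful functionals on finite-dimensional hom-spaces gives a C*-category, with operator
norms as norms (`FaithfulStar.isCStarNorm`).

Conversely, a given star operation sends the arc in Hom(0, 2) to a multiple 1/a of the reflected
arc. The zigzag identity, involutivity and positivity make a real with the sign of d
(`exists_adj_arcs`), and since arcs generate everything, the operation is D ↦ a^♯(D) D'
(`adj_starTL`). If D = |d| < 2, let [N + 1] be the first quantum number that is not positive. The
Jones–Wenzl projection, bent into a morphism f from the unit object, has f* f equal to a positive
multiple of [N + 1] (`exists_markovTrace_eq_qnum`). Positivity forces [N + 1] = 0, that is D =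
2cos(π/(N + 1)), and then f is killed in the quotient although it is not zero as a combination of
diagrams. This excludes D < 2 for the category itself.

Two star operations have parameters a and a' of the same sign, and multiplication of Hom(X, Y) by
ρ^(X - Y) with ρ⁴ = a/a' carries one to the other. -/

namespace TemperleyLieb

/-! ### Planar matchings: small arcs and mirror images. -/

section Matchings

/-- Insert an arc joining two new neighbouring points `j` and `j + 1`. -/
def cup (j : ℕ) (σ : ℕ → ℕ) : ℕ → ℕ := ins j 2 σ (nest 1)

theorem IsPlanar.cup {k j σ} (h : IsPlanar k σ) (hj : j ≤ k) : IsPlanar (k + 2) (cup j σ) :=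
  h.ins (IsPlanar.nest 1) hj

theorem cup_left (j : ℕ) (σ : ℕ → ℕ) : cup j σ j = j + 1 :=
  ins_add (p := j) (s := 2) σ (nest 1) (v := 0) (by omega)

theorem cup_right (j : ℕ) (σ : ℕ → ℕ) : cup j σ (j + 1) = j :=
  ins_add (p := j) (s := 2) σ (nest 1) (v := 1) (by omega)

theorem cup_shift (j : ℕ) (σ : ℕ → ℕ) (x : ℕ) : cup j σ (shift j 2 x) = shift j 2 (σ x) :=
  ins_shift j 2 σ _ x

theorem cup_cap {k j σ} (h : IsPlanar (k + 2) σ) (hj : j ≤ k) (e : σ j = j + 1) :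
    cup j (cap j σ) = σ := by
  have A := cap_iff h (i := j) (by omega)
  have e' : σ (j + 1) = j := by rw [← e, h.invol]
  funext x
  obtain ⟨u, rfl⟩ | ⟨v, hv, rfl⟩ := shift_or j 2 x
  · rw [cup_shift]
    have := (A u _).1 rfl
    have U : ∀ x, up j x = shift j 2 x := fun _ => rfl
    rw [U, U] at this
    unfold link at this
    have h1 := h.invol (shift j 2 u)
    rcases this with h2 | ⟨h2, h3⟩ | ⟨h2, h3⟩
    · exact h2.symm
    · rw [h2, e] at h1
      revert h1; unfold shift; split_ifs <;> omega
    · rw [h2, e'] at h1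
      revert h1; unfold shift; split_ifs <;> omega
  · obtain rfl | rfl : v = 0 ∨ v = 1 := by omega
    · rw [add_zero, cup_left, e]
    · rw [cup_right, e']

theorem cap_cup {k j σ} (h : IsPlanar k σ) (hj : j ≤ k) : cap j (cup j σ) = σ := by
  have := (cap_ins_mid (p := j) (i := 0) h (IsPlanar.nest 1) hj (by omega)).1
  rw [add_zero, ins_zero] at this
  exact this

/-- Descent to an innermost arc: unless the arc at x is small, noncrossing traps the partner of x +
1 strictly between x + 1 and σ x, and the arc at x + 1 is shorter. The number n bounds the length.
-/
theorem IsPlanar.exists_adjacent_aux {k σ} (h : IsPlanar k σ) (n : ℕ) :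
    ∀ x, x < σ x → σ x - x ≤ n → ∃ i, x ≤ i ∧ σ i = i + 1 := by
  induction n with
  | zero => intro x h1 h2; omega
  | succ n ih =>
    intro x h1 h2
    by_cases h3 : σ x = x + 1
    · exact ⟨x, le_rfl, h3⟩
    have hx : σ x < k := by
      by_contra hc
      have := h.eq_self (σ x) (by omega)
      rw [h.invol] at this
      omega
    have a1 := h.noncrossing x (x + 1)
    have a2 := h.noncrossing (σ (x + 1)) x
    have a3 := h.ne_self (x + 1) (by omega)
    have a4 := h.invol (x + 1)
    have a5 := h.invol x
    have a6 : σ (x + 1) ≠ x := by intro hc; rw [hc] at a4; omega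
    have a7 : σ (x + 1) ≠ σ x := by intro hc; rw [hc, a5] at a4; omega
    rw [a4] at a2
    obtain ⟨i, hi, hi'⟩ := ih (x + 1) (by omega) (by omega)
    exact ⟨i, by omega, hi'⟩

theorem IsPlanar.exists_adjacent {k σ} (h : IsPlanar k σ) (hk : 0 < k) :
    ∃ i, i + 2 ≤ k ∧ σ i = i + 1 := by
  have h0 := h.ne_self 0 hk
  obtain ⟨i, -, hi⟩ := h.exists_adjacent_aux _ 0 (by omega) le_rfl
  have : i < k := by
    by_contra hc
    have := h.eq_self i (by omega)
    omega
  have := h.lt this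
  exact ⟨i, by omega, hi⟩

theorem IsPlanar.zero_eq_id {σ} (h : IsPlanar 0 σ) : σ = id := funext fun x => h.eq_self x x.zero_le

theorem IsPlanar.id : IsPlanar 0 id := by constructor <;> intros <;> simp at *; omega

/-- Every planar matching is obtained from the empty one by successively inserting small arcs. -/
theorem IsPlanar.cup_induction {P : ℕ → (ℕ → ℕ) → Prop} (zero : P 0 _root_.id)
    (cup : ∀ k j σ, IsPlanar k σ → j ≤ k → P k σ → P (k + 2) (TemperleyLieb.cup j σ)) {k σ} (h : IsPlanar k σ) :
    P k σ := by
  induction k using Nat.strong_induction_on generalizing σ with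
  | _ k ih =>
  rcases Nat.eq_zero_or_pos k with rfl | hk
  · rw [h.zero_eq_id]; exact zero
  obtain ⟨i, hi, e⟩ := h.exists_adjacent hk
  obtain ⟨k, rfl⟩ : ∃ l, k = l + 2 := ⟨k - 2, by omega⟩
  rw [← cup_cap h (by omega) e]
  exact cup k i _ (h.cap (by omega)) (by omega) (ih k (by omega) (h.cap (by omega)))

theorem IsPlanar.even {k σ} (h : IsPlanar k σ) : Even k := by
  refine IsPlanar.cup_induction (P := fun k _ => Even k) (by simp) ?_ h
  intro k j σ _ _ h
  exact h.add (by decide)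

/-- The mirror image of a matching of `k` points. -/
def rev (k : ℕ) (σ : ℕ → ℕ) (x : ℕ) : ℕ := if x < k then k - 1 - σ (k - 1 - x) else x

theorem IsPlanar.rev {k σ} (h : IsPlanar k σ) : IsPlanar k (rev k σ) := by
  have := (KauffmanDiagram.reflect (m := 0) (n := k) ⟨σ, by rwa [zero_add]⟩).2
  change IsPlanar k fun x => if x < k then k - 1 - σ (k - 1 - x) else x
  simpa [KauffmanDiagram.reflect] using this

theorem rev_rev {k σ} (h : IsPlanar k σ) : rev k (rev k σ) = σ := by
  funext x
  have h1 := h.lt (x := x)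
  have h2 := h.eq_self x
  unfold rev
  by_cases hx : x < k
  · rw [if_pos hx, if_pos (by omega), show k - 1 - (k - 1 - x) = x by omega]
    have := h1 hx
    omega
  · rw [if_neg hx, h2 (by omega)]

/-- The mirror image moves the pair k - i, k - i + 1 to i + 1, i. -/
theorem cap_rev {k i σ} (h : IsPlanar (k + 2) σ) (hi : i ≤ k) :
    cap i (rev (k + 2) σ) = rev k (cap (k - i) σ) ∧
      capLoop i (rev (k + 2) σ) = capLoop (k - i) σ := by
  have A := cap_iff h.rev (i := i) (by omega)
  have B := cap_iff h (i := k - i) (by omega)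
  have hc := h.cap (i := k - i) (by omega)
  have hl := fun x => h.lt (x := x)
  have e1 : ∀ x, x < k + 2 → rev (k + 2) σ x = k + 1 - σ (k + 1 - x) := by
    intro x hx; unfold rev; rw [if_pos hx]; rfl
  constructor
  · funext x
    by_cases hx : x < k
    · rw [A]
      have := (B (k - 1 - x) _).1 rfl
      have e2 : rev k (cap (k - i) σ) x = k - 1 - cap (k - i) σ (k - 1 - x) := by
        unfold rev; rw [if_pos hx]
      have h3 := hc.lt (x := k - 1 - x) (by omega)
      rw [e2]
      generalize cap (k - i) σ (k - 1 - x) = y at *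
      have U : ∀ x, x < k → up i (k - 1 - x) = k + 1 - up (k - i) x ∧ up (k - i) x < k + 2 := by
        intro x hx; unfold up; split_ifs <;> omega
      obtain ⟨u1, u2⟩ := U (k - 1 - x) (by omega)
      obtain ⟨u3, u4⟩ := U y h3
      rw [show k - 1 - (k - 1 - x) = x by omega] at u1
      rw [u1, u3]
      generalize up (k - i) (k - 1 - x) = a at *
      generalize up (k - i) y = b at *
      unfold link at *
      rw [e1 _ (by omega), e1 (i + 1) (by omega), e1 i (by omega)]
      have l1 := hl a u2
      have l2 := hl (k - i) (by omega)
      have l3 := hl (k - i + 1) (by omega)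
      rw [show k + 1 - (k + 1 - a) = a by omega, show k + 1 - (i + 1) = k - i by omega,
        show k + 1 - i = k - i + 1 by omega]
      omega
    · rw [(h.rev.cap (i := i) (by omega)).eq_self x (by omega), hc.rev.eq_self x (by omega)]
  · unfold capLoop
    rw [e1 _ (by omega), show k + 1 - i = k - i + 1 by omega]
    have l3 := hl (k - i + 1) (by omega)
    have e : (k + 1 - σ (k - i + 1) = i + 1) ↔ σ (k - i) = k - i + 1 := by
      have := h.invol (k - i)
      have := h.invol (k - i + 1)
      constructor
      · intro hh
        have : σ (k - i + 1) = k - i := by omega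
        rw [← this, h.invol]
        omega
      · intro hh
        have : σ (k - i + 1) = k - i := by rw [← hh, h.invol]
        omega
    simp only [e]

/-- The nested pattern is its own mirror image; only the a points in front of the glued block and
the c points behind it change places. -/
theorem glue_rev {a c n σ} (h : IsPlanar (a + c + 2 * n) σ) :
    rev (a + c) (glue a n σ) = glue c n (rev (a + c + 2 * n) σ) ∧
      glueLoops a n σ = glueLoops c n (rev (a + c + 2 * n) σ) := by
  induction n generalizing σ with
  | zero => exact ⟨rfl, rfl⟩
  | succ n ih =>
    have h' : IsPlanar (a + c + 2 * n + 2) σ := h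
    obtain ⟨e1, e2⟩ := cap_rev h' (i := c + n) (by omega)
    rw [show a + c + 2 * n - (c + n) = a + n by omega] at e1 e2
    obtain ⟨e3, e4⟩ := ih (h'.cap (i := a + n) (by omega))
    simp only [glue, glueLoops]
    rw [show a + c + 2 * (n + 1) = a + c + 2 * n + 2 from rfl, e1, e2, e3, e4]
    exact ⟨rfl, rfl⟩

theorem rev_ins {k p s σ τ} (h : IsPlanar k σ) (h' : IsPlanar s τ) (hp : p ≤ k) :
    rev (k + s) (ins p s σ τ) = ins (k - p) s (rev k σ) (rev s τ) := by
  funext x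
  have R : ∀ x < k + s, rev (k + s) (ins p s σ τ) x = k + s - 1 - ins p s σ τ (k + s - 1 - x) := by
    intro x hx; unfold rev; rw [if_pos hx]
  obtain ⟨u, rfl⟩ | ⟨v, hv, rfl⟩ := shift_or (k - p) s x
  · rw [ins_shift]
    by_cases hu : u < k
    · have hl := h.lt (x := k - 1 - u) (by omega)
      have e : ∀ u < k, k + s - 1 - shift (k - p) s u = shift p s (k - 1 - u) ∧
          shift (k - p) s u < k + s := by
        intro u hu; unfold shift; split_ifs <;> omega
      rw [R _ (e u hu).2, (e u hu).1, ins_shift]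
      unfold rev
      rw [if_pos hu]
      revert hl
      generalize σ (k - 1 - u) = y
      intro hl
      unfold shift; split_ifs <;> omega
    · have e1 : rev k σ u = u := by unfold rev; rw [if_neg hu]
      rw [e1]
      have : ¬ shift (k - p) s u < k + s := by unfold shift; split_ifs <;> omega
      unfold rev; rw [if_neg this]
  · rw [ins_add _ _ hv, R _ (by omega), show k + s - 1 - (k - p + v) = p + (s - 1 - v) by omega,
      ins_add _ _ (by omega)]
    have hl := h'.lt (x := s - 1 - v) (by omega)
    unfold rev
    rw [if_pos hv]
    omega

/-- The number of loops of the planar closed curve system that consists of a matching `σ` of `k`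
points and of the mirror image of a matching `τ` of `k` points. -/
def pairLoops (k : ℕ) (σ τ : ℕ → ℕ) : ℕ := glueLoops 0 k (ins k k σ τ)

end Matchings

/-! ### Reflection, trace closure and arc index of diagrams. -/

namespace KauffmanDiagram

theorem even {m n : ℕ} (D : KauffmanDiagram m n) : Even (m + n) := D.2.even

theorem reflect_val {m n : ℕ} (D : KauffmanDiagram m n) : D.reflect.1 = rev (m + n) D.1 := rfl

theorem reflect_reflect {m n : ℕ} (D : KauffmanDiagram m n) : D.reflect.reflect = D := by
  refine Subtype.ext ?_
  rw [reflect_val, reflect_val, add_comm n m, rev_rev D.2]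

theorem reflect_comp {a b c : ℕ} (D : KauffmanDiagram a b) (E : KauffmanDiagram b c) :
    (D.comp E).reflect = E.reflect.comp D.reflect ∧ E.reflect.loops D.reflect = D.loops E := by
  have h : IsPlanar (a + c + 2 * b) (ins (a + b) (b + c) D.1 E.1) := by
    convert D.2.ins E.2 le_rfl using 1; omega
  obtain ⟨e1, e2⟩ := glue_rev h
  have e3 := rev_ins D.2 E.2 le_rfl
  -- The mirror image has the points of E in front of those of D; `ins_end` reads this as D inserted
  -- behind E, which is the form used by `comp`.
  rw [Nat.sub_self, ← ins_end E.2.rev D.2.rev] at e3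
  rw [show a + c + 2 * b = a + b + (b + c) by omega, e3] at e1 e2
  constructor
  · refine Subtype.ext ?_
    change rev (a + c) (glue a b _) = glue c b (ins (c + b) (b + a) (rev (b + c) E.1) (rev (a + b) D.1))
    rw [e1, add_comm c b, add_comm b a]
  · change glueLoops c b (ins (c + b) (b + a) (rev (b + c) E.1) (rev (a + b) D.1)) = _
    rw [add_comm c b, add_comm b a]
    exact e2.symm

theorem reflect_tensor {a b a' b' : ℕ} (D : KauffmanDiagram a b) (E : KauffmanDiagram a' b') :
    (D.tensor E).reflect = D.reflect.tensor E.reflect := by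
  refine Subtype.ext ?_
  have e3 := rev_ins D.2 E.2 (p := a) (by omega)
  change rev (a + a' + (b + b')) (ins a (a' + b') D.1 E.1) =
    ins b (b' + a') (rev (a + b) D.1) (rev (a' + b') E.1)
  rw [show a + a' + (b + b') = a + b + (a' + b') by omega, e3, Nat.add_sub_cancel_left]
  exact congrArg (fun t => ins b t _ _) (add_comm a' b')

theorem reflect_one (n : ℕ) : (one n).reflect = one n := by
  refine Subtype.ext (funext fun x => ?_)
  simp only [reflect, one, nest]
  split_ifs <;> omega

/-- The concatenation glues the b innermost of a + b nested pairs, and the trace closure glues the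
remaining a. Hence the exponent of d in a trace depends only on the two matchings, not on the
division of their points into upper and lower ones. -/
theorem loops_add_closureLoops {a b : ℕ} (D : KauffmanDiagram a b) (E : KauffmanDiagram b a) :
    D.loops E + (D.comp E).closureLoops = pairLoops (a + b) D.1 E.1 := by
  have := (glue_add 0 a b (ins (a + b) (b + a) D.1 E.1)).2
  rw [zero_add] at this
  change glueLoops a b _ + glueLoops 0 a (glue a b _) = glueLoops 0 (a + b) (ins (a + b) (a + b) _ _)
  rw [← this]
  exact congrArg (fun t => glueLoops 0 (a + b) (ins (a + b) t _ _)) (add_comm b a)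

instance {m n : ℕ} : Finite (KauffmanDiagram m n) := by
  refine Finite.of_injective
    (β := Fin (m + n) → Fin (m + n)) (fun D x => ⟨D.1 x, D.2.lt x.2⟩) fun D E h => ?_
  refine Subtype.ext (funext fun x => ?_)
  by_cases hx : x < m + n
  · exact congrArg Fin.val (congrFun h ⟨x, hx⟩)
  · rw [D.2.eq_self x (by omega), E.2.eq_self x (by omega)]

/-- With t through strings, m is twice the number of upper arcs plus t, and n is twice the number of
lower arcs plus t. So the arc index depends on m and n alone, which makes its additivity under
composition and tensor product immediate. -/
theorem two_mul_arcIndex {m n : ℕ} (D : KauffmanDiagram m n) : 2 * D.arcIndex = (n : ℤ) - m := by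
  obtain ⟨σ, h⟩ := D
  have hl := fun x => h.lt (x := x)
  have hne := h.ne_self
  have hi := h.invol
  -- Starts and ends of upper arcs and upper ends of through strings; then the same for the lower
  -- points. The involution σ exchanges starts with ends and T with T'.
  let U := (Finset.range m).filter fun x => x < σ x ∧ σ x < m
  let U' := (Finset.range m).filter fun x => σ x < x
  let T := (Finset.range m).filter fun x => m ≤ σ x
  let L := (Finset.Ico m (m + n)).filter fun x => x < σ x
  let L' := (Finset.Ico m (m + n)).filter fun x => m ≤ σ x ∧ σ x < x
  let T' := (Finset.Ico m (m + n)).filter fun x => σ x < m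
  have bij : ∀ (A B : Finset ℕ), (∀ x ∈ A, σ x ∈ B) → (∀ x ∈ B, σ x ∈ A) → A.card = B.card := by
    intro A B h1 h2
    refine Finset.card_bij' (fun x _ => σ x) (fun x _ => σ x) h1 h2 ?_ ?_ <;> intros <;> exact hi _
  have c1 : U.card = U'.card := by
    refine bij _ _ ?_ ?_ <;> intro x <;> simp only [U, U', Finset.mem_filter, Finset.mem_range, hi] <;>
      omega
  have c2 : T.card = T'.card := by
    refine bij _ _ ?_ ?_ <;> intro x <;>
      simp only [T, T', Finset.mem_filter, Finset.mem_range, Finset.mem_Ico, hi] <;>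
      have := hl x <;> omega
  have c3 : L.card = L'.card := by
    refine bij _ _ ?_ ?_ <;> intro x <;>
      simp only [L, L', Finset.mem_filter, Finset.mem_Ico, hi] <;>
      have := hl x <;> omega
  have s1 : m = U.card + (U'.card + T.card) := by
    rw [← Finset.card_union_of_disjoint, ← Finset.card_union_of_disjoint]
    · conv_lhs => rw [← Finset.card_range m]
      congr 1
      ext x
      simp only [U, U', T, Finset.mem_union, Finset.mem_filter, Finset.mem_range]
      have := hne x
      omega
    · rw [Finset.disjoint_left]
      intro x
      simp only [U, U', T, Finset.mem_union, Finset.mem_filter, Finset.mem_range]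
      omega
    · rw [Finset.disjoint_left]
      intro x
      simp only [U', T, Finset.mem_filter, Finset.mem_range]
      omega
  have s2 : n = L.card + (L'.card + T'.card) := by
    rw [← Finset.card_union_of_disjoint, ← Finset.card_union_of_disjoint]
    · have : n = (Finset.Ico m (m + n)).card := by simp
      conv_lhs => rw [this]
      congr 1
      ext x
      simp only [L, L', T', Finset.mem_union, Finset.mem_filter, Finset.mem_Ico]
      have := hne x
      omega
    · rw [Finset.disjoint_left]
      intro x
      simp only [L', L, T', Finset.mem_union, Finset.mem_filter, Finset.mem_Ico]
      omega
    · rw [Finset.disjoint_left]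
      intro x
      simp only [L', T', Finset.mem_filter, Finset.mem_Ico]
      omega
  change 2 * ((L.card : ℤ) - U.card) = n - m
  omega

theorem arcIndex_eq {m n : ℕ} (D : KauffmanDiagram m n) : D.arcIndex = ((n : ℤ) - m) / 2 := by
  have := D.two_mul_arcIndex
  omega

end KauffmanDiagram

end TemperleyLieb

/-! ### The path model: coefficients of matchings at walks. -/

namespace TemperleyLieb

open Finset

/-- Weights on the edges of a part of the graph `ℤ` that define a representation of Temperley–Lieb
diagrams by matrices indexed by walks: `lam` is an eigenvector of the graph, up to the sign `c`. -/
structure WalkWeights (d : ℝ) where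
  lam : ℤ → ℝ
  c : ℝ
  verts : Set ℤ
  c_sq : c * c = 1
  eigen : ∀ u ∈ verts, c * (lam (u + 1) + lam (u - 1)) = d * lam u
  ne_zero : ∀ u ∈ verts, lam u ≠ 0
  boundary : ∀ u ∈ verts, ∀ v, v = u + 1 ∨ v = u - 1 → v ∉ verts → lam v = 0

/-- `p` runs along the regions around the boundary of a matching `σ` of `k` points. -/
def Compat (k : ℕ) (σ : ℕ → ℕ) (p : ℕ → ℤ) : Prop :=
  ∀ x < k, p (σ x + 1) = p x ∧ (p (x + 1) = p x + 1 ∨ p (x + 1) = p x - 1)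

/-- Remove the points `q + 1, …, q + s` of a walk. -/
def cut (q s : ℕ) (p : ℕ → ℤ) (x : ℕ) : ℤ := p (shift (q + 1) s x)

/-- Insert a detour to `v` and back after the point `i` of a walk. -/
def detour (i : ℕ) (p : ℕ → ℤ) (v : ℤ) (x : ℕ) : ℤ :=
  if x ≤ i then p x else if x = i + 1 then v else p (x - 2)

theorem prod_range_shift {k q : ℕ} (s : ℕ) (hq : q ≤ k) (g : ℕ → ℝ) :
    ∏ x ∈ range (k + s), g x = (∏ u ∈ range k, g (shift q s u)) * ∏ v ∈ range s, g (q + v) := by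
  obtain ⟨r, rfl⟩ := Nat.exists_eq_add_of_le hq
  rw [show q + r + s = q + s + r by omega, prod_range_add, prod_range_add, prod_range_add]
  have e1 : ∀ u ∈ range q, g (shift q s u) = g u := by
    intro u hu; simp only [mem_range] at hu; simp [shift, hu]
  have e2 : ∀ u ∈ range r, g (shift q s (q + u)) = g (q + s + u) := by
    intro u _; congr 1; unfold shift; split_ifs <;> omega
  rw [prod_congr rfl e1, prod_congr rfl e2]
  ring

theorem Compat.congr {k σ p p'} (h : IsPlanar k σ) (e : ∀ x ≤ k, p x = p' x) (hc : Compat k σ p) :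
    Compat k σ p' := by
  intro x hx
  have := h.lt hx
  rw [← e _ (by omega), ← e x (by omega), ← e (x + 1) (by omega)]
  exact hc x hx

/-- The inserted matching lies inside one region of σ, whose label is `p q`. If the walk has this
label again after the s inserted points, it splits into a walk around σ and one around τ. -/
theorem Compat.ins_iff {k s q σ τ p} (hq : q ≤ k)
    (e : p (q + s) = p q) :
    Compat (k + s) (ins q s σ τ) p ↔
      Compat k σ (cut q s p) ∧ Compat s τ (fun x => p (q + x)) := by
  have R1 : ∀ y, p (shift q s y + 1) = cut q s p (y + 1) := by
    intro y; unfold cut; congr 1; unfold shift; split_ifs <;> omega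
  have R2 : ∀ y, p (shift q s y) = cut q s p y := by
    intro y
    by_cases hy : y = q
    · subst hy; simp only [cut, shift]; simp [e]
    · unfold cut; congr 1; unfold shift; split_ifs <;> omega
  constructor
  · intro H
    constructor
    · intro x hx
      have := H (shift q s x) (by unfold shift; split_ifs <;> omega)
      rwa [ins_shift, R1, R2, R1] at this
    · intro x hx
      have := H (q + x) (by omega)
      rwa [ins_add _ _ hx, add_assoc, add_assoc] at this
  · rintro ⟨H1, H2⟩ x hx
    obtain ⟨u, rfl⟩ | ⟨v, hv, rfl⟩ := shift_or q s x
    · rw [ins_shift, R1, R2, R1]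
      exact H1 u (by revert hx; unfold shift; split_ifs <;> omega)
    · rw [ins_add _ _ hv, add_assoc, add_assoc]
      exact H2 v hv

theorem cut_congr {q s : ℕ} {p : ℕ → ℤ} (e : p (q + s) = p q) (y : ℕ) :
    p (shift q s y) = cut q s p y := by
  by_cases hy : y = q
  · subst hy; simp only [cut, shift]; simp [e]
  · unfold cut; congr 1; unfold shift; split_ifs <;> omega

/-- The boundary begins and ends in the same outer region, as one sees by removing small arcs one
after the other. -/
theorem Compat.closed {k σ} (h : IsPlanar k σ) : ∀ {p}, Compat k σ p → p k = p 0 := by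
  refine IsPlanar.cup_induction (P := fun k σ => ∀ {p}, Compat k σ p → p k = p 0) (fun _ => rfl) ?_ h
  intro k j σ h hj ih p hp
  have h1 := (hp j (by omega)).1
  have h2 := (hp (j + 1) (by omega)).1
  rw [cup_left] at h1
  have := ih ((Compat.ins_iff hj h1).1 hp).1
  unfold cut at this
  rw [show shift (j + 1) 2 0 = 0 by simp [shift]] at this
  rw [← this]
  -- If the small arc comes last, `cut` retains the value at k in place of the one at k + 2; the two
  -- agree.
  by_cases hk : j = k
  · subst hk; rw [h1]; simp [shift]
  · congr 1; unfold shift; split_ifs <;> omega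

namespace WalkWeights
variable {d : ℝ} (G : WalkWeights d)

/-- The weight of a minimum or maximum, for the region `u` outside and `v` inside. -/
noncomputable def a (u v : ℤ) : ℝ := if v = u + 1 then 1 else G.c * G.lam v / G.lam u

open Classical in
/-- The weight of the removal of a detour from `u` to `v`. -/
noncomputable def b (u v : ℤ) : ℝ :=
  if v ∈ G.verts then (if v = u + 1 then G.c * G.lam v / G.lam u else 1) else 0

open Classical in
/-- The matrix coefficient of a matching at a walk. -/
noncomputable def amp (k : ℕ) (σ : ℕ → ℕ) (p : ℕ → ℤ) : ℝ :=
  if Compat k σ p then ∏ x ∈ range k, if x < σ x then G.a (p x) (p (x + 1)) else 1 else 0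

theorem amp_zero (σ : ℕ → ℕ) (p : ℕ → ℤ) : G.amp 0 σ p = 1 := by
  simp [amp, Compat]

variable {G} in
theorem amp_ne_zero {k σ p} (h : G.amp k σ p ≠ 0) : Compat k σ p := by
  by_contra hc
  exact h (if_neg hc)

theorem amp_congr {k σ p p'} (h : IsPlanar k σ) (e : ∀ x ≤ k, p x = p' x) :
    G.amp k σ p = G.amp k σ p' := by
  unfold amp
  have : Compat k σ p ↔ Compat k σ p' := ⟨Compat.congr h e, Compat.congr h fun x hx => (e x hx).symm⟩
  by_cases hc : Compat k σ p
  · rw [if_pos hc, if_pos (this.1 hc)]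
    refine prod_congr rfl fun x hx => ?_
    rw [mem_range] at hx
    rw [e x (by omega), e (x + 1) (by omega)]
  · rw [if_neg hc, if_neg (mt this.2 hc)]

/-- The weight is a product over arcs and hence splits. If the walk does not return to its label
after the inserted points, it is not compatible, because compatible walks around τ are closed. -/
theorem amp_ins {k s q σ τ} (p : ℕ → ℤ) (h' : IsPlanar s τ) (hq : q ≤ k) :
    G.amp (k + s) (ins q s σ τ) p =
      if p (q + s) = p q then G.amp k σ (cut q s p) * G.amp s τ (fun x => p (q + x)) else 0 := by
  split_ifs with e
  · unfold amp
    rw [Compat.ins_iff hq e]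
    by_cases h1 : Compat k σ (cut q s p)
    · by_cases h2 : Compat s τ (fun x => p (q + x))
      · rw [if_pos ⟨h1, h2⟩, if_pos h1, if_pos h2, prod_range_shift s hq]
        congr 1
        · refine prod_congr rfl fun x _ => ?_
          rw [ins_shift, cut_congr e,
            show p (shift q s x + 1) = cut q s p (x + 1) by
              unfold cut; congr 1; unfold shift; split_ifs <;> omega]
          have : shift q s x < shift q s (σ x) ↔ x < σ x := by
            unfold shift; split_ifs <;> omega
          simp only [this]
        · refine prod_congr rfl fun x hx => ?_
          rw [ins_add _ _ (mem_range.1 hx)]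
          simp only [Nat.add_lt_add_iff_left, add_assoc]
      · simp [h2]
    · simp [h1]
  · by_contra hc
    have := amp_ne_zero hc
    refine e ?_
    have H : Compat s τ (fun x => p (q + x)) := by
      intro x hx
      have := this (q + x) (by omega)
      rwa [ins_add _ _ hx, add_assoc, add_assoc] at this
    exact H.closed h'

theorem amp_nest_one (p : ℕ → ℤ) : G.amp 2 (nest 1) p =
    if p 2 = p 0 ∧ (p 1 = p 0 + 1 ∨ p 1 = p 0 - 1) then G.a (p 0) (p 1) else 0 := by
  have : Compat 2 (nest 1) p ↔ p 2 = p 0 ∧ (p 1 = p 0 + 1 ∨ p 1 = p 0 - 1) := by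
    constructor
    · intro h
      exact h 0 (by omega)
    · rintro ⟨h1, h2⟩ x hx
      obtain rfl | rfl : x = 0 ∨ x = 1 := by omega
      · exact ⟨h1, h2⟩
      · refine ⟨rfl, ?_⟩
        change p 2 = p 1 + 1 ∨ p 2 = p 1 - 1
        omega
  unfold amp
  simp only [this]
  split_ifs
  · simp [prod_range_succ, nest]
  · rfl

theorem amp_cup {k j σ} (p : ℕ → ℤ) (hj : j ≤ k) :
    G.amp (k + 2) (cup j σ) p =
      if p (j + 2) = p j ∧ (p (j + 1) = p j + 1 ∨ p (j + 1) = p j - 1) then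
        G.a (p j) (p (j + 1)) * G.amp k σ (cut j 2 p) else 0 := by
  have := G.amp_ins (σ := σ) p (IsPlanar.nest 1) hj
  rw [amp_nest_one] at this
  refine this.trans ?_
  by_cases h1 : p (j + 2) = p j <;> simp [h1, mul_comm]

/-- The action of the joining of two neighbouring points on functions of walks. -/
noncomputable def T (i : ℕ) (H : (ℕ → ℤ) → ℝ) (p : ℕ → ℤ) : ℝ :=
  G.b (p i) (p i + 1) * H (detour i p (p i + 1)) + G.b (p i) (p i - 1) * H (detour i p (p i - 1))

/-- Invariance under isotopy: the weights of a maximum and a neighbouring minimum cancel, so a bend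
can be straightened. -/
theorem b_mul_a {u v : ℤ} (hu : u ∈ G.verts) (hv : v ∈ G.verts) (h : v = u + 1 ∨ v = u - 1) :
    G.b u v * G.a v u = 1 := by
  have h1 := G.ne_zero u hu
  have h2 := G.ne_zero v hv
  have h3 := G.c_sq
  unfold b a
  rw [if_pos hv]
  rcases h with rfl | rfl
  · rw [if_pos rfl, if_neg (by omega)]
    field_simp
    linear_combination h3
  · rw [if_neg (by omega), if_pos (by omega), one_mul]

/-- The value of a closed loop in a region labelled u is the sum over the two labels of its
interior, and the eigenvector equation evaluates it. A label outside `verts` is suppressed by `b`,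
and it would contribute nothing anyway as `lam` vanishes there. -/
theorem b_mul_a_add {u : ℤ} (hu : u ∈ G.verts) :
    G.b u (u + 1) * G.a u (u + 1) + G.b u (u - 1) * G.a u (u - 1) = d := by
  have h1 := G.ne_zero u hu
  have e1 : G.b u (u + 1) * G.a u (u + 1) = G.c * G.lam (u + 1) / G.lam u := by
    unfold b a
    rw [if_pos rfl, if_pos rfl]
    split_ifs with h
    · simp
    · rw [G.boundary u hu _ (.inl rfl) h]; simp
  have e2 : G.b u (u - 1) * G.a u (u - 1) = G.c * G.lam (u - 1) / G.lam u := by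
    have h3 : ¬ u - 1 = u + 1 := by omega
    unfold b a
    rw [if_neg h3, if_neg h3]
    split_ifs with h
    · simp
    · rw [G.boundary u hu _ (.inr rfl) h]; simp
  rw [e1, e2, ← add_div, ← mul_add, G.eigen u hu, mul_div_assoc, div_self h1, mul_one]

theorem b_of_notMem {u v : ℤ} (hv : v ∉ G.verts) : G.b u v = 0 := if_neg hv

theorem detour_mem {i : ℕ} {p : ℕ → ℤ} {v : ℤ} (hp : ∀ x, p x ∈ G.verts) (hv : v ∈ G.verts) (x : ℕ) :
    detour i p v x ∈ G.verts := by
  unfold detour; split_ifs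
  · exact hp _
  · exact hv
  · exact hp _

theorem T_congr {i : ℕ} {H H' : (ℕ → ℤ) → ℝ} (e : ∀ p, (∀ x, p x ∈ G.verts) → H p = H' p)
    {p : ℕ → ℤ} (hp : ∀ x, p x ∈ G.verts) : G.T i H p = G.T i H' p := by
  have : ∀ v, G.b (p i) v * H (detour i p v) = G.b (p i) v * H' (detour i p v) := by
    intro v
    by_cases hv : v ∈ G.verts
    · rw [e _ (G.detour_mem hp hv)]
    · rw [G.b_of_notMem hv, zero_mul, zero_mul]
  unfold T
  rw [this, this]

/-- If only the detour to `w` contributes, then `T` has at most one summand. -/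
theorem T_eq_single {i : ℕ} {H : (ℕ → ℤ) → ℝ} {p : ℕ → ℤ} (w : ℤ)
    (hw : w = p i + 1 ∨ w = p i - 1) (e : ∀ v, v ≠ w → H (detour i p v) = 0) :
    G.T i H p = G.b (p i) w * H (detour i p w) := by
  unfold T
  rcases hw with rfl | rfl
  · rw [e (p i - 1) (by omega)]; ring
  · rw [e (p i + 1) (by omega)]; ring

/-- The local moves of the path model. A joint at i and a small arc at j commute if they are at
least two places apart, which leads to the smaller matching of the induction hypothesis. If i = j, a
loop is closed. If they are neighbours, the joint straightens the arc. -/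
theorem T_amp_cup {k i j σ p} (h : IsPlanar k σ) (hi : i ≤ k) (hj : j ≤ k)
    (hp : ∀ x, p x ∈ G.verts)
    (ih : ∀ l i p, k = l + 2 → i ≤ l → (∀ x, p x ∈ G.verts) →
      G.T i (G.amp k σ) p = d ^ capLoop i σ * G.amp l (cap i σ) p) :
    G.T i (G.amp (k + 2) (cup j σ)) p =
      d ^ capLoop i (cup j σ) * G.amp k (cap i (cup j σ)) p := by
  have hcut : ∀ q x, cut q 2 p x ∈ G.verts := fun q x => hp _
  have A := fun p => G.amp_cup (σ := σ) p hj
  rcases Nat.lt_trichotomy i j with hij | rfl | hij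
  · rcases Nat.lt_or_ge (i + 1) j with hij' | hij'
    · obtain ⟨l, rfl⟩ : ∃ l, k = l + 2 := ⟨k - 2, by omega⟩
      obtain ⟨q, rfl⟩ : ∃ q, j = q + 2 := ⟨j - 2, by omega⟩
      obtain ⟨e1, e2⟩ := cap_ins_left h (IsPlanar.nest 1) hj (i := i) (by omega)
      have e1 : cap i (cup (q + 2) σ) = cup q (cap i σ) := e1
      have e2 : capLoop i (cup (q + 2) σ) = capLoop i σ := e2
      rw [e1, e2, G.amp_cup p (by omega)]
      have f1 : ∀ v x, i < q + x → detour i p v (q + 2 + x) = p (q + x) := by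
        intro v x hx
        unfold detour
        rw [if_neg (by omega), if_neg (by omega)]
        congr 1; omega
      have f1' : ∀ v, detour i p v (q + 2) = p q := by
        intro v
        unfold detour
        rw [if_neg (by omega), if_neg (by omega)]
        congr 1
      have f2 : ∀ v, cut (q + 2) 2 (detour i p v) = detour i (cut q 2 p) v := by
        intro v; funext x
        unfold cut detour shift
        grind
      have f3 : cut q 2 p i = p i := by
        unfold cut shift; rw [if_pos (by omega)]
      have := ih l i (cut q 2 p) rfl (by omega) (hcut _)
      unfold T at this ⊢
      rw [f3] at this
      simp only [A, f1', f2, f1 _ 1 (by omega), f1 _ 2 (by omega)]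
      split_ifs
      · linear_combination (G.a (p q) (p (q + 1))) * this
      · simp
    -- Neighbouring positions: the small arc is compatible with the detour to `p (i + 1)` only, and
    -- its weight cancels that of the joint.
    · obtain rfl : j = i + 1 := by omega
      obtain ⟨e1, e2⟩ := cap_ins_nest' (r := 0) h (q := i) (by omega)
      rw [mul_zero, ins_zero] at e1
      have e1 : cap i (cup (i + 1) σ) = σ := e1
      have e2 : capLoop i (cup (i + 1) σ) = 0 := e2
      rw [e1, e2, pow_zero, one_mul]
      have f1 : ∀ v, detour i p v (i + 1) = v := by
        intro v; unfold detour; rw [if_neg (by omega), if_pos rfl]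
      have f2 : ∀ v, detour i p v (i + 1 + 1) = p i := by
        intro v; unfold detour; rw [if_neg (by omega), if_neg (by omega)]; congr 1
      have f3 : ∀ v, detour i p v (i + 1 + 2) = p (i + 1) := by
        intro v; unfold detour; rw [if_neg (by omega), if_neg (by omega)]; congr 1
      have f4 : cut (i + 1) 2 (detour i p (p (i + 1))) = p := by
        funext x; unfold cut detour shift; grind
      by_cases hs : p (i + 1) = p i + 1 ∨ p (i + 1) = p i - 1
      · rw [G.T_eq_single (p (i + 1)) hs]
        · rw [A, f1, f2, f3, if_pos ⟨rfl, by omega⟩, f4, ← mul_assoc,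
            G.b_mul_a (hp _) (hp _) hs, one_mul]
        · intro v hv
          rw [A, f1, f2, f3, if_neg (fun hc => hv hc.1.symm)]
      -- When p makes no unit step at this point, both sides vanish.
      · have : G.amp k σ p = 0 := by
          by_contra hc
          exact hs (amp_ne_zero hc i (by omega)).2
        rw [this]
        unfold T
        simp only [A, f1, f2, f3]
        rw [if_neg (by omega), if_neg (by omega)]
        simp
  -- The closed loop: both detours lead back to p and their weights add up to d.
  · obtain ⟨-, e2⟩ := cap_ins_mid (p := i) (i := 0) h (IsPlanar.nest 1) hj (by omega)
    have e2 : capLoop i (cup i σ) = 1 := e2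
    rw [cap_cup h hj, e2, pow_one]
    have hsum := G.b_mul_a_add (hp i)
    have f0 : ∀ v, detour i p v i = p i := by
      intro v; unfold detour; rw [if_pos le_rfl]
    have f1 : ∀ v, detour i p v (i + 1) = v := by
      intro v; unfold detour; rw [if_neg (by omega), if_pos rfl]
    have f2 : ∀ v, detour i p v (i + 2) = p i := by
      intro v; unfold detour; rw [if_neg (by omega), if_neg (by omega)]; congr 1
    have f4 : ∀ v, cut i 2 (detour i p v) = p := by
      intro v; funext x; unfold cut detour shift; grind
    unfold T
    simp only [A, f0, f1, f2, f4]
    simp only [true_and, true_or, or_true, if_true]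
    linear_combination (G.amp k σ p) * hsum
  · rcases Nat.lt_or_ge (j + 1) i with hij' | hij'
    · obtain ⟨l, rfl⟩ : ∃ l, k = l + 2 := ⟨k - 2, by omega⟩
      obtain ⟨r, rfl⟩ : ∃ r, i = r + 2 := ⟨i - 2, by omega⟩
      obtain ⟨e1, e2⟩ := cap_ins_right h (IsPlanar.nest 1) (p := j) (i := r) (by omega) (by omega)
      have e1 : cap (r + 2) (cup j σ) = cup j (cap r σ) := e1
      have e2 : capLoop (r + 2) (cup j σ) = capLoop r σ := e2
      rw [e1, e2, G.amp_cup p (by omega)]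
      have f1 : ∀ v x, x ≤ 2 → detour (r + 2) p v (j + x) = p (j + x) := by
        intro v x hx; unfold detour; rw [if_pos (by omega)]
      have f1' : ∀ v, detour (r + 2) p v j = p j := fun v => f1 v 0 (by omega)
      simp only [T, A, f1', f1 _ 1 (by omega), f1 _ 2 (by omega)]
      split_ifs with hc
      · have f2 : ∀ v, cut j 2 (detour (r + 2) p v) = detour r (cut j 2 p) v := by
          intro v; funext x
          unfold cut detour shift
          grind
        -- At r = j the cut walk keeps `p j` rather than `p (j + 2)`; compatibility with the small
        -- arc makes these equal.
        have f3 : cut j 2 p r = p (r + 2) := by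
          unfold cut shift
          split_ifs
          · obtain rfl : r = j := by omega
            exact hc.1.symm
          · rfl
        have := ih l r (cut j 2 p) rfl (by omega) (hcut _)
        unfold T at this
        rw [f3] at this
        simp only [f2]
        linear_combination (G.a (p j) (p (j + 1))) * this
      · simp
    -- The mirror situation: only the detour back to `p j` survives.
    · obtain rfl : i = j + 1 := by omega
      obtain ⟨e1, e2⟩ := cap_ins_nest (r := 0) h (p := j) (by omega)
      rw [mul_zero, ins_zero] at e1
      have e1 : cap (j + 1) (cup j σ) = σ := e1
      have e2 : capLoop (j + 1) (cup j σ) = 0 := e2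
      rw [e1, e2, pow_zero, one_mul]
      have f0 : ∀ v, detour (j + 1) p v j = p j := by
        intro v; unfold detour; rw [if_pos (by omega)]
      have f1 : ∀ v, detour (j + 1) p v (j + 1) = p (j + 1) := by
        intro v; unfold detour; rw [if_pos (by omega)]
      have f2 : ∀ v, detour (j + 1) p v (j + 2) = v := by
        intro v; unfold detour; rw [if_neg (by omega), if_pos rfl]
      have f4 : cut j 2 (detour (j + 1) p (p j)) = p := by
        funext x; unfold cut detour shift; grind
      by_cases hs : p (j + 1) = p j + 1 ∨ p (j + 1) = p j - 1
      · rw [G.T_eq_single (p j) (by omega)]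
        · rw [A, f0, f1, f2, if_pos ⟨rfl, by omega⟩, f4, ← mul_assoc,
            G.b_mul_a (hp _) (hp _) (by omega), one_mul]
        · intro v hv
          rw [A, f0, f1, f2, if_neg (fun hc => hv hc.1)]
      · have : G.amp k σ p = 0 := by
          by_contra hc
          exact hs (amp_ne_zero hc j (by omega)).2
        rw [this]
        unfold T
        simp only [A, f0, f1, f2]
        rw [if_neg (by omega), if_neg (by omega)]
        simp

theorem T_amp {k i σ p} (h : IsPlanar (k + 2) σ) (hi : i ≤ k) (hp : ∀ x, p x ∈ G.verts) :
    G.T i (G.amp (k + 2) σ) p = d ^ capLoop i σ * G.amp k (cap i σ) p := by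
  refine IsPlanar.cup_induction (P := fun k σ => ∀ l i p, k = l + 2 → i ≤ l →
    (∀ x, p x ∈ G.verts) → G.T i (G.amp k σ) p = d ^ capLoop i σ * G.amp l (cap i σ) p)
    ?_ ?_ h k i p rfl hi hp
  · intro l i p hl; omega
  · intro k j σ h hj ih l i p hl hi hp
    obtain rfl : k = l := by omega
    exact G.T_amp_cup h hi hj hp ih

/-- The action of `glue` on functions of walks. -/
noncomputable def Tn (a : ℕ) : ℕ → ((ℕ → ℤ) → ℝ) → (ℕ → ℤ) → ℝ
  | 0, H => H
  | n + 1, H => Tn a n (G.T (a + n) H)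

theorem Tn_congr {a n : ℕ} {H H' : (ℕ → ℤ) → ℝ} (e : ∀ p, (∀ x, p x ∈ G.verts) → H p = H' p)
    {p : ℕ → ℤ} (hp : ∀ x, p x ∈ G.verts) : G.Tn a n H p = G.Tn a n H' p := by
  induction n generalizing H H' with
  | zero => exact e p hp
  | succ n ih => exact ih fun p hp => G.T_congr e hp

theorem Tn_smul {a n : ℕ} (r : ℝ) (H : (ℕ → ℤ) → ℝ) (p : ℕ → ℤ) :
    G.Tn a n (fun p => r * H p) p = r * G.Tn a n H p := by
  induction n generalizing H with
  | zero => rfl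
  | succ n ih =>
    simp only [Tn]
    rw [← ih]
    congr 1
    funext p
    unfold T
    ring

theorem Tn_amp {k a n σ p} (h : IsPlanar (k + 2 * n) σ) (ha : a ≤ k) (hp : ∀ x, p x ∈ G.verts) :
    G.Tn a n (G.amp (k + 2 * n) σ) p = d ^ glueLoops a n σ * G.amp k (glue a n σ) p := by
  induction n generalizing σ with
  | zero => simp [Tn, glue, glueLoops]
  | succ n ih =>
    simp only [Tn, glue, glueLoops]
    have e : ∀ p, (∀ x, p x ∈ G.verts) → G.T (a + n) (G.amp (k + 2 * (n + 1)) σ) p =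
        d ^ capLoop (a + n) σ * G.amp (k + 2 * n) (cap (a + n) σ) p :=
      fun p hp => G.T_amp (k := k + 2 * n) h (by omega) hp
    rw [G.Tn_congr e hp, Tn_smul,
      ih (IsPlanar.cap (k := k + 2 * n) h (by omega)), pow_add, mul_assoc]

end WalkWeights

/-- Extend a walk of `n` steps by one step. -/
def extend (n : ℕ) (w : ℕ → ℤ) (e : ℤ) (x : ℕ) : ℤ := if x ≤ n then w x else w n + e

open Classical in
/-- The walks of `n` steps from `u` (continued as constant). -/
noncomputable def walks (u : ℤ) : ℕ → Finset (ℕ → ℤ)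
  | 0 => {fun _ => u}
  | n + 1 => (walks u n).image (extend n · 1) ∪ (walks u n).image (extend n · (-1))

theorem mem_walks {u : ℤ} {n : ℕ} {w : ℕ → ℤ} : w ∈ walks u n ↔
    w 0 = u ∧ (∀ x < n, w (x + 1) = w x + 1 ∨ w (x + 1) = w x - 1) ∧ ∀ x, n ≤ x → w x = w n := by
  classical
  induction n generalizing w with
  | zero =>
    simp only [walks, mem_singleton]
    constructor
    · rintro rfl; simp
    · rintro ⟨h1, -, h2⟩
      funext x
      rw [h2 x x.zero_le, h1]
  | succ n ih =>
    have key : ∀ e : ℤ, e = 1 ∨ e = -1 → (w ∈ (walks u n).image (extend n · e) ↔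
        (w 0 = u ∧ (∀ x < n + 1, w (x + 1) = w x + 1 ∨ w (x + 1) = w x - 1) ∧
          ∀ x, n + 1 ≤ x → w x = w (n + 1)) ∧ w (n + 1) = w n + e) := by
      intro e he
      rw [mem_image]
      constructor
      · rintro ⟨v, hv, rfl⟩
        obtain ⟨h1, h2, h3⟩ := ih.1 hv
        have e1 : ∀ x, n < x → extend n v e x = v n + e := by
          intro x hx; unfold extend; rw [if_neg (by omega)]
        have e2 : ∀ x, x ≤ n → extend n v e x = v x := by
          intro x hx; unfold extend; rw [if_pos hx]
        refine ⟨⟨?_, ?_, ?_⟩, ?_⟩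
        · rw [e2 0 (by omega), h1]
        · intro x hx
          rcases Nat.lt_or_ge x n with h | h
          · rw [e2 x (by omega), e2 (x + 1) (by omega)]
            exact h2 x h
          · obtain rfl : x = n := by omega
            rw [e1 (x + 1) (by omega), e2 x le_rfl]
            omega
        · intro x hx
          rw [e1 x (by omega), e1 (n + 1) (by omega)]
        · rw [e1 (n + 1) (by omega), e2 n le_rfl]
      · rintro ⟨⟨h1, h2, h3⟩, h4⟩
        refine ⟨fun x => if x ≤ n then w x else w n, ih.2 ⟨?_, ?_, ?_⟩, ?_⟩
        · simpa using h1
        · intro x hx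
          simp only [show x ≤ n by omega, show x + 1 ≤ n by omega, if_true]
          exact h2 x (by omega)
        · intro x hx
          simp only [le_refl, if_true]
          split_ifs with h
          · rw [show x = n by omega]
          · rfl
        · funext x
          simp only [extend, le_refl, if_true]
          split_ifs with h
          · rfl
          · rw [h3 x (by omega), h4]
    rw [walks, mem_union, key 1 (.inl rfl), key (-1) (.inr rfl)]
    constructor
    · rintro (h | h) <;> exact h.1
    · intro h
      rcases h.2.1 n (by omega) with h' | h'
      · exact .inl ⟨h, h'⟩
      · exact .inr ⟨h, by omega⟩

theorem sum_walks_succ (u : ℤ) (n : ℕ) (g : (ℕ → ℤ) → ℝ) :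
    ∑ w ∈ walks u (n + 1), g w = ∑ w ∈ walks u n, (g (extend n w 1) + g (extend n w (-1))) := by
  classical
  have inj : ∀ e : ℤ, Set.InjOn (extend n · e) (walks u n : Set (ℕ → ℤ)) := by
    intro e w hw w' hw' h
    obtain ⟨-, -, h1⟩ := mem_walks.1 hw
    obtain ⟨-, -, h2⟩ := mem_walks.1 hw'
    have h3 : ∀ x ≤ n, w x = w' x := by
      intro x hx
      have := congrFun h x
      simpa [extend, hx] using this
    funext x
    rcases Nat.le_total x n with hx | hx
    · exact h3 x hx
    · rw [h1 x hx, h2 x hx, h3 n le_rfl]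
  rw [walks, sum_union, sum_image (inj _), sum_image (inj _), sum_add_distrib]
  rw [disjoint_left]
  intro w h1 h2
  obtain ⟨v, -, rfl⟩ := mem_image.1 h1
  obtain ⟨v', -, h⟩ := mem_image.1 h2
  have e1 := congrFun h n
  have e2 := congrFun h (n + 1)
  simp only [extend, le_refl, if_true] at e1
  simp only [extend, show ¬ n + 1 ≤ n by omega, if_false] at e2
  omega

/-- Insert the detour along a walk `w` of `n` steps and back after the point `a` of `p`. -/
def splice (a n : ℕ) (p w : ℕ → ℤ) (x : ℕ) : ℤ :=
  if x ≤ a then p x else if x ≤ a + n then w (x - a) else if x ≤ a + 2 * n then w (a + 2 * n - x)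
  else p (x - 2 * n)

/-! ### The loop pairing as a sum over walks. -/

namespace WalkWeights
variable {d : ℝ} (G : WalkWeights d)

/-- The weight of a walk of `n` steps in the trace. -/
noncomputable def weight (n : ℕ) (w : ℕ → ℤ) : ℝ := ∏ x ∈ range n, G.b (w x) (w (x + 1))

theorem weight_extend (n : ℕ) (w : ℕ → ℤ) (e : ℤ) :
    G.weight (n + 1) (extend n w e) = G.weight n w * G.b (w n) (w n + e) := by
  unfold weight
  rw [prod_range_succ]
  congr 1
  · refine prod_congr rfl fun x hx => ?_
    rw [mem_range] at hx
    simp [extend, show x ≤ n by omega, show x + 1 ≤ n by omega]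
  · simp [extend]

/-- By the recursion, a new detour is made at the turning point a + n of the excursion already
spliced in. So n detours build up a walk of n steps traversed out and back, and their factors `b`
multiply to its weight. -/
theorem Tn_eq_sum (a n : ℕ) (H : (ℕ → ℤ) → ℝ) (p : ℕ → ℤ) :
    G.Tn a n H p = ∑ w ∈ walks (p a) n, G.weight n w * H (splice a n p w) := by
  induction n generalizing H with
  | zero =>
    simp only [Tn, walks, sum_singleton, weight, range_zero, prod_empty, one_mul]
    congr 1
    funext x
    unfold splice
    split_ifs <;> first | rfl | omega
  | succ n ih =>
    rw [sum_walks_succ]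
    simp only [Tn]
    rw [ih]
    refine sum_congr rfl fun w hw => ?_
    have h0 := (mem_walks.1 hw).1
    have e1 : splice a n p w (a + n) = w n := by
      unfold splice
      rcases Nat.eq_zero_or_pos n with rfl | hn
      · simp [h0]
      · rw [if_neg (by omega), if_pos le_rfl, Nat.add_sub_cancel_left]
    have e2 : ∀ e, detour (a + n) (splice a n p w) (w n + e) =
        splice a (n + 1) p (extend n w e) := by
      intro e; funext x
      unfold detour
      by_cases h1 : x ≤ a
      · rw [if_pos (by omega)]; simp [splice, h1]
      by_cases h2 : x ≤ a + n
      · rw [if_pos h2]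
        simp [splice, h1, h2, show x ≤ a + (n + 1) by omega, extend, show x ≤ n + a by omega]
      by_cases h3 : x = a + n + 1
      · rw [if_neg h2, if_pos h3]
        simp [splice, h3, ← add_assoc, extend, show a + n + 1 - a = n + 1 by omega]
      · rw [if_neg h2, if_neg h3]
        -- The old turning point now occurs twice, just before and just after the new one; this is
        -- its second copy, the first point on the way back.
        by_cases h4 : x = a + n + 2
        · subst h4
          rw [show a + n + 2 - 2 = a + n by omega, e1]
          unfold splice
          rw [if_neg (by omega), if_neg (by omega), if_pos (by omega)]
          unfold extend
          rw [if_pos (by omega)]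
          congr 1; omega
        unfold splice
        rw [if_neg (show ¬ x - 2 ≤ a by omega), if_neg (show ¬ x - 2 ≤ a + n by omega), if_neg h1,
          if_neg (show ¬ x ≤ a + (n + 1) by omega)]
        by_cases h5 : x ≤ a + 2 * (n + 1)
        · rw [if_pos (by omega), if_pos h5]
          unfold extend
          rw [if_pos (by omega)]
          congr 1; omega
        · rw [if_neg (by omega), if_neg h5]
          congr 1; omega
    unfold T
    rw [weight_extend, weight_extend, e1, e2 1, ← sub_eq_add_neg (w n) 1, sub_eq_add_neg (w n) 1,
      e2 (-1)]
    ring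

/-- The matrix coefficients of matchings factorize the loop pairing. -/
theorem pow_pairLoops {k σ τ} (h : IsPlanar k σ) (h' : IsPlanar k τ) {u : ℤ} (hu : u ∈ G.verts) :
    d ^ pairLoops k σ τ =
      ∑ w ∈ walks u k, G.weight k w * (G.amp k σ w * G.amp k τ fun x => w (k - x)) := by
  have h2 : IsPlanar (0 + 2 * k) (ins k k σ τ) := by
    convert h.ins h' le_rfl using 1; omega
  -- All 2k points are glued, so only the empty matching remains, with coefficient 1; the constant
  -- walk is the label of the outer region.
  have := G.Tn_amp (p := fun _ => u) h2 le_rfl (fun _ => hu)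
  rw [amp_zero, mul_one, Tn_eq_sum] at this
  refine this.symm.trans (sum_congr rfl fun w hw => ?_)
  congr 1
  obtain ⟨h0, -, -⟩ := mem_walks.1 hw
  rw [show 0 + 2 * k = k + k by omega, G.amp_ins _ h' le_rfl]
  have e1 : ∀ x ≤ k, splice 0 k (fun _ => u) w x = w x := by
    intro x hx
    unfold splice
    rcases Nat.eq_zero_or_pos x with rfl | h
    · simp [h0]
    · rw [if_neg (by omega), if_pos (by omega), Nat.sub_zero]
  have e2 : ∀ x ≤ k, splice 0 k (fun _ => u) w (k + x) = w (k - x) := by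
    intro x hx
    rcases Nat.eq_zero_or_pos x with rfl | h
    · exact e1 k le_rfl
    · unfold splice
      rw [if_neg (by omega), if_neg (by omega), if_pos (by omega)]
      congr 1; omega
  have f1 : G.amp k σ (cut k k (splice 0 k (fun _ => u) w)) = G.amp k σ w := by
    refine G.amp_congr h fun x hx => ?_
    unfold cut shift
    rw [if_pos (by omega), e1 x hx]
  have f2 : G.amp k τ (fun x => splice 0 k (fun _ => u) w (k + x)) =
      G.amp k τ fun x => w (k - x) := G.amp_congr h' fun x hx => e2 x hx
  rw [f1, f2, e2 k le_rfl, e1 k le_rfl, Nat.sub_self]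
  -- A walk that does not close up has coefficient zero, so the condition from `amp_ins` may be
  -- dropped.
  split_ifs with hc
  · rfl
  · have : G.amp k σ w = 0 := by
      by_contra h3
      exact hc ((amp_ne_zero h3).closed h).symm
    rw [this, zero_mul]

/-- The weight of an arc depends only on the labels outside and inside it, and for a compatible walk
these are the same at its two ends. It therefore does not matter that the reflection exchanges the
ends. -/
theorem amp_rev {k τ} (w : ℕ → ℤ) (h : IsPlanar k τ) :
    G.amp k (rev k τ) (fun x => w (k - x)) = G.amp k τ w := by
  have hl := fun x => h.lt (x := x)
  have hi := h.invol
  have key : Compat k (rev k τ) (fun x => w (k - x)) ↔ Compat k τ w := by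
    have R : ∀ y < k, rev k τ (k - 1 - y) = k - 1 - τ y := by
      intro y hy
      unfold rev
      rw [if_pos (by omega), show k - 1 - (k - 1 - y) = y by omega]
    constructor
    · intro H y hy
      have h1 := H (k - 1 - y) (by omega)
      have h2 := H (k - 1 - τ y) (by have := hl y hy; omega)
      have := hl y hy
      simp only [R y hy, R (τ y) (hl y hy), hi] at h1 h2
      rw [show k - (k - 1 - y + 1) = y by omega, show k - (k - 1 - y) = y + 1 by omega,
        show k - (k - 1 - τ y + 1) = τ y by omega] at h1
      rw [show k - (k - 1 - y + 1) = y by omega, show k - (k - 1 - τ y) = τ y + 1 by omega] at h2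
      exact ⟨h2.1.symm, by omega⟩
    · intro H x hx
      obtain ⟨y, hy, rfl⟩ : ∃ y < k, x = k - 1 - y := ⟨k - 1 - x, by omega, by omega⟩
      have h1 := H y hy
      have h2 := H (τ y) (hl y hy)
      have := hl y hy
      rw [hi] at h2
      simp only [R y hy]
      rw [show k - (k - 1 - y + 1) = y by omega, show k - (k - 1 - y) = y + 1 by omega,
        show k - (k - 1 - τ y + 1) = τ y by omega]
      exact ⟨h2.1.symm, by omega⟩
  unfold amp
  by_cases hc : Compat k τ w
  · rw [if_pos hc, if_pos (key.2 hc), ← prod_filter, ← prod_filter]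
    -- The start x of a mirrored arc comes from the end k - 1 - x of an arc of τ; its partner is the
    -- start of that arc.
    refine prod_bij' (fun x _ => τ (k - 1 - x)) (fun y _ => k - 1 - τ y) ?_ ?_ ?_ ?_ ?_
    · intro x
      simp only [mem_filter, mem_range, hi]
      rintro ⟨h1, h2⟩
      rw [rev, if_pos h1] at h2
      have := hl (k - 1 - x) (by omega)
      omega
    · intro y
      simp only [mem_filter, mem_range]
      rintro ⟨h1, h2⟩
      have := hl y h1
      rw [rev, if_pos (by omega), show k - 1 - (k - 1 - τ y) = τ y by omega, hi]
      omega
    · intro x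
      simp only [mem_filter, mem_range, hi]
      omega
    · intro y
      simp only [mem_filter, mem_range]
      rintro ⟨h1, h2⟩
      have := hl y h1
      rw [show k - 1 - (k - 1 - τ y) = τ y by omega, hi]
    · intro x
      simp only [mem_filter, mem_range]
      rintro ⟨h1, h2⟩
      have h3 := (hc (k - 1 - x) (by omega)).1
      have h4 := (hc (τ (k - 1 - x)) (hl _ (by omega))).1
      rw [hi] at h4
      rw [h3, ← h4]
      congr 2 <;> omega
  · rw [if_neg hc, if_neg (mt key.1 hc)]

end WalkWeights

end TemperleyLieb

/-! ### Dyck paths and unitriangularity of the coefficients. -/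

namespace TemperleyLieb

open Finset

section Lead

/-- The direction of a matching at `x`: `1` at the start and `-1` at the end of an arc. -/
def dir (σ : ℕ → ℕ) (x : ℕ) : ℤ := if x < σ x then 1 else if σ x < x then -1 else 0

/-- The Dyck path of a matching. -/
def lead (σ : ℕ → ℕ) (x : ℕ) : ℤ := ∑ y ∈ range x, dir σ y

theorem lead_zero (σ : ℕ → ℕ) : lead σ 0 = 0 := rfl

theorem lead_succ (σ : ℕ → ℕ) (x : ℕ) : lead σ (x + 1) = lead σ x + dir σ x := sum_range_succ _ _

variable {k : ℕ} {σ τ : ℕ → ℕ}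

/-- No arc crosses the given one, so σ is an involution of the points from x to σ x, and it pairs
steps up with steps down. -/
theorem lead_arc (h : IsPlanar k σ) {x : ℕ} (hx : x < σ x) : lead σ (σ x + 1) = lead σ x := by
  have : ∑ y ∈ Ico x (σ x + 1), dir σ y = 0 := by
    refine sum_involution (fun y _ => σ y) ?_ ?_ ?_ ?_
    · intro y _
      have := h.invol y
      unfold dir
      rw [this]
      split_ifs <;> omega
    · intro y _ hy hc
      refine hy ?_
      unfold dir
      rw [hc]; simp
    · intro y hy
      rw [mem_Ico] at hy ⊢
      have h1 := h.noncrossing x y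
      have h2 := h.noncrossing (σ y) x
      have h3 := h.invol x
      have h4 := h.invol y
      rw [h4] at h2
      rcases Nat.lt_trichotomy x y with h5 | rfl | h5
      · by_cases h6 : y = σ x
        · subst h6; rw [h3]; omega
        · have : σ y ≠ x := by intro hc; rw [hc] at h4; omega
          have : σ y ≠ σ x := by intro hc; rw [hc, h3] at h4; omega
          omega
      · omega
      · omega
    · intro y _; exact h.invol y
  rw [sum_Ico_eq_sub _ (by omega)] at this
  unfold lead
  omega

theorem dir_of_lt {x : ℕ} (h : x < σ x) : dir σ x = 1 := by simp [dir, h]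

theorem dir_of_gt {x : ℕ} (h : σ x < x) : dir σ x = -1 := by
  simp [dir, h, show ¬ x < σ x by omega]

theorem lead_arc' (h : IsPlanar k σ) {x : ℕ} (hx : σ x < x) : lead σ (x + 1) = lead σ (σ x) := by
  have := lead_arc h (x := σ x) (by rw [h.invol]; exact hx)
  rwa [h.invol] at this

theorem lead_compat (h : IsPlanar k σ) : Compat k σ (lead σ) := by
  intro x hx
  have h1 := h.ne_self x hx
  rw [lead_succ σ x]
  rcases Nat.lt_or_ge x (σ x) with h2 | h2
  · rw [dir_of_lt h2]
    exact ⟨lead_arc h h2, .inl rfl⟩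
  · have h2 : σ x < x := by omega
    have h3 := lead_arc' h h2
    rw [lead_succ, dir_of_gt h2] at h3
    rw [dir_of_gt h2, lead_succ, dir_of_lt (by rwa [h.invol]), ← h3]
    exact ⟨by omega, .inr (by omega)⟩

theorem lead_nonneg (h : IsPlanar k σ) (x : ℕ) : 0 ≤ lead σ x := by
  induction x using Nat.strong_induction_on with
  | _ x ih =>
  rcases x with _ | x
  · simp [lead_zero]
  rcases Nat.lt_or_ge (σ x) x with h1 | h1
  · rw [lead_arc' h h1]
    exact ih _ (by omega)
  · rw [lead_succ]
    have := ih x (by omega)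
    unfold dir
    split_ifs <;> omega

theorem lead_const (h : IsPlanar k σ) {x : ℕ} (hx : k ≤ x) : lead σ x = lead σ k := by
  induction x, hx using Nat.le_induction with
  | base => rfl
  | succ x hx ih =>
    rw [lead_succ, ih]
    simp [dir, h.eq_self x hx]

/-- At the start of an arc the Dyck path rises as much as a walk can, and after its end both walks
have returned to their values before the arc. The Dyck path is thus the largest compatible walk from
0, which is the source of triangularity. -/
theorem Compat.le_lead {p : ℕ → ℤ} (h : IsPlanar k σ) (hp : Compat k σ p) (h0 : p 0 = 0) {x : ℕ}
    (hx : x ≤ k) : p x ≤ lead σ x := by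
  induction x using Nat.strong_induction_on with
  | _ x ih =>
  rcases x with _ | x
  · simp [lead_zero, h0]
  have h1 := h.ne_self x (by omega)
  have h3 := h.lt (x := x) (by omega)
  rcases Nat.lt_or_ge (σ x) x with h2 | h2
  · rw [lead_arc' h h2]
    have := (hp (σ x) h3).1
    rw [h.invol] at this
    rw [this]
    exact ih _ (by omega) (by omega)
  · rw [lead_succ, dir_of_lt (by omega)]
    have := ih x (by omega) (by omega)
    have := (hp x (by omega)).2
    omega

/-- A matching is determined by its bracket word: where j opens and j + 1 closes, noncrossing makes
j and j + 1 partners, and this small arc can be removed. -/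
theorem eq_of_lt_iff (h : IsPlanar k σ) :
    ∀ {τ}, IsPlanar k τ → (∀ x < k, x < σ x ↔ x < τ x) → σ = τ := by
  refine IsPlanar.cup_induction (P := fun k σ => ∀ {τ}, IsPlanar k τ →
    (∀ x < k, x < σ x ↔ x < τ x) → σ = τ) ?_ ?_ h
  · intro τ hτ _
    exact hτ.zero_eq_id.symm
  · intro k j σ _ hj ih τ hτ e
    have e0 := e j (by omega)
    have e1 := e (j + 1) (by omega)
    rw [cup_left] at e0
    rw [cup_right] at e1
    have h1 := hτ.ne_self (j + 1) (by omega)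
    have h2 := hτ.noncrossing (τ (j + 1)) j
    have h3 := hτ.invol (j + 1)
    have h4 : τ j ≠ j + 1 → τ (j + 1) ≠ j := by
      intro h5 h6; rw [h6] at h3; omega
    have h5 : τ j = j + 1 := by
      rw [h3] at h2; omega
    rw [← cup_cap hτ hj h5] at e ⊢
    congr 1
    refine ih (hτ.cap hj) fun x hx => ?_
    have := e (shift j 2 x) (by unfold shift; split_ifs <;> omega)
    rw [cup_shift, cup_shift] at this
    have U : ∀ y, shift j 2 x < shift j 2 y ↔ x < y := by
      intro y; unfold shift; split_ifs <;> omega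
    rwa [U, U] at this

theorem eq_of_lead_eq (h : IsPlanar k σ) (h' : IsPlanar k τ) (e : ∀ x ≤ k, lead σ x = lead τ x) :
    σ = τ := by
  refine eq_of_lt_iff h h' fun x hx => ?_
  have h1 := e x (by omega)
  have h2 := e (x + 1) (by omega)
  rw [lead_succ, lead_succ] at h2
  have h3 := h.ne_self x hx
  have h4 := h'.ne_self x hx
  unfold dir at h2
  split_ifs at h2 <;> omega

/-- Brackets are matched by induction: the first step down follows a step up, so it ends a peak; the
peak becomes a small arc and is cut off. -/
theorem exists_lead_aux (k : ℕ) : ∀ (p : ℕ → ℤ), p k = p 0 → (∀ x ≤ k, p 0 ≤ p x) →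
    (∀ x < k, p (x + 1) = p x + 1 ∨ p (x + 1) = p x - 1) →
    ∃ σ, IsPlanar k σ ∧ ∀ x < k, x < σ x ↔ p (x + 1) = p x + 1 := by
  induction k using Nat.strong_induction_on with
  | _ k ih =>
  intro p hk hp hs
  rcases Nat.eq_zero_or_pos k with rfl | hpos
  · exact ⟨id, IsPlanar.id, by omega⟩
  -- Without a step down the walk would end at `p 0 + k`.
  have hex : ∃ x, x < k ∧ p (x + 1) = p x - 1 := by
    by_contra hc
    push Not at hc
    have : ∀ x ≤ k, p x = p 0 + x := by
      intro x
      induction x with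
      | zero => simp
      | succ x ihx =>
        intro hx
        have h1 := hs x (by omega)
        have h2 := hc x (by omega)
        have h3 := ihx (by omega)
        push_cast
        omega
    have := this k le_rfl
    omega
  classical
  -- The first step down; it is not the initial step, since the walk stays at or above `p 0`.
  obtain ⟨h1, h2⟩ := Nat.find_spec hex
  have hmin := fun y => Nat.find_min hex (m := y)
  generalize Nat.find hex = x at *
  obtain ⟨i, rfl⟩ : ∃ i, x = i + 1 := by
    refine ⟨x - 1, ?_⟩
    rcases x with _ | x
    · have := hp 1 (by omega)
      rw [zero_add] at h2
      omega
    · rfl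
  have h3 : p (i + 1) = p i + 1 := by
    have := hs i (by omega)
    have := hmin i (by omega)
    omega
  obtain ⟨k, rfl⟩ : ∃ l, k = l + 2 := ⟨k - 2, by omega⟩
  have e : p (i + 2) = p i := by
    rw [show i + 2 = i + 1 + 1 from rfl, h2, h3]; omega
  have R1 : ∀ y, p (shift i 2 y + 1) = cut i 2 p (y + 1) := by
    intro y; unfold cut; congr 1; unfold shift; split_ifs <;> omega
  have R2 := cut_congr e
  have R0 : cut i 2 p 0 = p 0 := by simp [cut, shift]
  obtain ⟨σ, hσ, e'⟩ := ih k (by omega) (cut i 2 p)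
    (by
      rw [R0, ← hk, ← R2]
      by_cases hik : k < i
      · omega
      · congr 1; unfold shift; split_ifs; rfl)
    (by
      intro x hx
      rw [R0]
      exact hp _ (by unfold shift; split_ifs <;> omega))
    (by
      intro x hx
      rw [← R1, ← R2]
      exact hs _ (by unfold shift; split_ifs <;> omega))
  refine ⟨cup i σ, hσ.cup (by omega), fun x hx => ?_⟩
  obtain ⟨u, rfl⟩ | ⟨v, hv, rfl⟩ := shift_or i 2 x
  · have U : ∀ y, shift i 2 u < shift i 2 y ↔ u < y := by
      intro y; unfold shift; split_ifs <;> omega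
    rw [cup_shift, U, R1, R2]
    exact e' u (by revert hx; unfold shift; split_ifs <;> omega)
  · obtain rfl | rfl : v = 0 ∨ v = 1 := by omega
    · rw [add_zero, cup_left]
      omega
    · rw [cup_right]
      rw [h2]
      omega

open Classical in
/-- The Dyck paths of length `k`. -/
noncomputable def dyck (k : ℕ) : Finset (ℕ → ℤ) :=
  (walks 0 k).filter fun w => w k = 0 ∧ ∀ x, 0 ≤ w x

theorem lead_mem_dyck (h : IsPlanar k σ) : lead σ ∈ dyck k := by
  classical
  rw [dyck, mem_filter, mem_walks]
  refine ⟨⟨lead_zero σ, fun x hx => ?_, fun x hx => lead_const h hx⟩, ?_, lead_nonneg h⟩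
  · exact (lead_compat h x hx).2
  · rw [(lead_compat h).closed h, lead_zero]

theorem exists_lead_eq {w : ℕ → ℤ} (hw : w ∈ dyck k) : ∃ σ, IsPlanar k σ ∧ lead σ = w := by
  classical
  rw [dyck, mem_filter, mem_walks] at hw
  obtain ⟨⟨h0, h1, h2⟩, h3, h4⟩ := hw
  obtain ⟨σ, hσ, e⟩ := exists_lead_aux k w (by rw [h3, h0]) (fun x _ => by rw [h0]; exact h4 x) h1
  refine ⟨σ, hσ, funext fun x => ?_⟩
  have key : ∀ x ≤ k, lead σ x = w x := by
    intro x
    induction x with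
    | zero => intro _; rw [lead_zero, h0]
    | succ x ih =>
      intro hx
      have a1 := e x (by omega)
      have a2 := h1 x (by omega)
      have a3 := hσ.ne_self x (by omega)
      rw [lead_succ, ih (by omega)]
      unfold dir
      split_ifs <;> omega
  rcases Nat.le_total x k with hx | hx
  · exact key x hx
  · rw [lead_const hσ hx, h2 x hx, key k le_rfl]

end Lead

namespace WalkWeights
variable {d : ℝ} (G : WalkWeights d)

/-- Along its Dyck path each arc starts with a step up, and `a` is normalized to be 1 on such steps.
-/
theorem amp_lead {k σ} (h : IsPlanar k σ) : G.amp k σ (lead σ) = 1 := by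
  unfold amp
  rw [if_pos (lead_compat h)]
  refine prod_eq_one fun x _ => ?_
  split_ifs with hx
  · unfold a
    rw [if_pos]
    rw [lead_succ, dir_of_lt hx]
  · rfl

/-- The matrix coefficients of linear combinations of diagrams. -/
noncomputable def eval {m n : ℕ} (w : ℕ → ℤ) : (KauffmanDiagram m n →₀ ℂ) →ₗ[ℂ] ℂ :=
  Finsupp.linearCombination ℂ fun D => (G.amp (m + n) D.1 w : ℂ)

theorem eval_single {m n : ℕ} (w : ℕ → ℤ) (D : KauffmanDiagram m n) (x : ℂ) :
    G.eval w (Finsupp.single D x) = x * G.amp (m + n) D.1 w := by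
  rw [eval, Finsupp.linearCombination_single, smul_eq_mul]

/-- In the support of f, a diagram D is chosen whose Dyck path has the largest area. Another diagram
with nonzero coefficient at this path would have a Dyck path above it by `le_lead`, hence the same
path and the same matching. So f(D) is the whole value at this path. Nothing is required of `verts`
here. -/
theorem eq_zero_of_eval {m n : ℕ} {f : KauffmanDiagram m n →₀ ℂ}
    (hf : ∀ w ∈ dyck (m + n), G.eval w f = 0) : f = 0 := by
  by_contra hne
  obtain ⟨D, hD, hmax⟩ := exists_max_image f.support
    (fun D => ∑ x ∈ range (m + n + 1), lead D.1 x) (Finsupp.support_nonempty_iff.2 hne)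
  have := hf _ (lead_mem_dyck D.2)
  rw [eval, Finsupp.linearCombination_apply, Finsupp.sum,
    sum_eq_single D, G.amp_lead D.2, Complex.ofReal_one, smul_eq_mul, mul_one] at this
  · exact Finsupp.mem_support_iff.1 hD this
  · intro E hE hED
    by_contra hc
    have hc : G.amp (m + n) E.1 (lead D.1) ≠ 0 := by
      intro h; rw [h] at hc; simp at hc
    have hle : ∀ x ∈ range (m + n + 1), lead D.1 x ≤ lead E.1 x := fun x hx =>
      (amp_ne_zero hc).le_lead E.2 (lead_zero _) (by rw [mem_range] at hx; omega)
    have := (sum_eq_sum_iff_of_le hle).1 (le_antisymm (sum_le_sum hle) (hmax E hE))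
    exact hED (Subtype.ext (eq_of_lead_eq E.2 D.2 fun x hx =>
      (this x (by rw [mem_range]; omega)).symm))
  · intro h; exact absurd hD h

/-- There are at least as many diagrams as Dyck paths, since each Dyck path comes from a matching.
By the comparison of dimensions, injectivity of the evaluation implies surjectivity. -/
theorem exists_eval_eq {m n : ℕ} (g : (ℕ → ℤ) → ℂ) :
    ∃ f : KauffmanDiagram m n →₀ ℂ, ∀ w ∈ dyck (m + n), G.eval w f = g w := by
  classical
  have := Fintype.ofFinite (KauffmanDiagram m n)
  let Φ : (KauffmanDiagram m n →₀ ℂ) →ₗ[ℂ] ({w // w ∈ dyck (m + n)} → ℂ) :=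
    LinearMap.pi fun w => G.eval w.1
  have hinj : Function.Injective Φ := by
    rw [← LinearMap.ker_eq_bot, LinearMap.ker_eq_bot']
    intro f hf
    exact G.eq_zero_of_eval fun w hw => congrFun hf ⟨w, hw⟩
  have hcard : Module.finrank ℂ (KauffmanDiagram m n →₀ ℂ) =
      Module.finrank ℂ ({w // w ∈ dyck (m + n)} → ℂ) := by
    refine le_antisymm (LinearMap.finrank_le_finrank_of_injective hinj) ?_
    rw [Module.finrank_finsupp_self, Module.finrank_fintype_fun_eq_card]
    refine Fintype.card_le_of_surjective (fun D => ⟨lead D.1, lead_mem_dyck D.2⟩) ?_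
    rintro ⟨w, hw⟩
    obtain ⟨σ, hσ, e⟩ := exists_lead_eq hw
    exact ⟨⟨σ, hσ⟩, Subtype.ext e⟩
  obtain ⟨f, hf⟩ := (LinearMap.injective_iff_surjective_of_finrank_eq_finrank hcard).1 hinj
    fun w => g w.1
  exact ⟨f, fun w hw => congrFun hf ⟨w, hw⟩⟩

theorem mem_verts_of_weight_ne_zero {n : ℕ} {w : ℕ → ℤ} (h : G.weight n w ≠ 0) (h0 : w 0 ∈ G.verts)
    {x : ℕ} (hx : x ≤ n) : w x ∈ G.verts := by
  rcases x with _ | x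
  · exact h0
  by_contra hc
  exact h (prod_eq_zero (mem_range.2 hx) (G.b_of_notMem hc))

/-- A step up carries c times a positive factor and a step down the factor 1. The number j of steps
up is determined by the length and the end points. -/
theorem weight_sign {n : ℕ} {w : ℕ → ℤ}
    (hs : ∀ x < n, w (x + 1) = w x + 1 ∨ w (x + 1) = w x - 1)
    (hv : ∀ x ≤ n, w x ∈ G.verts) (hpos : ∀ x ≤ n, 0 < G.lam (w x)) :
    ∃ j : ℕ, 2 * (j : ℤ) = n + w n - w 0 ∧ 0 < G.c ^ j * G.weight n w := by
  induction n with
  | zero => exact ⟨0, by simp, by simp [weight]⟩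
  | succ n ih =>
    obtain ⟨j, h1, h2⟩ := ih (fun x hx => hs x (by omega)) (fun x hx => hv x (by omega))
      fun x hx => hpos x (by omega)
    have e : G.weight (n + 1) w = G.weight n w * G.b (w n) (w (n + 1)) := prod_range_succ _ _
    have p1 := hpos n (by omega)
    have p2 := hpos (n + 1) le_rfl
    rcases hs n (by omega) with h3 | h3
    · refine ⟨j + 1, by push_cast; omega, ?_⟩
      rw [e, b, if_pos (hv _ le_rfl), if_pos h3, show G.c ^ (j + 1) * (G.weight n w *
        (G.c * G.lam (w (n + 1)) / G.lam (w n))) = (G.c * G.c) * ((G.c ^ j * G.weight n w) *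
        (G.lam (w (n + 1)) / G.lam (w n))) by ring, G.c_sq]
      positivity
    · refine ⟨j, by push_cast; omega, ?_⟩
      rw [e, b, if_pos (hv _ le_rfl), if_neg (by omega), mul_one]
      exact h2

end WalkWeights

end TemperleyLieb

/-! ### The reflected star operation and the Markov trace in coefficients. -/

namespace TemperleyLieb

open Finset CategoryTheory MonoidalCategory

section Rev
variable {d : ℂ}

/-- The conjugate linear extension of the reflection of diagrams. -/
noncomputable def revHom {m n : ℕ} (f : KauffmanDiagram m n →₀ ℂ) : KauffmanDiagram n m →₀ ℂ :=
  (f.mapDomain KauffmanDiagram.reflect).mapRange (starRingEnd ℂ) (map_zero _)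

theorem revHom_zero {m n : ℕ} : revHom (0 : KauffmanDiagram m n →₀ ℂ) = 0 := by
  simp [revHom]

theorem revHom_single {m n : ℕ} (D : KauffmanDiagram m n) (x : ℂ) :
    revHom (Finsupp.single D x) = Finsupp.single D.reflect (starRingEnd ℂ x) := by
  rw [revHom, Finsupp.mapDomain_single, Finsupp.mapRange_single]

theorem revHom_add {m n : ℕ} (f g : KauffmanDiagram m n →₀ ℂ) :
    revHom (f + g) = revHom f + revHom g := by
  rw [revHom, Finsupp.mapDomain_add, Finsupp.mapRange_add (map_add _)]; rfl

theorem revHom_smul {m n : ℕ} (c : ℂ) (f : KauffmanDiagram m n →₀ ℂ) :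
    revHom (c • f) = starRingEnd ℂ c • revHom f := by
  rw [revHom, Finsupp.mapDomain_smul]
  ext x
  simp [revHom]

theorem revHom_revHom {m n : ℕ} (f : KauffmanDiagram m n →₀ ℂ) : revHom (revHom f) = f := by
  induction f using Finsupp.induction_linear with
  | zero => rw [revHom_zero, revHom_zero]
  | add f g hf hg => rw [revHom_add, revHom_add, hf, hg]
  | single D x => rw [revHom_single, revHom_single, D.reflect_reflect, Complex.conj_conj]

/-- The star operation `D ↦ c ^ ♯(D) D'` on the Temperley–Lieb category. -/
noncomputable def starTL (c : ℂ) {X Y : TL d} (f : X ⟶ Y) : Y ⟶ X :=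
  c ^ (((X.strands : ℤ) - Y.strands) / 2) • (revHom f : KauffmanDiagram X.strands Y.strands →₀ ℂ)

variable {c : ℂ} {X Y Z X' Y' : TL d}

theorem starTL_single (D : KauffmanDiagram Y.strands X.strands) (x : ℂ) :
    starTL c (show X ⟶ Y from Finsupp.single D x) =
      Finsupp.single D.reflect (c ^ D.arcIndex * starRingEnd ℂ x) := by
  unfold starTL
  rw [revHom_single, D.arcIndex_eq]
  exact Finsupp.smul_single _ _ _

theorem starTL_diagram {m n : ℕ} (D : KauffmanDiagram m n) :
    starTL c (diagram d D) = c ^ D.arcIndex • diagram d D.reflect := by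
  have := starTL_single (d := d) (X := ⟨n⟩) (Y := ⟨m⟩) (c := c) D 1
  refine this.trans ?_
  rw [map_one]
  exact (Finsupp.smul_single (c ^ D.arcIndex) D.reflect (1 : ℂ)).symm

theorem starTL_zero : starTL c (0 : X ⟶ Y) = 0 := by
  unfold starTL
  exact (congrArg (_ • ·) revHom_zero).trans (smul_zero _)

theorem starTL_add (f g : X ⟶ Y) : starTL c (f + g) = starTL c f + starTL c g := by
  unfold starTL
  exact (congrArg _ (revHom_add _ _)).trans (smul_add _ _ _)

theorem starTL_smul (r : ℂ) (f : X ⟶ Y) : starTL c (r • f) = starRingEnd ℂ r • starTL c f := by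
  unfold starTL
  exact (congrArg _ (revHom_smul _ _)).trans (smul_comm _ _ _)

theorem starTL_starTL (hc : starRingEnd ℂ c = c) (hc0 : c ≠ 0) (f : X ⟶ Y) :
    starTL c (starTL c f) = f := by
  induction f using TL.hom_induction with
  | zero => rw [starTL_zero, starTL_zero]
  | add f g hf hg => rw [starTL_add, starTL_add, hf, hg]
  | single D x =>
    rw [starTL_single, starTL_single, D.reflect_reflect]
    have h1 := D.two_mul_arcIndex
    have h2 := D.reflect.two_mul_arcIndex
    have : D.reflect.arcIndex = -D.arcIndex := by omega
    rw [this, map_mul, map_zpow₀, hc, Complex.conj_conj, ← mul_assoc, ← zpow_add₀ hc0]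
    simp

theorem starTL_comp (hd : starRingEnd ℂ d = d) (hc0 : c ≠ 0) (f : X ⟶ Y)
    (g : Y ⟶ Z) : starTL c (f ≫ g) = starTL c g ≫ starTL c f := by
  induction f using TL.hom_induction with
  | zero => simp only [starTL_zero, Limits.zero_comp, Limits.comp_zero]
  | add f g hf hg => simp only [starTL_add, Preadditive.add_comp, Preadditive.comp_add, hf, hg]
  | single D x =>
  induction g using TL.hom_induction with
  | zero => simp only [starTL_zero, Limits.zero_comp, Limits.comp_zero]
  | add f g hf hg => simp only [starTL_add, Preadditive.add_comp, Preadditive.comp_add, hf, hg]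
  | single E y =>
    have e := compHom_single d E D y x
    refine (congrArg (starTL c) e).trans ?_
    rw [starTL_single, starTL_single, starTL_single]
    refine .trans ?_ (compHom_single d D.reflect E.reflect _ _).symm
    rw [← (E.reflect_comp D).1, (E.reflect_comp D).2]
    congr 1
    have h1 := D.two_mul_arcIndex
    have h2 := E.two_mul_arcIndex
    have h3 := (E.comp D).two_mul_arcIndex
    have : (E.comp D).arcIndex = D.arcIndex + E.arcIndex := by omega
    rw [this, zpow_add₀ hc0, map_mul, map_mul, map_pow, hd]
    ring

theorem starTL_tensor (hc0 : c ≠ 0) (f : X ⟶ Y) (g : X' ⟶ Y') :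
    starTL c (f ⊗ₘ g) = starTL c f ⊗ₘ starTL c g := by
  induction f using TL.hom_induction with
  | zero => simp only [starTL_zero, TL.zero_tensor]
  | add f g hf hg => simp only [starTL_add, TL.add_tensor, hf, hg]
  | single D x =>
  induction g using TL.hom_induction with
  | zero => simp only [starTL_zero, TL.tensor_zero]
  | add f g hf hg => simp only [starTL_add, TL.tensor_add, hf, hg]
  | single E y =>
    have e := tensorMap_single D E x y
    refine (congrArg (starTL c) e).trans ?_
    refine (starTL_single (X := X ⊗ X') (Y := Y ⊗ Y') (D.tensor E) (x * y)).trans ?_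
    rw [starTL_single, starTL_single]
    refine .trans ?_ (tensorMap_single D.reflect E.reflect _ _).symm
    rw [D.reflect_tensor]
    congr 1
    have h1 := D.two_mul_arcIndex
    have h2 := E.two_mul_arcIndex
    have h3 := (D.tensor E).two_mul_arcIndex
    push_cast at h3
    have : (D.tensor E).arcIndex = D.arcIndex + E.arcIndex := by omega
    rw [this, zpow_add₀ hc0, map_mul]
    ring

theorem starTL_eqToHom (h : X = Y) : starTL c (eqToHom h) = eqToHom h.symm := by
  subst h
  rw [eqToHom_refl, TL.id_def]
  refine (starTL_single (KauffmanDiagram.one X.strands) 1).trans ?_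
  rw [KauffmanDiagram.reflect_one, KauffmanDiagram.arcIndex_eq]
  simp

end Rev

theorem markovTrace_comp_single {d : ℂ} {X Y : TL d} (D : KauffmanDiagram Y.strands X.strands)
    (E : KauffmanDiagram X.strands Y.strands) (x y : ℂ) :
    markovTrace Y ((show Y ⟶ X from Finsupp.single E y) ≫ (show X ⟶ Y from Finsupp.single D x)) =
      x * y * d ^ pairLoops (Y.strands + X.strands) D.1 E.1 := by
  have e := compHom_single d D E x y
  refine (congrArg (markovTrace Y) e).trans ?_
  refine (Finsupp.linearCombination_single ℂ _ _).trans ?_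
  rw [smul_eq_mul, mul_assoc, ← pow_add, KauffmanDiagram.loops_add_closureLoops]

namespace WalkWeights
variable {d : ℝ} (G : WalkWeights d)

theorem markovTrace_comp {X Y : TL (d : ℂ)} (f : X ⟶ Y) (g : Y ⟶ X) {u : ℤ} (hu : u ∈ G.verts) :
    markovTrace Y (g ≫ f) = ∑ w ∈ walks u (Y.strands + X.strands),
      (G.weight (Y.strands + X.strands) w : ℂ) *
        (G.eval w f * G.eval (fun x => w (Y.strands + X.strands - x)) g) := by
  induction f using TL.hom_induction with
  | zero =>
    rw [Limits.comp_zero, map_zero]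
    refine (sum_eq_zero fun w _ => ?_).symm
    rw [(G.eval w).map_zero, zero_mul, mul_zero]
  | add f f' hf hf' =>
    rw [Preadditive.comp_add, map_add, hf, hf', ← sum_add_distrib]
    refine sum_congr rfl fun w _ => ?_
    rw [(G.eval w).map_add]
    ring
  | single D x =>
  induction g using TL.hom_induction with
  | zero =>
    rw [Limits.zero_comp, map_zero]
    refine (sum_eq_zero fun w _ => ?_).symm
    rw [(G.eval _).map_zero, mul_zero, mul_zero]
  | add f f' hf hf' =>
    rw [Preadditive.add_comp, map_add, hf, hf', ← sum_add_distrib]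
    refine sum_congr rfl fun w _ => ?_
    rw [(G.eval _).map_add]
    ring
  | single E y =>
    refine (markovTrace_comp_single D E x y).trans ?_
    have e2 : IsPlanar (Y.strands + X.strands) E.1 := by
      rw [add_comm]; exact E.2
    have := G.pow_pairLoops D.2 e2 hu
    rw [← Complex.ofReal_pow, this, Complex.ofReal_sum, mul_sum]
    refine sum_congr rfl fun w _ => ?_
    have e3 : G.amp (Y.strands + X.strands) E.1 = G.amp (X.strands + Y.strands) E.1 :=
      congrArg (fun t => G.amp t E.1) (add_comm _ _)
    rw [eval_single, eval_single, e3]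
    push_cast
    ring

theorem eval_revHom {m n : ℕ} (f : KauffmanDiagram m n →₀ ℂ) (w : ℕ → ℤ) :
    G.eval (fun x => w (m + n - x)) (revHom f) = starRingEnd ℂ (G.eval w f) := by
  induction f using Finsupp.induction_linear with
  | zero => rw [revHom_zero, map_zero, map_zero, map_zero]
  | add f g hf hg => rw [revHom_add, map_add, map_add, map_add, hf, hg]
  | single D x =>
    rw [revHom_single, eval_single, eval_single, map_mul, Complex.conj_ofReal, D.reflect_val,
      add_comm n m, G.amp_rev w D.2]

theorem eval_congr {m n : ℕ} (f : KauffmanDiagram m n →₀ ℂ) {w w' : ℕ → ℤ}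
    (h : ∀ x ≤ m + n, w x = w' x) : G.eval w f = G.eval w' f := by
  unfold eval
  congr 2
  funext D
  rw [G.amp_congr D.2 h]

theorem eval_eq_zero {m n : ℕ} (f : KauffmanDiagram m n →₀ ℂ) {w : ℕ → ℤ}
    (h : ∀ σ, ¬ (IsPlanar (m + n) σ ∧ Compat (m + n) σ w)) : G.eval w f = 0 := by
  induction f using Finsupp.induction_linear with
  | zero => rw [map_zero]
  | add f g hf hg => rw [map_add, hf, hg, add_zero]
  | single D x =>
    rw [eval_single]
    by_cases hc : G.amp (m + n) D.1 w = 0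
    · rw [hc]; simp
    · exact absurd ⟨D.2, amp_ne_zero hc⟩ (h D.1)

/-- This is matrix multiplication in the path model, with summation over the labels along the common
edge. It serves to show that vanishing of coefficients is inherited by composites. -/
theorem eval_compHom {a b c : ℕ} (f : KauffmanDiagram a b →₀ ℂ) (g : KauffmanDiagram b c →₀ ℂ)
    {p : ℕ → ℤ} (hp : ∀ x, p x ∈ G.verts) :
    G.eval p (compHom d a b c f g) = ∑ w ∈ walks (p a) b, (G.weight b w : ℂ) *
      if splice a b p w (a + b + (b + c)) = splice a b p w (a + b) then
        G.eval (cut (a + b) (b + c) (splice a b p w)) f *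
          G.eval (fun x => splice a b p w (a + b + x)) g else 0 := by
  induction f using Finsupp.induction_linear with
  | zero => simp
  | add f f' hf hf' =>
    simp only [map_add, LinearMap.add_apply, hf, hf', ← sum_add_distrib]
    refine sum_congr rfl fun w _ => ?_
    split_ifs <;> ring
  | single D x =>
  induction g using Finsupp.induction_linear with
  | zero => simp
  | add f f' hf hf' =>
    simp only [map_add, hf, hf', ← sum_add_distrib]
    refine sum_congr rfl fun w _ => ?_
    split_ifs <;> ring
  | single E y =>
    have h : IsPlanar (a + c + 2 * b) (ins (a + b) (b + c) D.1 E.1) := by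
      convert D.2.ins E.2 le_rfl using 1; omega
    have h1 := G.Tn_amp (a := a) h (by omega) hp
    rw [Tn_eq_sum] at h1
    have h1 : _ = d ^ D.loops E * G.amp (a + c) (D.comp E).1 p := h1
    rw [compHom_single, eval_single, mul_assoc, ← Complex.ofReal_pow, ← Complex.ofReal_mul, ← h1,
      Complex.ofReal_sum, mul_sum]
    refine sum_congr rfl fun w _ => ?_
    rw [show a + c + 2 * b = a + b + (b + c) by omega, G.amp_ins _ E.2 le_rfl, eval_single,
      eval_single]
    split_ifs
    · push_cast; ring
    · simp

theorem eval_tensorMap {a b a' b' : ℕ} (f : KauffmanDiagram a b →₀ ℂ)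
    (g : KauffmanDiagram a' b' →₀ ℂ) (p : ℕ → ℤ) :
    G.eval p (tensorMap a b a' b' f g) = if p (a + (a' + b')) = p a then
      G.eval (cut a (a' + b') p) f * G.eval (fun x => p (a + x)) g else 0 := by
  induction f using Finsupp.induction_linear with
  | zero => simp
  | add f f' hf hf' =>
    simp only [map_add, LinearMap.add_apply, hf, hf']
    split_ifs <;> ring
  | single D x =>
  induction g using Finsupp.induction_linear with
  | zero => simp
  | add f f' hf hf' =>
    simp only [map_add, hf, hf']
    split_ifs <;> ring
  | single E y =>
    rw [tensorMap_single, eval_single, eval_single, eval_single]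
    have := G.amp_ins (σ := D.1) p E.2 (q := a) (k := a + b) (by omega)
    rw [show a + b + (a' + b') = a + a' + (b + b') by omega] at this
    have e : (D.tensor E).1 = ins a (a' + b') D.1 E.1 := rfl
    rw [e, this]
    split_ifs
    · push_cast; ring
    · simp

theorem splice_mem {a n : ℕ} {p w : ℕ → ℤ} (hp : ∀ x, p x ∈ G.verts)
    (hw : ∀ x ≤ n, w x ∈ G.verts) (x : ℕ) : splice a n p w x ∈ G.verts := by
  unfold splice
  split_ifs
  · exact hp _
  · exact hw _ (by omega)
  · exact hw _ (by omega)
  · exact hp _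

/-- The tensor ideal of the morphisms whose matrix coefficients vanish. -/
noncomputable def kerIdeal : TensorIdeal (TL (d : ℂ)) where
  carrier X Y := ⨅ (p : ℕ → ℤ) (_ : ∀ x, p x ∈ G.verts), LinearMap.ker
    (G.eval p : (KauffmanDiagram Y.strands X.strands →₀ ℂ) →ₗ[ℂ] ℂ)
  comp_mem {X Y Z f} g hf := by
    simp only [Submodule.mem_iInf, LinearMap.mem_ker] at hf ⊢
    intro p hp
    refine (G.eval_compHom g f hp).trans (sum_eq_zero fun w hw => ?_)
    -- Walks that leave `verts` have weight zero; for the others the spliced walk stays in `verts`,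
    -- where the coefficients of f vanish.
    by_cases h0 : G.weight Y.strands w = 0
    · rw [h0]; simp
    have h1 := fun x hx => G.mem_verts_of_weight_ne_zero h0
      (by rw [(mem_walks.1 hw).1]; exact hp _) (x := x) hx
    rw [hf _ fun x => G.splice_mem hp h1 _]
    simp
  mem_comp {X Y Z} f g hg := by
    simp only [Submodule.mem_iInf, LinearMap.mem_ker] at hg ⊢
    intro p hp
    refine (G.eval_compHom g f hp).trans (sum_eq_zero fun w hw => ?_)
    by_cases h0 : G.weight Y.strands w = 0
    · rw [h0]; simp
    have h1 := fun x hx => G.mem_verts_of_weight_ne_zero h0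
      (by rw [(mem_walks.1 hw).1]; exact hp _) (x := x) hx
    rw [hg (cut (Z.strands + Y.strands) (Y.strands + X.strands) (splice Z.strands Y.strands p w))
      fun x => G.splice_mem hp h1 _]
    simp
  tensor_mem {X Y X' Y' f} g hf := by
    simp only [Submodule.mem_iInf, LinearMap.mem_ker] at hf ⊢
    intro p hp
    refine (G.eval_tensorMap f g p).trans ?_
    rw [hf (cut _ _ _) fun x => hp _]
    simp
  mem_tensor {X Y X' Y'} f g hg := by
    simp only [Submodule.mem_iInf, LinearMap.mem_ker] at hg ⊢
    intro p hp
    refine (G.eval_tensorMap f g p).trans ?_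
    rw [hg _ fun x => hp _]
    simp

theorem mem_kerIdeal {X Y : TL (d : ℂ)} {f : X ⟶ Y} :
    f ∈ G.kerIdeal.carrier X Y ↔ ∀ p : ℕ → ℤ, (∀ x, p x ∈ G.verts) → G.eval p f = 0 := by
  simp only [kerIdeal, Submodule.mem_iInf, LinearMap.mem_ker]

/-- The sesquilinear trace form in terms of matrix coefficients. -/
theorem markovTrace_comp_revHom {X Y : TL (d : ℂ)} (f : X ⟶ Y) {u : ℤ} (hu : u ∈ G.verts) :
    markovTrace X (f ≫ (show Y ⟶ X from revHom f)) = ∑ w ∈ walks u (X.strands + Y.strands),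
      (G.weight (X.strands + Y.strands) w : ℂ) *
        ((‖G.eval (fun x => w (X.strands + Y.strands - x)) f‖ ^ 2 : ℝ) : ℂ) := by
  rw [G.markovTrace_comp _ _ hu]
  refine sum_congr rfl fun w _ => ?_
  congr 1
  have e := G.eval_revHom f (fun x => w (X.strands + Y.strands - x))
  have e2 : G.eval (fun x => w (X.strands + Y.strands - (Y.strands + X.strands - x))) (revHom f) =
      G.eval w (revHom f) := by
    refine G.eval_congr _ fun x hx => ?_
    congr 1; omega
  rw [← e2]
  refine (congrArg (· * _) e).trans ?_
  rw [mul_comm, Complex.mul_conj, Complex.normSq_eq_norm_sq]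

/-- If `lam` is positive, the trace form is positive semidefinite up to sign, and its kernel
consists of the morphisms with vanishing matrix coefficients. -/
theorem trace_form (hpos : ∀ u ∈ G.verts, 0 < G.lam u) {X Y : TL (d : ℂ)} (f : X ⟶ Y) {u : ℤ}
    (hu : u ∈ G.verts) : ∃ r : ℝ, 0 ≤ r ∧
      markovTrace X (f ≫ (show Y ⟶ X from revHom f)) =
        ((G.c ^ ((X.strands + Y.strands) / 2) * r : ℝ) : ℂ) ∧
      (r = 0 → ∀ p : ℕ → ℤ, (∀ x, p x ∈ G.verts) → p 0 = u → G.eval p f = 0) := by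
  set k := X.strands + Y.strands with hk
  have hf0 : ∀ w : ℕ → ℤ, (∃ σ, IsPlanar k σ ∧ Compat k σ w) ∨ G.eval w f = 0 := by
    intro w
    by_cases h : ∃ σ, IsPlanar k σ ∧ Compat k σ w
    · exact .inl h
    · refine .inr (G.eval_eq_zero f fun σ hσ => h ⟨σ, ?_⟩)
      rwa [hk, add_comm]
  have hcc : (G.c ^ (k / 2)) * (G.c ^ (k / 2)) = 1 := by
    rw [← mul_pow, G.c_sq, one_pow]
  have key : ∀ w ∈ walks u k, 0 ≤ G.c ^ (k / 2) * (G.weight k w * ‖G.eval (fun x => w (k - x)) f‖ ^ 2) ∧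
      (G.c ^ (k / 2) * (G.weight k w * ‖G.eval (fun x => w (k - x)) f‖ ^ 2) = 0 →
        (∀ x ≤ k, w x ∈ G.verts) → G.eval (fun x => w (k - x)) f = 0) := by
    intro w hw
    obtain ⟨h0, h1, h2⟩ := mem_walks.1 hw
    rcases hf0 fun x => w (k - x) with ⟨σ, hσ, hc⟩ | h3
    swap
    · rw [h3]; simp
    by_cases hv : ∀ x ≤ k, w x ∈ G.verts
    · obtain ⟨j, hj, hjp⟩ := G.weight_sign h1 hv fun x hx => hpos _ (hv x hx)
      have h4 := hc.closed hσ
      simp only [Nat.sub_self, Nat.sub_zero] at h4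
      -- A closed walk of k steps goes up in exactly half of them.
      have : j = k / 2 := by omega
      rw [this] at hjp
      rw [← mul_assoc]
      refine ⟨by positivity, fun h _ => ?_⟩
      rcases mul_eq_zero.1 h with h | h
      · exact absurd h hjp.ne'
      · simpa using h
    · have : G.weight k w = 0 := by
        by_contra hne
        exact hv fun x hx => G.mem_verts_of_weight_ne_zero hne (by rw [h0]; exact hu) hx
      rw [this]
      refine ⟨by simp, fun _ h => absurd h hv⟩
  refine ⟨∑ w ∈ walks u k, G.c ^ (k / 2) * (G.weight k w * ‖G.eval (fun x => w (k - x)) f‖ ^ 2),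
    sum_nonneg fun w hw => (key w hw).1, ?_, ?_⟩
  · rw [G.markovTrace_comp_revHom f hu, ← mul_sum, ← mul_assoc, hcc, one_mul]
    push_cast
    rfl
  · intro hr p hp hp0
    rw [sum_eq_zero_iff_of_nonneg fun w hw => (key w hw).1] at hr
    rcases hf0 p with ⟨σ, hσ, hc⟩ | h
    swap
    · exact h
    have hcl := hc.closed hσ
    -- Truncated subtraction makes the reversed walk constant beyond k, as `walks` demands, whatever
    -- p does there.
    have hw : (fun x => p (k - x)) ∈ walks u k := by
      rw [mem_walks]
      refine ⟨by rw [Nat.sub_zero, hcl, hp0], fun x hx => ?_, fun x hx => ?_⟩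
      · have := (hc (k - (x + 1)) (by omega)).2
        rw [show k - (x + 1) + 1 = k - x by omega] at this
        omega
      · rw [Nat.sub_self, Nat.sub_eq_zero_of_le hx]
    have := (key _ hw).2 (hr _ hw) fun x _ => hp _
    rw [← this]
    refine G.eval_congr f fun x hx => ?_
    congr 1; omega

/-- A negligible f can be tested against its own reflection, where definiteness of the trace form
makes its coefficients vanish. Conversely, the trace pairing sees only coefficients at walks inside
`verts`. -/
theorem negligible_eq (hpos : ∀ u ∈ G.verts, 0 < G.lam u) (hne : G.verts.Nonempty)
    (X Y : TL (d : ℂ)) : negligible X Y = (G.kerIdeal.carrier X Y : Set (X ⟶ Y)) := by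
  obtain ⟨u₀, hu₀⟩ := hne
  ext f
  rw [SetLike.mem_coe, mem_kerIdeal]
  constructor
  · intro hf p hp
    have e := G.eval_revHom f p
    have h := hf (show Y ⟶ X from revHom f)
    -- The trace may be expanded from any vertex of `verts`. The one chosen is the starting point of
    -- the reversed walk.
    obtain ⟨r, -, h2, h3⟩ := G.trace_form hpos (show Y ⟶ X from revHom f)
      (hp (Y.strands + X.strands))
    have e1 : (show X ⟶ Y from revHom (revHom f)) = f := revHom_revHom f
    have h2 : markovTrace Y ((show Y ⟶ X from revHom f) ≫ (show X ⟶ Y from revHom (revHom f))) = _ := h2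
    rw [e1, h] at h2
    have h4 : r = 0 := by
      have := Complex.ofReal_eq_zero.1 h2.symm
      refine (mul_eq_zero.1 this).resolve_left (pow_ne_zero _ fun hc => ?_)
      have := G.c_sq
      rw [hc] at this
      simp at this
    have := h3 h4 (fun x => p (Y.strands + X.strands - x)) (fun x => hp _) rfl
    have e : G.eval (fun x => p (Y.strands + X.strands - x)) (revHom f) = _ := e
    rw [this] at e
    exact (map_eq_zero _).1 e.symm
  · intro hf g
    rw [G.markovTrace_comp f g hu₀]
    refine sum_eq_zero fun w hw => ?_
    by_cases h0 : G.weight (Y.strands + X.strands) w = 0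
    · rw [h0]; simp
    have h1 := fun x hx => G.mem_verts_of_weight_ne_zero h0
      (by rw [(mem_walks.1 hw).1]; exact hu₀) (x := x) hx
    rw [hf w, zero_mul, mul_zero]
    intro x
    rcases Nat.le_total x (Y.strands + X.strands) with hx | hx
    · exact h1 x hx
    · rw [(mem_walks.1 hw).2.2 x hx]
      exact h1 _ le_rfl

/-- The negligible morphisms already form the tensor ideal `kerIdeal`, so generating an ideal from
them adds nothing. -/
theorem negligibleIdeal_eq (hpos : ∀ u ∈ G.verts, 0 < G.lam u) (hne : G.verts.Nonempty)
    (X Y : TL (d : ℂ)) : (negligibleIdeal (d : ℂ)).carrier X Y = G.kerIdeal.carrier X Y := by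
  refine le_antisymm ?_ ?_
  · refine iInf₂_le G.kerIdeal fun X Y => ?_
    rw [G.negligible_eq hpos hne]
  · refine le_iInf₂ fun I hI => ?_
    have := hI X Y
    rwa [G.negligible_eq hpos hne] at this

end WalkWeights

end TemperleyLieb

/-! ### C*-norms from positive faithful functionals. -/

namespace TemperleyLieb

open CategoryTheory MonoidalCategory

section Core
variable {V : Type*} [AddCommGroup V] [Module ℂ V]

theorem core_norm_add_le (K : InnerProductSpace.Core ℂ V) (x y : V) :
    √(K.inner (x + y) (x + y)).re ≤ √(K.inner x x).re + √(K.inner y y).re := by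
  let := K.toNormedAddCommGroup
  exact norm_add_le x y

theorem core_norm_inner_le (K : InnerProductSpace.Core ℂ V) (x y : V) :
    ‖K.inner x y‖ ≤ √(K.inner x x).re * √(K.inner y y).re := by
  let := K.toNormedAddCommGroup
  let : InnerProductSpace ℂ V := InnerProductSpace.ofCore K.toCore
  exact norm_inner_le_norm x y

variable [FiniteDimensional ℂ V]

theorem core_exists_bound (K : InnerProductSpace.Core ℂ V) (L : V →ₗ[ℂ] V) :
    ∃ B : ℝ, 0 ≤ B ∧ ∀ x, (K.inner (L x) x).re ≤ B * (K.inner x x).re := by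
  let := K.toNormedAddCommGroup
  let : InnerProductSpace ℂ V := InnerProductSpace.ofCore K.toCore
  refine ⟨‖L.toContinuousLinearMap‖, norm_nonneg _, fun x => ?_⟩
  have h1 : (inner ℂ (L x) x).re ≤ ‖inner ℂ (L x) x‖ := Complex.re_le_norm _
  have h2 : ‖inner ℂ (L x) x‖ ≤ ‖L x‖ * ‖x‖ := norm_inner_le_norm _ _
  have h3 : ‖L x‖ ≤ ‖L.toContinuousLinearMap‖ * ‖x‖ := L.toContinuousLinearMap.le_opNorm x
  have h4 : ‖x‖ * ‖x‖ = (K.inner x x).re := (inner_self_eq_norm_mul_norm (𝕜 := ℂ) x).symm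
  rw [← h4, ← mul_assoc]
  exact h1.trans (h2.trans (mul_le_mul_of_nonneg_right h3 (norm_nonneg x)))

/-- Positive operators have symmetric square roots in their bicommutant. -/
theorem exists_sqrt {E : Type*} [NormedAddCommGroup E] [InnerProductSpace ℂ E]
    [FiniteDimensional ℂ E] (L : E →ₗ[ℂ] E) (hs : L.IsSymmetric)
    (hp : ∀ x, 0 ≤ (inner ℂ (L x) x).re) :
    ∃ Q : E →ₗ[ℂ] E, Q.IsSymmetric ∧ (∀ x, Q (Q x) = L x) ∧
      ∀ R : E →ₗ[ℂ] E, (∀ x, R (L x) = L (R x)) → ∀ x, R (Q x) = Q (R x) := by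
  have : CompleteSpace E := FiniteDimensional.complete ℂ E
  let T : E →L[ℂ] E := L.toContinuousLinearMap
  have hT : 0 ≤ T := (ContinuousLinearMap.nonneg_iff_isPositive T).2 ⟨hs, hp⟩
  have hQ : 0 ≤ CFC.sqrt T := CFC.sqrt_nonneg T
  have hQQ := CFC.sqrt_mul_sqrt_self T hT
  refine ⟨(CFC.sqrt T : E →L[ℂ] E), ?_, fun x => congrArg (fun S : E →L[ℂ] E => S x) hQQ, ?_⟩
  · exact ((ContinuousLinearMap.nonneg_iff_isPositive _).1 hQ).1
  · intro R hR x
    -- The functional calculus of T commutes with everything that commutes with T.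
    have hc : Commute T R.toContinuousLinearMap := by
      ext x; exact (hR x).symm
    have := hc.cfc_nnreal NNReal.sqrt
    rw [← CFC.sqrt_eq_cfc] at this
    exact (congrArg (fun S : E →L[ℂ] E => S x) this.eq).symm

theorem core_exists_sqrt (K : InnerProductSpace.Core ℂ V) (L : V →ₗ[ℂ] V)
    (hs : ∀ x y, K.inner (L x) y = K.inner x (L y)) (hp : ∀ x, 0 ≤ (K.inner (L x) x).re) :
    ∃ Q : V →ₗ[ℂ] V, (∀ x y, K.inner (Q x) y = K.inner x (Q y)) ∧ (∀ x, Q (Q x) = L x) ∧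
      ∀ R : V →ₗ[ℂ] V, (∀ x, R (L x) = L (R x)) → ∀ x, R (Q x) = Q (R x) := by
  let := K.toNormedAddCommGroup
  let : InnerProductSpace ℂ V := InnerProductSpace.ofCore K.toCore
  exact exists_sqrt L hs hp

/-- Completeness is automatic in finite dimension, for any norm. -/
theorem exists_limit_of_norm (nrm : V → ℝ) (eq_zero : ∀ f, nrm f = 0 → f = 0)
    (nonneg : ∀ f, 0 ≤ nrm f)
    (add_le : ∀ f g, nrm (f + g) ≤ nrm f + nrm g) (smul : ∀ (c : ℂ) f, nrm (c • f) = ‖c‖ * nrm f)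
    (u : ℕ → V) (hu : ∀ ε : ℝ, 0 < ε → ∃ N : ℕ, ∀ m n : ℕ, N ≤ m → N ≤ n → nrm (u m - u n) < ε) :
    ∃ f, ∀ ε : ℝ, 0 < ε → ∃ N : ℕ, ∀ n : ℕ, N ≤ n → nrm (u n - f) < ε := by
  let : Norm V := ⟨nrm⟩
  have core : NormedSpace.Core ℂ V :=
    { norm_nonneg := nonneg
      norm_smul := smul
      norm_triangle := add_le
      norm_eq_zero_iff := fun x => ⟨eq_zero x, by
        rintro rfl
        have := smul 0 0
        rw [norm_zero, zero_mul, zero_smul] at this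
        exact this⟩ }
  let : NormedAddCommGroup V := NormedAddCommGroup.ofCore core
  let : NormedSpace ℂ V := NormedSpace.ofCore core
  have : CompleteSpace V := FiniteDimensional.complete ℂ V
  have hc : CauchySeq u := Metric.cauchySeq_iff.2 fun ε hε => by
    obtain ⟨N, hN⟩ := hu ε hε
    refine ⟨N, fun m hm n hn => ?_⟩
    rw [dist_eq_norm]
    exact hN m n hm hn
  obtain ⟨f, hf⟩ := cauchySeq_tendsto_of_complete hc
  refine ⟨f, fun ε hε => ?_⟩
  obtain ⟨N, hN⟩ := Metric.tendsto_atTop.1 hf ε hε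
  refine ⟨N, fun n hn => ?_⟩
  have := hN n hn
  rw [dist_eq_norm] at this
  exact this

end Core

section Abstract
universe v u

/-- A star operation on a linear category together with positive faithful functionals. -/
structure FaithfulStar (C : Type u) [Category.{v} C] [Preadditive C] [Linear ℂ C] where
  star : ∀ {X Y : C}, (X ⟶ Y) → (Y ⟶ X)
  star_add : ∀ {X Y : C} (f g : X ⟶ Y), star (f + g) = star f + star g
  star_smul : ∀ {X Y : C} (c : ℂ) (f : X ⟶ Y), star (c • f) = (starRingEnd ℂ c) • star f
  star_star : ∀ {X Y : C} (f : X ⟶ Y), star (star f) = f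
  star_comp : ∀ {X Y Z : C} (f : X ⟶ Y) (g : Y ⟶ Z), star (f ≫ g) = star g ≫ star f
  state : ∀ X : C, (X ⟶ X) →ₗ[ℂ] ℂ
  state_pos : ∀ {X Y : C} (f : X ⟶ Y), ∃ r : ℝ, 0 ≤ r ∧ state X (f ≫ star f) = r ∧ (r = 0 → f = 0)

namespace FaithfulStar
variable {C : Type u} [Category.{v} C] [Preadditive C] [Linear ℂ C] (S : FaithfulStar C)

/-- The sesquilinear form on morphisms. -/
def form {X Y : C} (f g : X ⟶ Y) : ℂ := S.state X (g ≫ S.star f)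

theorem form_add_left {X Y : C} (f f' g : X ⟶ Y) :
    S.form (f + f') g = S.form f g + S.form f' g := by
  rw [form, S.star_add, Preadditive.comp_add, map_add]; rfl

theorem form_add_right {X Y : C} (f g g' : X ⟶ Y) :
    S.form f (g + g') = S.form f g + S.form f g' := by
  rw [form, Preadditive.add_comp, map_add]; rfl

theorem form_smul_left {X Y : C} (f g : X ⟶ Y) (c : ℂ) :
    S.form (c • f) g = starRingEnd ℂ c * S.form f g := by
  rw [form, S.star_smul, Linear.comp_smul, map_smul]; rfl

theorem form_smul_right {X Y : C} (f g : X ⟶ Y) (c : ℂ) :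
    S.form f (c • g) = c * S.form f g := by
  rw [form, Linear.smul_comp, map_smul]; rfl

theorem form_self {X Y : C} (f : X ⟶ Y) :
    (S.form f f).im = 0 ∧ 0 ≤ (S.form f f).re ∧ (S.form f f = 0 → f = 0) := by
  obtain ⟨r, h1, h2, h3⟩ := S.state_pos f
  unfold form
  rw [h2]
  exact ⟨Complex.ofReal_im r, h1, fun h => h3 (Complex.ofReal_eq_zero.1 h)⟩

/-- Polarization: the form is real on the diagonal, in particular at f + g and f + ig. -/
theorem form_symm {X Y : C} (f g : X ⟶ Y) : starRingEnd ℂ (S.form g f) = S.form f g := by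
  have h1 := (S.form_self (f + g)).1
  have h2 := (S.form_self (f + Complex.I • g)).1
  simp only [form_add_left, form_add_right, form_smul_left, form_smul_right, Complex.add_im,
    Complex.add_re, (S.form_self f).1, (S.form_self g).1, Complex.mul_im, Complex.conj_I,
    Complex.neg_re, Complex.neg_im, Complex.I_re, Complex.I_im, Complex.mul_re] at h1 h2
  apply Complex.ext
  · rw [Complex.conj_re]; linarith
  · rw [Complex.conj_im]; linarith

/-- The inner product on morphisms. -/
@[reducible]
noncomputable def core (X Y : C) : InnerProductSpace.Core ℂ (X ⟶ Y) where
  inner := S.form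
  conj_inner_symm f g := S.form_symm f g
  re_inner_nonneg f := (S.form_self f).2.1
  add_left f f' g := S.form_add_left f f' g
  smul_left f g c := S.form_smul_left f g c
  definite f := (S.form_self f).2.2

/-- The norm of the inner product on morphisms. -/
noncomputable def size {X Y : C} (f : X ⟶ Y) : ℝ := √(S.form f f).re

theorem size_nonneg {X Y : C} (f : X ⟶ Y) : 0 ≤ S.size f := Real.sqrt_nonneg _

theorem size_sq {X Y : C} (f : X ⟶ Y) : S.size f ^ 2 = (S.form f f).re :=
  Real.sq_sqrt (S.form_self f).2.1

theorem size_add_le {X Y : C} (f g : X ⟶ Y) : S.size (f + g) ≤ S.size f + S.size g :=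
  core_norm_add_le (S.core X Y) f g

theorem norm_form_le {X Y : C} (f g : X ⟶ Y) : ‖S.form f g‖ ≤ S.size f * S.size g :=
  core_norm_inner_le (S.core X Y) f g

theorem size_smul {X Y : C} (c : ℂ) (f : X ⟶ Y) : S.size (c • f) = ‖c‖ * S.size f := by
  unfold size
  rw [form_smul_left, form_smul_right, ← mul_assoc, ← Complex.normSq_eq_conj_mul_self,
    Complex.re_ofReal_mul, Real.sqrt_mul (Complex.normSq_nonneg c), Complex.normSq_eq_norm_sq,
    Real.sqrt_sq (norm_nonneg c)]

theorem eq_zero_of_size {X Y : C} {f : X ⟶ Y} (h : S.size f = 0) : f = 0 := by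
  refine (S.form_self f).2.2 (Complex.ext ?_ (S.form_self f).1)
  rw [← S.size_sq, h]; simp

theorem form_comp_left {X Y Z : C} (f : X ⟶ Y) (a : Y ⟶ Z) (g : X ⟶ Z) :
    S.form (f ≫ a) g = S.form f (g ≫ S.star a) := by
  rw [form, form, S.star_comp, Category.assoc]

theorem form_comp_right {X Y Z : C} (f : X ⟶ Z) (a : Y ⟶ Z) (g : X ⟶ Y) :
    S.form f (g ≫ a) = S.form (f ≫ S.star a) g := by
  rw [form_comp_left, S.star_star]

variable [∀ X Y : C, Module.Finite ℂ (X ⟶ Y)]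

/-- Positive endomorphisms are of the form `b* b`. -/
theorem exists_eq_comp_star {X : C} (h : X ⟶ X) (hs : S.star h = h)
    (hp : ∀ f : X ⟶ X, 0 ≤ (S.form (f ≫ h) f).re) : ∃ b : X ⟶ X, h = b ≫ S.star b := by
  -- Composition with h on one side is a positive operator on End(X), and its square root Q commutes
  -- with composition on the other side.
  obtain ⟨Q, h1, h2, h3⟩ := core_exists_sqrt (S.core X X) (Linear.rightComp ℂ X h)
    (fun f g => (S.form_comp_left f h g).trans (by rw [hs]; rfl)) hp
  have h1 : ∀ f g, S.form (Q f) g = S.form f (Q g) := h1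
  -- Hence Q is itself composition with the endomorphism Q(1), the desired b.
  have hQ : ∀ f, Q f = f ≫ Q (𝟙 X) := by
    intro f
    have := h3 (Linear.leftComp ℂ X f) (fun x => (Category.assoc f x h).symm) (𝟙 X)
    simp only [Linear.leftComp_apply, Category.comp_id] at this
    exact this.symm
  refine ⟨Q (𝟙 X), ?_⟩
  -- Symmetry of Q says that b and its star have the same inner product with every f, and the form
  -- is definite.
  have hb : S.star (Q (𝟙 X)) = Q (𝟙 X) := by
    have key : ∀ f : X ⟶ X, S.form f (S.star (Q (𝟙 X)) - Q (𝟙 X)) = 0 := by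
      intro f
      have e1 := h1 f (𝟙 X)
      rw [hQ f, form_comp_left, Category.id_comp] at e1
      rw [sub_eq_add_neg, form_add_right, e1, ← form_add_right, add_neg_cancel]
      unfold form; simp
    exact sub_eq_zero.1 ((S.form_self _).2.2 (key _))
  rw [hb, ← hQ, h2]
  simp

/-- The bound must be uniform in X. It is found on the single finite-dimensional space End(Y), where
it makes B·1 - `a ≫ star a` positive, hence of the form `b ≫ star b`. This identity bounds `f ≫ a`
for f from any X, since the size of `f ≫ b` is nonnegative. -/
theorem exists_size_comp_le {Y Z : C} (a : Y ⟶ Z) :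
    ∃ B : ℝ, 0 ≤ B ∧ ∀ (X : C) (f : X ⟶ Y), S.size (f ≫ a) ≤ B * S.size f := by
  obtain ⟨B, hB, h⟩ := core_exists_bound (S.core Y Y) (Linear.rightComp ℂ Y (a ≫ S.star a))
  have h : ∀ f : Y ⟶ Y, (S.form (f ≫ a ≫ S.star a) f).re ≤ B * (S.form f f).re := h
  obtain ⟨b, hb⟩ := S.exists_eq_comp_star ((B : ℂ) • 𝟙 Y + (-1 : ℂ) • (a ≫ S.star a))
    (by
      have h1 : S.star (𝟙 Y) = 𝟙 Y := by
        have := S.star_comp (S.star (𝟙 Y)) (𝟙 Y)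
        rwa [Category.comp_id, S.star_star, Category.comp_id, eq_comm] at this
      rw [S.star_add, S.star_smul, S.star_smul, h1, S.star_comp, S.star_star, Complex.conj_ofReal,
        map_neg, map_one])
    (by
      intro f
      rw [Preadditive.comp_add, Linear.comp_smul, Linear.comp_smul, Category.comp_id,
        form_add_left, form_smul_left, form_smul_left, Complex.add_re, Complex.conj_ofReal,
        Complex.re_ofReal_mul, map_neg, map_one, neg_one_mul, Complex.neg_re]
      linarith [h f])
  refine ⟨√B, Real.sqrt_nonneg B, fun X f => ?_⟩
  have h2 : S.form (f ≫ (b ≫ S.star b)) f = S.form (f ≫ b) (f ≫ b) := by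
    rw [← Category.assoc, form_comp_left, S.star_star]
  rw [← hb, Preadditive.comp_add, Linear.comp_smul, Linear.comp_smul, Category.comp_id,
    form_add_left, form_smul_left, form_smul_left, Complex.conj_ofReal, map_neg, map_one,
    neg_one_mul, ← Category.assoc, form_comp_left, S.star_star] at h2
  have h3 := congrArg Complex.re h2
  rw [Complex.add_re, Complex.re_ofReal_mul, Complex.neg_re] at h3
  have h4 := (S.form_self (f ≫ b)).2.1
  unfold size
  rw [← Real.sqrt_mul hB]
  exact Real.sqrt_le_sqrt (by linarith)

/-- The operator norm of postcomposition. -/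
noncomputable def opNorm {Y Z : C} (a : Y ⟶ Z) : ℝ :=
  sInf {B : ℝ | 0 ≤ B ∧ ∀ (X : C) (f : X ⟶ Y), S.size (f ≫ a) ≤ B * S.size f}

theorem opNorm_le {Y Z : C} {a : Y ⟶ Z} {B : ℝ} (hB : 0 ≤ B)
    (h : ∀ (X : C) (f : X ⟶ Y), S.size (f ≫ a) ≤ B * S.size f) : S.opNorm a ≤ B :=
  csInf_le ⟨0, fun _ h => h.1⟩ ⟨hB, h⟩

theorem opNorm_nonneg {Y Z : C} (a : Y ⟶ Z) : 0 ≤ S.opNorm a :=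
  le_csInf (S.exists_size_comp_le a) fun _ h => h.1

theorem size_comp_le {X Y Z : C} (f : X ⟶ Y) (a : Y ⟶ Z) :
    S.size (f ≫ a) ≤ S.opNorm a * S.size f := by
  rcases (S.size_nonneg f).eq_or_lt with h | h
  · rw [S.eq_zero_of_size h.symm, Limits.zero_comp]
    have : S.size (0 : X ⟶ Z) = 0 := by unfold size form; simp
    have h0 : S.size (0 : X ⟶ Y) = 0 := by unfold size form; simp
    rw [this, h0, mul_zero]
  · rw [← div_le_iff₀ h]
    exact le_csInf (S.exists_size_comp_le a) fun B hB => (div_le_iff₀ h).2 (hB.2 X f)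

theorem opNorm_comp_le {X Y Z : C} (a : X ⟶ Y) (b : Y ⟶ Z) :
    S.opNorm (a ≫ b) ≤ S.opNorm a * S.opNorm b := by
  refine S.opNorm_le (mul_nonneg (S.opNorm_nonneg a) (S.opNorm_nonneg b)) fun W f => ?_
  rw [← Category.assoc]
  refine (S.size_comp_le _ b).trans ?_
  rw [mul_comm (S.opNorm a), mul_assoc]
  exact mul_le_mul_of_nonneg_left (S.size_comp_le f a) (S.opNorm_nonneg b)

/-- Cauchy–Schwarz, because the squared size of `f ≫ a` is the inner product of f with `f ≫ a ≫ star
a`. -/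
theorem opNorm_sq_le {X Y : C} (a : X ⟶ Y) : S.opNorm a ^ 2 ≤ S.opNorm (a ≫ S.star a) := by
  have h0 := S.opNorm_nonneg (a ≫ S.star a)
  have : S.opNorm a ≤ √(S.opNorm (a ≫ S.star a)) := by
    refine S.opNorm_le (Real.sqrt_nonneg _) fun W f => ?_
    rw [← Real.sqrt_sq (S.size_nonneg f), ← Real.sqrt_mul h0]
    refine Real.sqrt_le_sqrt ?_
    rw [form_comp_right, Category.assoc]
    refine (Complex.re_le_norm _).trans ((S.norm_form_le _ _).trans ?_)
    rw [sq, ← mul_assoc]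
    exact mul_le_mul_of_nonneg_right (S.size_comp_le f _) (S.size_nonneg f)
  calc S.opNorm a ^ 2 ≤ √(S.opNorm (a ≫ S.star a)) ^ 2 :=
        pow_le_pow_left₀ (S.opNorm_nonneg a) this 2
    _ = _ := Real.sq_sqrt h0

/-- From ‖a‖² ≤ ‖a‖ ‖a*‖ one factor ‖a‖ cancels; applied to a* as well, this makes the star
isometric. -/
theorem opNorm_star_le {X Y : C} (a : X ⟶ Y) : S.opNorm a ≤ S.opNorm (S.star a) := by
  have h1 := (S.opNorm_sq_le a).trans (S.opNorm_comp_le a (S.star a))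
  rcases (S.opNorm_nonneg a).eq_or_lt with h | h
  · rw [← h]; exact S.opNorm_nonneg _
  · rw [sq] at h1
    exact le_of_mul_le_mul_left h1 h

theorem isCStarNorm : IsCStarNorm (C := C) S.star S.opNorm := by
  have hz : ∀ {X Y : C} (a : X ⟶ Y), S.opNorm a = 0 → a = 0 := by
    intro X Y a h
    have := S.size_comp_le (𝟙 X) a
    rw [h, zero_mul, Category.id_comp] at this
    exact S.eq_zero_of_size (le_antisymm this (S.size_nonneg a))
  have hadd : ∀ {X Y : C} (a b : X ⟶ Y), S.opNorm (a + b) ≤ S.opNorm a + S.opNorm b := by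
    intro X Y a b
    refine S.opNorm_le (add_nonneg (S.opNorm_nonneg a) (S.opNorm_nonneg b)) fun W f => ?_
    rw [Preadditive.comp_add, add_mul]
    exact (S.size_add_le _ _).trans (add_le_add (S.size_comp_le f a) (S.size_comp_le f b))
  have hsmul' : ∀ {X Y : C} (c : ℂ) (a : X ⟶ Y), S.opNorm (c • a) ≤ ‖c‖ * S.opNorm a := by
    intro X Y c a
    refine S.opNorm_le (mul_nonneg (norm_nonneg c) (S.opNorm_nonneg a)) fun W f => ?_
    rw [Linear.comp_smul, size_smul, mul_assoc]
    exact mul_le_mul_of_nonneg_left (S.size_comp_le f a) (norm_nonneg c)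
  have hsmul : ∀ {X Y : C} (c : ℂ) (a : X ⟶ Y), S.opNorm (c • a) = ‖c‖ * S.opNorm a := by
    intro X Y c a
    refine le_antisymm (hsmul' c a) ?_
    by_cases hc : c = 0
    · rw [hc, norm_zero, zero_mul]; exact S.opNorm_nonneg _
    · have := hsmul' c⁻¹ (c • a)
      rw [smul_smul, inv_mul_cancel₀ hc, one_smul, norm_inv] at this
      have hc' : 0 < ‖c‖ := norm_pos_iff.2 hc
      calc ‖c‖ * S.opNorm a ≤ ‖c‖ * (‖c‖⁻¹ * S.opNorm (c • a)) :=
            mul_le_mul_of_nonneg_left this hc'.le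
        _ = _ := by rw [← mul_assoc, mul_inv_cancel₀ hc'.ne', one_mul]
  exact
    { nonneg := S.opNorm_nonneg
      eq_zero := hz
      add_le := hadd
      smul := hsmul
      complete := fun {X Y} u hu =>
        exists_limit_of_norm (V := X ⟶ Y) S.opNorm hz S.opNorm_nonneg hadd hsmul u hu
      comp_le := S.opNorm_comp_le
      cstar := fun {X Y} f => by
        refine le_antisymm ?_ (S.opNorm_sq_le f)
        have h1 := S.opNorm_star_le (S.star f)
        rw [S.star_star] at h1
        rw [sq]
        exact (S.opNorm_comp_le _ _).trans (mul_le_mul_of_nonneg_left h1 (S.opNorm_nonneg f)) }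

theorem positive {X Y : C} (f : X ⟶ Y) : ∃ g : X ⟶ X, f ≫ S.star f = g ≫ S.star g := by
  refine S.exists_eq_comp_star _ (by rw [S.star_comp, S.star_star]) fun x => ?_
  rw [← Category.assoc, form_comp_left, S.star_star]
  exact (S.form_self _).2.1

end FaithfulStar

end Abstract

end TemperleyLieb

/-! ### C*-tensor structures from positive weights. -/

namespace TemperleyLieb

open CategoryTheory MonoidalCategory

section Unit
variable {d : ℂ}

theorem markovTrace_id_unit : markovTrace (⟨0⟩ : TL d) (𝟙 _) = 1 := by
  rw [TL.id_def]
  refine (Finsupp.linearCombination_single ℂ _ _).trans ?_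
  have : (KauffmanDiagram.one 0).closureLoops = 0 := rfl
  rw [this, pow_zero, smul_eq_mul, one_mul]

theorem eq_smul_id_unit (f : (⟨0⟩ : TL d) ⟶ ⟨0⟩) : f = markovTrace _ f • 𝟙 _ := by
  induction f using TL.hom_induction with
  | zero => rw [map_zero, zero_smul]
  | add f g hf hg => rw [map_add, add_smul, ← hf, ← hg]
  | single D x =>
    have hD : D = KauffmanDiagram.one 0 := by
      refine Subtype.ext ?_
      rw [IsPlanar.zero_eq_id D.2]
      exact (IsPlanar.zero_eq_id (KauffmanDiagram.one 0).2).symm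
    subst hD
    have : (Finsupp.single (KauffmanDiagram.one 0) x : (⟨0⟩ : TL d) ⟶ ⟨0⟩) = x • 𝟙 (⟨0⟩ : TL d) := by
      rw [TL.id_def]
      refine Eq.symm ((Finsupp.smul_single x _ (1 : ℂ)).trans ?_)
      rw [smul_eq_mul, mul_one]
    refine this.trans ?_
    have h2 := congrArg (markovTrace (⟨0⟩ : TL d)) this
    rw [map_smul, markovTrace_id_unit, smul_eq_mul, mul_one] at h2
    exact congrArg (· • 𝟙 (⟨0⟩ : TL d)) h2.symm

theorem isTensorCategory_TL (d : ℂ) : IsTensorCategory (TL d) where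
  finite_hom X Y := inferInstanceAs
    (Module.Finite ℂ (KauffmanDiagram Y.strands X.strands →₀ ℂ))
  end_unit f := by
    refine ⟨markovTrace (⟨0⟩ : TL d) f, eq_smul_id_unit f, fun c hc => ?_⟩
    have := congrArg (markovTrace (⟨0⟩ : TL d)) hc
    refine Eq.trans ?_ this.symm
    refine Eq.symm ((map_smul _ c _).trans ?_)
    refine (congrArg (c • ·) markovTrace_id_unit).trans ?_
    rw [smul_eq_mul, mul_one]
  tensor_assoc X Y Z := ⟨TL.tensor_assoc X Y Z, TL.associator_hom X Y Z⟩
  unit_tensor X := ⟨TL.unit_tensor X, TL.leftUnitor_hom X⟩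
  tensor_unit X := ⟨TL.tensor_unit X, TL.rightUnitor_hom X⟩

theorem homMk_eqToHom {I : TensorIdeal (TL d)} {X Y : TL d} (h : X = Y) :
    (TensorQuotient.homMk (eqToHom h) : (⟨X⟩ : TensorQuotient I) ⟶ ⟨Y⟩) =
      eqToHom (congrArg TensorQuotient.mk h) := by
  subst h; rfl

instance (I : TensorIdeal (TL d)) (X Y : TensorQuotient I) : Module.Finite ℂ (X ⟶ Y) :=
  have : Module.Finite ℂ (X.obj ⟶ Y.obj) := (isTensorCategory_TL d).finite_hom _ _
  inferInstanceAs (Module.Finite ℂ ((X.obj ⟶ Y.obj) ⧸ I.carrier X.obj Y.obj))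

instance (X Y : TL d) : Module.Finite ℂ (X ⟶ Y) := (isTensorCategory_TL d).finite_hom _ _

theorem isTensorCategory_quotient (I : TensorIdeal (TL d))
    (hI : 𝟙 (𝟙_ (TL d)) ∉ I.carrier (𝟙_ (TL d)) (𝟙_ (TL d))) :
    IsTensorCategory (TensorQuotient I) where
  finite_hom X Y := inferInstance
  end_unit f := by
    obtain ⟨f, rfl⟩ := TensorQuotient.mk_surj f
    refine ⟨markovTrace (⟨0⟩ : TL d) f, ?_, fun c hc => ?_⟩
    · refine (congrArg TensorQuotient.homMk (eq_smul_id_unit f)).trans ?_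
      rfl
    · have h1 : (TensorQuotient.homMk f : (⟨𝟙_ (TL d)⟩ : TensorQuotient I) ⟶ ⟨𝟙_ (TL d)⟩) =
        TensorQuotient.homMk (c • 𝟙 (𝟙_ (TL d))) := hc
      have h2 := TensorQuotient.mk_eq_mk.1 h1
      have h3 : f - c • 𝟙 (𝟙_ (TL d)) = (markovTrace (⟨0⟩ : TL d) f - c) • 𝟙 (𝟙_ (TL d)) := by
        rw [sub_smul]
        exact congrArg (· - _) (eq_smul_id_unit f)
      rw [h3] at h2
      by_contra hne
      refine hI ?_
      have := (I.carrier _ _).smul_mem (markovTrace (⟨0⟩ : TL d) f - c)⁻¹ h2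
      rwa [smul_smul, inv_mul_cancel₀ (sub_ne_zero.2 (Ne.symm hne)), one_smul] at this
  tensor_assoc X Y Z := ⟨congrArg TensorQuotient.mk (TL.tensor_assoc X.obj Y.obj Z.obj),
    homMk_eqToHom (TL.tensor_assoc X.obj Y.obj Z.obj)⟩
  unit_tensor X := ⟨congrArg TensorQuotient.mk (TL.unit_tensor X.obj),
    homMk_eqToHom (TL.unit_tensor X.obj)⟩
  tensor_unit X := ⟨congrArg TensorQuotient.mk (TL.tensor_unit X.obj),
    homMk_eqToHom (TL.tensor_unit X.obj)⟩

end Unit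

namespace WalkWeights
variable {d : ℝ} (G : WalkWeights d)

theorem c_ne_zero : G.c ≠ 0 := by
  intro h
  have := G.c_sq
  rw [h] at this
  simp at this

theorem mem_kerIdeal_of_trace_eq_zero (hpos : ∀ u ∈ G.verts, 0 < G.lam u) {X Y : TL (d : ℂ)}
    {f : X ⟶ Y} (h : markovTrace X (f ≫ (show Y ⟶ X from revHom f)) = 0) :
    f ∈ G.kerIdeal.carrier X Y := by
  rw [mem_kerIdeal]
  intro p hp
  obtain ⟨r, -, h2, h3⟩ := G.trace_form hpos f (hp 0)
  rw [h] at h2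
  have := Complex.ofReal_eq_zero.1 h2.symm
  exact h3 ((mul_eq_zero.1 this).resolve_left (pow_ne_zero _ G.c_ne_zero)) p hp rfl

theorem starTL_mem_kerIdeal {X Y : TL (d : ℂ)} {f : X ⟶ Y} (hf : f ∈ G.kerIdeal.carrier X Y) :
    starTL (G.c : ℂ) f ∈ G.kerIdeal.carrier Y X := by
  refine Submodule.smul_mem _ _ ?_
  rw [mem_kerIdeal] at hf ⊢
  intro p hp
  have e := G.eval_revHom f fun x => p (Y.strands + X.strands - x)
  rw [hf _ fun x => hp _, map_zero] at e
  rw [← e]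
  refine G.eval_congr _ fun x hx => ?_
  congr 1; omega

/-- The sign-corrected Markov trace is positive. -/
theorem state_pos (hpos : ∀ u ∈ G.verts, 0 < G.lam u) (hne : G.verts.Nonempty) {X Y : TL (d : ℂ)}
    (f : X ⟶ Y) : ∃ r : ℝ, 0 ≤ r ∧
      ((G.c : ℂ) ^ X.strands • markovTrace X) (f ≫ starTL (G.c : ℂ) f) = r ∧
      (r = 0 → f ∈ G.kerIdeal.carrier X Y) := by
  obtain ⟨u, hu⟩ := hne
  have hc : (G.c : ℂ) ≠ 0 := Complex.ofReal_ne_zero.2 G.c_ne_zero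
  by_cases hev : Even (X.strands + Y.strands)
  · obtain ⟨r, h1, h2, -⟩ := G.trace_form hpos f hu
    refine ⟨r, h1, ?_, ?_⟩
    · rw [LinearMap.smul_apply, starTL]
      have : f ≫ ((G.c : ℂ) ^ (((X.strands : ℤ) - Y.strands) / 2) • (show Y ⟶ X from revHom f)) =
        (G.c : ℂ) ^ (((X.strands : ℤ) - Y.strands) / 2) • (f ≫ (show Y ⟶ X from revHom f)) :=
        Linear.comp_smul _ _ _ _ _ _
      refine (congrArg (fun g => (G.c : ℂ) ^ X.strands • markovTrace X g) this).trans ?_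
      simp only [map_smul, h2, smul_eq_mul]
      push_cast
      rw [← mul_assoc, ← mul_assoc, ← zpow_natCast, ← zpow_natCast, ← zpow_add₀ hc, ← zpow_add₀ hc]
      -- Three powers of c meet: one from the functional, one from the star operation and one from
      -- the trace form. Their exponents add up to an even number, so the signs cancel.
      have e : (X.strands : ℤ) + ((X.strands : ℤ) - Y.strands) / 2 +
          ((X.strands + Y.strands) / 2 : ℕ) = X.strands + X.strands := by
        obtain ⟨t, ht⟩ := hev
        omega
      rw [e, zpow_add₀ hc, ← mul_zpow, ← Complex.ofReal_mul, G.c_sq]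
      simp
    · intro h
      rw [h] at h2
      exact G.mem_kerIdeal_of_trace_eq_zero hpos (by rw [h2]; simp)
  · have hf : f = 0 := by
      induction f using TL.hom_induction with
      | zero => rfl
      | add f g hf hg => rw [hf, hg, add_zero]
      | single D x =>
        refine absurd D.even ?_
        rwa [add_comm]
    subst hf
    exact ⟨0, le_rfl, by rw [Limits.zero_comp, map_zero]; simp, fun _ => Submodule.zero_mem _⟩

theorem markovTrace_eq_zero (hpos : ∀ u ∈ G.verts, 0 < G.lam u) (hne : G.verts.Nonempty)
    {X : TL (d : ℂ)} {f : X ⟶ X} (hf : f ∈ G.kerIdeal.carrier X X) : markovTrace X f = 0 := by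
  have : f ∈ negligible X X := by
    rw [G.negligible_eq hpos hne]; exact hf
  have := this (𝟙 X)
  rwa [Category.id_comp] at this

theorem conj_c : starRingEnd ℂ (G.c : ℂ) = G.c := Complex.conj_ofReal _

variable (hpos : ∀ u ∈ G.verts, 0 < G.lam u) (hne : G.verts.Nonempty)

/-- The star operation on the Temperley–Lieb category is faithful if all matrix coefficients
together separate morphisms. -/
noncomputable def faithfulStarTL (h0 : ∀ X Y : TL (d : ℂ), G.kerIdeal.carrier X Y = ⊥) :
    FaithfulStar (TL (d : ℂ)) where
  star f := starTL (G.c : ℂ) f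
  star_add f g := starTL_add f g
  star_smul c f := starTL_smul c f
  star_star f := starTL_starTL G.conj_c (Complex.ofReal_ne_zero.2 G.c_ne_zero) f
  star_comp f g := starTL_comp (Complex.conj_ofReal d) (Complex.ofReal_ne_zero.2 G.c_ne_zero) f g
  state X := (G.c : ℂ) ^ X.strands • markovTrace X
  state_pos {X Y} f := by
    obtain ⟨r, h1, h2, h3⟩ := G.state_pos hpos hne f
    refine ⟨r, h1, h2, fun h => ?_⟩
    have := h3 h
    rw [h0] at this
    exact (Submodule.mem_bot ℂ).1 this

/-- The structure of C*-tensor category on the Temperley–Lieb category. -/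
noncomputable def cstarTL (h0 : ∀ X Y : TL (d : ℂ), G.kerIdeal.carrier X Y = ⊥) :
    CStarTensorStructure (TL (d : ℂ)) where
  star f := starTL (G.c : ℂ) f
  star_add f g := starTL_add f g
  star_smul c f := starTL_smul c f
  star_star := (G.faithfulStarTL hpos hne h0).star_star
  star_comp := (G.faithfulStarTL hpos hne h0).star_comp
  exists_norm := ⟨_, (G.faithfulStarTL hpos hne h0).isCStarNorm⟩
  positive := (G.faithfulStarTL hpos hne h0).positive
  star_tensor f g := starTL_tensor (Complex.ofReal_ne_zero.2 G.c_ne_zero) f g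
  star_associator X Y Z := starTL_eqToHom (TL.tensor_assoc X Y Z)
  star_leftUnitor X := starTL_eqToHom (TL.unit_tensor X)
  star_rightUnitor X := starTL_eqToHom (TL.tensor_unit X)

/-- The star operation induced on the quotient by the morphisms with vanishing matrix
coefficients. -/
noncomputable def faithfulStarQuotient (I : TensorIdeal (TL (d : ℂ)))
    (hI : ∀ X Y, I.carrier X Y = G.kerIdeal.carrier X Y) : FaithfulStar (TensorQuotient I) where
  star {X Y} := Quotient.map (fun f => starTL (G.c : ℂ) f) (by
    intro f g hfg
    have hfg := (Submodule.quotientRel_def _).1 hfg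
    refine (Submodule.quotientRel_def _).2 ?_
    rw [hI] at hfg ⊢
    have := G.starTL_mem_kerIdeal hfg
    have e : starTL (G.c : ℂ) (f - g) = starTL (G.c : ℂ) f - starTL (G.c : ℂ) g := by
      rw [eq_sub_iff_add_eq, ← starTL_add, sub_add_cancel]
    rwa [e] at this)
  star_add f g := by
    obtain ⟨f, rfl⟩ := TensorQuotient.mk_surj f
    obtain ⟨g, rfl⟩ := TensorQuotient.mk_surj g
    exact congrArg TensorQuotient.homMk (starTL_add f g)
  star_smul c f := by
    obtain ⟨f, rfl⟩ := TensorQuotient.mk_surj f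
    exact congrArg TensorQuotient.homMk (starTL_smul c f)
  star_star f := by
    obtain ⟨f, rfl⟩ := TensorQuotient.mk_surj f
    exact congrArg TensorQuotient.homMk
      (starTL_starTL G.conj_c (Complex.ofReal_ne_zero.2 G.c_ne_zero) f)
  star_comp f g := by
    obtain ⟨f, rfl⟩ := TensorQuotient.mk_surj f
    obtain ⟨g, rfl⟩ := TensorQuotient.mk_surj g
    exact congrArg TensorQuotient.homMk
      (starTL_comp (Complex.conj_ofReal d) (Complex.ofReal_ne_zero.2 G.c_ne_zero) f g)
  state X := Submodule.liftQ _ ((G.c : ℂ) ^ X.obj.strands • markovTrace X.obj) (by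
    intro f hf
    rw [hI] at hf
    rw [LinearMap.mem_ker, LinearMap.smul_apply, G.markovTrace_eq_zero hpos hne hf, smul_zero])
  state_pos {X Y} f := by
    obtain ⟨f, rfl⟩ := TensorQuotient.mk_surj f
    obtain ⟨r, h1, h2, h3⟩ := G.state_pos hpos hne f
    refine ⟨r, h1, h2, fun h => ?_⟩
    have := h3 h
    rw [← hI] at this
    exact (Submodule.Quotient.mk_eq_zero _).2 this

/-- The structure of C*-tensor category on the quotient. -/
noncomputable def cstarQuotient (I : TensorIdeal (TL (d : ℂ)))
    (hI : ∀ X Y, I.carrier X Y = G.kerIdeal.carrier X Y) :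
    CStarTensorStructure (TensorQuotient I) where
  star := (G.faithfulStarQuotient hpos hne I hI).star
  star_add := (G.faithfulStarQuotient hpos hne I hI).star_add
  star_smul := (G.faithfulStarQuotient hpos hne I hI).star_smul
  star_star := (G.faithfulStarQuotient hpos hne I hI).star_star
  star_comp := (G.faithfulStarQuotient hpos hne I hI).star_comp
  exists_norm := ⟨_, (G.faithfulStarQuotient hpos hne I hI).isCStarNorm⟩
  positive := (G.faithfulStarQuotient hpos hne I hI).positive
  star_tensor f g := by
    obtain ⟨f, rfl⟩ := TensorQuotient.mk_surj f
    obtain ⟨g, rfl⟩ := TensorQuotient.mk_surj g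
    exact congrArg TensorQuotient.homMk
      (starTL_tensor (Complex.ofReal_ne_zero.2 G.c_ne_zero) f g)
  star_associator X Y Z :=
    congrArg TensorQuotient.homMk (starTL_eqToHom (TL.tensor_assoc X.obj Y.obj Z.obj))
  star_leftUnitor X := congrArg TensorQuotient.homMk (starTL_eqToHom (TL.unit_tensor X.obj))
  star_rightUnitor X := congrArg TensorQuotient.homMk (starTL_eqToHom (TL.tensor_unit X.obj))

theorem id_unit_notMem_kerIdeal (hpos : ∀ u ∈ G.verts, 0 < G.lam u) (hne : G.verts.Nonempty) :
    𝟙 (𝟙_ (TL (d : ℂ))) ∉ G.kerIdeal.carrier (𝟙_ (TL (d : ℂ))) (𝟙_ (TL (d : ℂ))) := by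
  intro h
  have := G.markovTrace_eq_zero hpos hne h
  exact one_ne_zero (markovTrace_id_unit.symm.trans this)

/-- Dyck paths stay in the half-line, and their coefficients already separate morphisms. -/
theorem kerIdeal_eq_bot (hv : ∀ u, 0 ≤ u → u ∈ G.verts) (X Y : TL (d : ℂ)) :
    G.kerIdeal.carrier X Y = ⊥ := by
  rw [eq_bot_iff]
  intro f hf
  rw [mem_kerIdeal] at hf
  rw [Submodule.mem_bot]
  classical
  exact G.eq_zero_of_eval fun w hw => hf w fun x => hv _ ((Finset.mem_filter.1 hw).2.2 x)

end WalkWeights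

end TemperleyLieb

/-! ### Quantum numbers and the Jones–Wenzl morphism. -/

namespace TemperleyLieb

open Finset CategoryTheory MonoidalCategory

/-- The quantum number `[u + 1]` for `q + q⁻¹ = D`. -/
noncomputable def qnum (D : ℝ) (u : ℤ) : ℝ := (Polynomial.Chebyshev.S ℝ u).eval D

theorem qnum_zero (D : ℝ) : qnum D 0 = 1 := by simp [qnum]

theorem qnum_one (D : ℝ) : qnum D 1 = D := by simp [qnum]

theorem qnum_neg_one (D : ℝ) : qnum D (-1) = 0 := by simp [qnum]

theorem qnum_add (D : ℝ) (u : ℤ) : qnum D (u + 1) + qnum D (u - 1) = D * qnum D u := by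
  unfold qnum
  rw [Polynomial.Chebyshev.S_add_one]
  simp

theorem qnum_two_mul_cos (θ : ℝ) (u : ℤ) :
    qnum (2 * Real.cos θ) u * Real.sin θ = Real.sin ((u + 1) * θ) :=
  Polynomial.Chebyshev.S_two_mul_real_cos θ u

/-- The weights given by quantum numbers. -/
noncomputable def qnumWeights {d D c : ℝ} (hc : c * c = 1) (hd : d = c * D) (verts : Set ℤ)
    (ne_zero : ∀ u ∈ verts, qnum D u ≠ 0)
    (boundary : ∀ u ∈ verts, ∀ v, v = u + 1 ∨ v = u - 1 → v ∉ verts → qnum D v = 0) :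
    WalkWeights d where
  lam := qnum D
  c := c
  verts := verts
  c_sq := hc
  eigen u _ := by rw [qnum_add, hd, mul_assoc]
  ne_zero := ne_zero
  boundary := boundary

/-- For D ≥ 2 the recursion gives [n + 3] ≥ 2[n + 2] - [n + 1], so monotonicity and positivity
propagate together. -/
theorem qnum_pos_of_two_le {D : ℝ} (hD : 2 ≤ D) (n : ℕ) : 0 < qnum D n ∧ qnum D n ≤ qnum D (n + 1) := by
  induction n with
  | zero =>
    have h1 := qnum_zero D
    have h2 := qnum_one D
    norm_num [h1, h2]
    linarith
  | succ n ih =>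
    have := qnum_add D (n + 1)
    rw [add_sub_cancel_right] at this
    push_cast
    refine ⟨by linarith, ?_⟩
    nlinarith

/-- Weights on the half-line. -/
theorem exists_weights_of_two_le {d D c : ℝ} (hc : c * c = 1) (hd : d = c * D) (hD : 2 ≤ D) :
    ∃ G : WalkWeights d, G.c = c ∧ G.verts = {u | 0 ≤ u} ∧ ∀ u ∈ G.verts, 0 < G.lam u := by
  have hp : ∀ u : ℤ, 0 ≤ u → 0 < qnum D u := by
    intro u hu
    obtain ⟨n, rfl⟩ := Int.eq_ofNat_of_zero_le hu
    exact (qnum_pos_of_two_le hD n).1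
  refine ⟨qnumWeights hc hd {u | 0 ≤ u} (fun u hu => (hp u hu).ne') ?_, rfl, rfl, hp⟩
  intro u hu v hv hv'
  -- The only outer neighbour of the half-line is -1, where the quantum number is [0] = 0.
  simp only [Set.mem_ofPred_eq] at hu hv'
  obtain rfl : v = -1 := by omega
  exact qnum_neg_one D

/-- Weights on an interval. -/
theorem exists_weights_of_cos {d D c : ℝ} (hc : c * c = 1) (hd : d = c * D) {n : ℕ} (hn : 3 ≤ n)
    (hD : D = 2 * Real.cos (Real.pi / n)) :
    ∃ G : WalkWeights d, G.c = c ∧ G.verts.Nonempty ∧ ∀ u ∈ G.verts, 0 < G.lam u := by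
  have hn' : (3 : ℝ) ≤ n := by exact_mod_cast hn
  have hpi := Real.pi_pos
  have hs : 0 < Real.sin (Real.pi / n) :=
    Real.sin_pos_of_pos_of_lt_pi (by positivity) (div_lt_self hpi (by linarith))
  have hq := qnum_two_mul_cos (Real.pi / n)
  rw [← hD] at hq
  have hp : ∀ u ∈ {u : ℤ | 0 ≤ u ∧ u < (n : ℤ) - 1}, 0 < qnum D u := by
    rintro u ⟨hu, hu'⟩
    have h0 : (0 : ℝ) ≤ u := by exact_mod_cast hu
    have h1 : (u : ℝ) + 1 < n := by
      have : u + 1 < n := by omega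
      exact_mod_cast this
    have : 0 < Real.sin ((u + 1) * (Real.pi / n)) := by
      refine Real.sin_pos_of_pos_of_lt_pi (by positivity) ?_
      rw [mul_div_assoc', div_lt_iff₀ (by positivity), mul_comm]
      gcongr
    rw [← hq] at this
    exact pos_of_mul_pos_left this hs.le
  refine ⟨qnumWeights hc hd {u | 0 ≤ u ∧ u < (n : ℤ) - 1} (fun u hu => (hp u hu).ne') ?_, rfl,
    ⟨0, le_rfl, by omega⟩, hp⟩
  intro u hu v hv hv'
  simp only [Set.mem_ofPred_eq] at hu hv'
  -- The interval has two outer neighbours, and the weight at n - 1 is [n], which vanishes because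
  -- sin π = 0.
  obtain rfl | rfl : v = -1 ∨ v = (n : ℤ) - 1 := by omega
  · exact qnum_neg_one D
  · have := hq (n - 1)
    push_cast at this
    rw [sub_add_cancel, mul_div_cancel₀ _ (by positivity), Real.sin_pi] at this
    exact (mul_eq_zero.1 this).resolve_right hs.ne'

/-- The first quantum number that fails to be positive. -/
theorem exists_qnum_nonpos {D : ℝ} (h0 : 0 < D) (h2 : D < 2) : ∃ N : ℕ, 2 ≤ N ∧
    (∀ j < N, 0 < qnum D j) ∧ qnum D N ≤ 0 ∧
      (qnum D N = 0 → D = 2 * Real.cos (Real.pi / (N + 1 : ℕ))) := by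
  obtain ⟨θ, hθ0, hθ1, hD⟩ : ∃ θ, 0 < θ ∧ θ < Real.pi / 2 ∧ D = 2 * Real.cos θ :=
    ⟨Real.arccos (D / 2), Real.arccos_pos.2 (by linarith),
      Real.arccos_lt_pi_div_two.2 (by linarith),
      by rw [Real.cos_arccos (by linarith) (by linarith)]; ring⟩
  have hpi := Real.pi_pos
  have hs : 0 < Real.sin θ := Real.sin_pos_of_pos_of_lt_pi hθ0 (by linarith)
  have hq := qnum_two_mul_cos θ
  rw [← hD] at hq
  -- With this N one has Nθ < π ≤ (N + 1)θ, so sin((N + 1)θ) is the first of the sines that is not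
  -- positive.
  obtain ⟨N, hN⟩ : ∃ N, ⌈Real.pi / θ⌉₊ = N + 1 :=
    Nat.exists_eq_succ_of_ne_zero (Nat.ceil_pos.2 (by positivity)).ne'
  have hlt : N * θ < Real.pi := by
    rw [← lt_div_iff₀ hθ0]
    exact Nat.lt_ceil.1 (by omega)
  have hge : Real.pi ≤ (N + 1) * θ := by
    rw [← div_le_iff₀ hθ0]
    have := Nat.le_ceil (Real.pi / θ)
    rw [hN] at this
    exact_mod_cast this
  have hN2 : 2 ≤ N := by
    by_contra hc
    have : (N : ℝ) ≤ 1 := by exact_mod_cast (by omega : N ≤ 1)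
    nlinarith
  have hqN := hq N
  push_cast at hqN
  refine ⟨N, hN2, fun j hj => ?_, ?_, fun h => ?_⟩
  · have h1 : ((j : ℝ) + 1) ≤ N := by exact_mod_cast hj
    have : 0 < Real.sin ((j + 1) * θ) :=
      Real.sin_pos_of_pos_of_lt_pi (by positivity) (by nlinarith)
    have e := hq j
    push_cast at e
    rw [← e] at this
    exact pos_of_mul_pos_left this hs.le
  · have : Real.sin ((N + 1) * θ) ≤ 0 := by
      rw [← neg_nonneg, ← Real.sin_sub_pi]
      exact Real.sin_nonneg_of_nonneg_of_le_pi (by linarith) (by linarith)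
    rw [← hqN] at this
    by_contra hc
    exact absurd (mul_pos (not_le.1 hc) hs) (not_lt.2 this)
  · rw [h, zero_mul, eq_comm, ← neg_eq_zero, ← Real.sin_sub_pi] at hqN
    have : (N + 1) * θ - Real.pi = 0 := by
      by_contra hc
      have : 0 < (N + 1) * θ - Real.pi := lt_of_le_of_ne (by linarith) (Ne.symm hc)
      exact absurd (Real.sin_pos_of_pos_of_lt_pi this (by linarith)) (by rw [hqN]; exact lt_irrefl _)
    rw [hD]
    congr 2
    push_cast
    field_simp
    linarith

/-- The walk that goes up `N` steps and down again. -/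
def peak (N : ℕ) (x : ℕ) : ℤ := (min x (2 * N - x) : ℕ)

theorem peak_mem_dyck (N : ℕ) : peak N ∈ dyck (2 * N) := by
  classical
  rw [dyck, mem_filter, mem_walks]
  refine ⟨⟨rfl, fun x hx => ?_, fun x hx => ?_⟩, ?_, fun x => ?_⟩ <;> unfold peak <;> omega

/-- A morphism from the unit object whose square has as trace a given quantum number, up to sign:
the Jones–Wenzl projection, with half of its points moved to the other side. -/
theorem exists_markovTrace_eq_qnum {d D c : ℝ} (hc : c * c = 1) (hd : d = c * D) {N : ℕ}
    (hN : 0 < N) (hpos : ∀ j < N, 0 < qnum D j) :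
    ∃ f : (⟨0⟩ : TL (d : ℂ)) ⟶ ⟨2 * N⟩, f ≠ 0 ∧
      markovTrace ⟨0⟩ (f ≫ (show (⟨2 * N⟩ : TL (d : ℂ)) ⟶ ⟨0⟩ from revHom f)) =
        ((c ^ N * qnum D N : ℝ) : ℂ) := by
  classical
  -- With the vertices taken where the quantum number is nonzero, the boundary condition is void.
  -- Positivity of all weights is not needed, since a single walk will contribute.
  set G : WalkWeights d := qnumWeights hc hd {u | qnum D u ≠ 0} (fun u hu => hu)
    (fun u _ v _ hv => not_not.1 hv) with hG
  have hmem : ∀ u, u ∈ G.verts ↔ qnum D u ≠ 0 := fun u => Iff.rfl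
  -- The morphism f is dual to the highest Dyck path: its coefficients at all other Dyck paths
  -- vanish.
  obtain ⟨f, hf⟩ := G.exists_eval_eq (m := 2 * N) (n := 0) fun w => if w = peak N then 1 else 0
  rw [add_zero] at hf
  have hu : (0 : ℤ) ∈ G.verts := by rw [hmem, qnum_zero]; exact one_ne_zero
  refine ⟨f, fun h => ?_, ?_⟩
  · have := hf _ (peak_mem_dyck N)
    rw [if_pos rfl] at this
    refine one_ne_zero (this.symm.trans ?_)
    rw [h]
    exact (G.eval _).map_zero
  rw [G.markovTrace_comp_revHom (X := ⟨0⟩) (Y := ⟨2 * N⟩) f hu]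
  dsimp only
  rw [zero_add]
  have hpm : peak N ∈ walks 0 (2 * N) := (mem_filter.1 (peak_mem_dyck N)).1
  rw [sum_eq_single_of_mem _ hpm]
  · have e2 : G.eval (fun x => peak N (2 * N - x)) f = 1 := by
      refine Eq.trans ?_ ((hf _ (peak_mem_dyck N)).trans (if_pos rfl))
      refine G.eval_congr _ fun x hx => ?_
      unfold peak; omega
    have hw : G.weight (2 * N) (peak N) = c ^ N * qnum D N := by
      have up : ∀ j ≤ N, G.weight j (peak N) = c ^ j * qnum D j := by
        intro j hj
        induction j with
        | zero => simp [WalkWeights.weight, qnum_zero]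
        | succ j ih =>
          have h1 : G.weight (j + 1) (peak N) = G.weight j (peak N) * G.b (peak N j) (peak N (j + 1)) :=
            prod_range_succ _ _
          have h2 : peak N j = j := by unfold peak; omega
          have h3 : peak N (j + 1) = j + 1 := by unfold peak; omega
          have h4 := (hpos j (by omega)).ne'
          rw [h1, ih (by omega), h2, h3, WalkWeights.b, if_pos rfl]
          change _ * (if (j + 1 : ℤ) ∈ G.verts then c * qnum D (j + 1) / qnum D j else 0) = _
          -- On the way up the factors c[j + 2]/[j + 1] telescope. At the top N may fail to be a
          -- vertex; then [N + 1] = 0 and both sides are zero. On the way down all factors are 1.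
          push_cast
          split_ifs with h5
          · field_simp
            ring
          · rw [hmem, not_not] at h5
            rw [h5]; ring
      have down : ∀ j ≤ N, G.weight (N + j) (peak N) = c ^ N * qnum D N := by
        intro j hj
        induction j with
        | zero => exact up N le_rfl
        | succ j ih =>
          have h1 : G.weight (N + j + 1) (peak N) =
              G.weight (N + j) (peak N) * G.b (peak N (N + j)) (peak N (N + j + 1)) :=
            prod_range_succ _ _
          have h2 : peak N (N + j) = (N - j : ℕ) := by unfold peak; omega
          have h3 : peak N (N + j + 1) = (N - (j + 1) : ℕ) := by unfold peak; omega
          rw [← add_assoc, h1, ih (by omega), h2, h3, WalkWeights.b, if_pos, if_neg (by omega), mul_one]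
          rw [hmem]
          exact (hpos _ (by omega)).ne'
      rw [two_mul]
      exact down N le_rfl
    rw [hw, e2]
    simp
  · intro w hw hne
    obtain ⟨h0, h1, h2⟩ := mem_walks.1 hw
    by_cases hwt : G.weight (2 * N) w = 0
    · rw [hwt]; simp
    suffices h : G.eval (fun x => w (2 * N - x)) f = 0 by rw [h]; simp
    by_cases hcl : w (2 * N) = 0
    · have hv : ∀ x ≤ 2 * N, w x ∈ G.verts := fun x hx =>
        G.mem_verts_of_weight_ne_zero hwt (by rw [h0]; exact hu) hx
      -- To become negative a walk has to pass through -1, which is not a vertex as [0] = 0. So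
      -- closed walks of nonzero weight are Dyck paths.
      have hnn : ∀ x ≤ 2 * N, 0 ≤ w x := by
        intro x hx
        induction x with
        | zero => rw [h0]
        | succ x ih =>
          have := ih (by omega)
          have h3 := h1 x (by omega)
          by_contra hc
          refine (hmem _).1 (hv (x + 1) hx) ?_
          rw [show w (x + 1) = -1 by omega, qnum_neg_one]
      rw [hf, if_neg]
      · intro h
        refine hne (funext fun x => ?_)
        rcases Nat.le_total x (2 * N) with hx | hx
        · have := congrFun h (2 * N - x)
          simp only [Nat.sub_sub_self hx] at this
          rw [this]
          unfold peak; omega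
        · rw [h2 x hx, hcl]
          unfold peak; omega
      · rw [dyck, mem_filter, mem_walks]
        refine ⟨⟨by simpa using hcl, fun x hx => ?_, fun x hx => ?_⟩, by simpa using h0,
          fun x => hnn _ (by omega)⟩
        · have := h1 (2 * N - (x + 1)) (by omega)
          rw [show 2 * N - (x + 1) + 1 = 2 * N - x by omega] at this
          omega
        · rw [Nat.sub_self, Nat.sub_eq_zero_of_le hx]
    · refine G.eval_eq_zero (m := 2 * N) (n := 0) f ?_
      rintro σ ⟨hσ, hcomp⟩
      have := hcomp.closed hσ
      simp only [add_zero, Nat.sub_self, Nat.sub_zero] at this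
      exact hcl (by rw [← this, h0])

end TemperleyLieb

/-! ### Generation by a single arc. -/

namespace TemperleyLieb

open CategoryTheory MonoidalCategory

theorem IsPlanar.congr_card {k l : ℕ} {σ : ℕ → ℕ} (h : IsPlanar k σ) (e : k = l) : IsPlanar l σ :=
  e ▸ h

namespace KauffmanDiagram

/-- The arc joining two upper points. -/
def cupArc : KauffmanDiagram 2 0 := ⟨nest 1, IsPlanar.nest 1⟩

/-- The arc joining two lower points. -/
def capArc : KauffmanDiagram 0 2 := ⟨nest 1, IsPlanar.nest 1⟩

theorem eq_nest_of_isPlanar_two {σ : ℕ → ℕ} (h : IsPlanar 2 σ) : σ = nest 1 := by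
  have h0 := h.lt (x := 0) (by omega)
  have h1 := h.lt (x := 1) (by omega)
  have h2 := h.ne_self 0 (by omega)
  have h3 := h.ne_self 1 (by omega)
  funext x
  unfold nest
  obtain rfl | rfl | hx : x = 0 ∨ x = 1 ∨ 2 ≤ x := by omega
  · rw [if_pos (by omega)]; omega
  · rw [if_pos (by omega)]; omega
  · rw [if_neg (by omega), h.eq_self x hx]

theorem eq_of_add_eq_two {m n : ℕ} (h : m + n = 2) (D E : KauffmanDiagram m n) : D = E :=
  Subtype.ext ((eq_nest_of_isPlanar_two (D.2.congr_card h)).trans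
    (eq_nest_of_isPlanar_two (E.2.congr_card h)).symm)

theorem cupArc_reflect : cupArc.reflect = capArc := eq_of_add_eq_two rfl _ _

/-- A single arc joining the upper points `i` and `i + 1`, next to vertical arcs. -/
def cupAt (i l : ℕ) : KauffmanDiagram (i + 2 + l) (i + l) :=
  ((one i).tensor cupArc).tensor (one l)

/-- The small arc takes no part in the gluing and can be pulled out of it; the vertical strings then
act as an identity. -/
theorem cupAt_comp {i l n : ℕ} (D : KauffmanDiagram (i + l) n) :
    ((cupAt i l).comp D).1 = cup i D.1 ∧ (cupAt i l).loops D = 0 := by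
  have hN : IsPlanar (i + l + (i + l)) (nest (i + l)) := by
    rw [← two_mul]; exact IsPlanar.nest _
  have h0 : ∀ w < 2, nest 1 w < 2 := fun w hw => nest_lt (r := 1) hw
  have h1 : (cupAt i l).1 = ins i 2 (nest (i + l)) (nest 1) := by
    rw [← ins_nest_nest, ins_ins_comm (s := 2) _ _ _ le_rfl h0, two_mul l]
    rfl
  have h2 : ins (i + 2 + l + (i + l)) (i + l + n) (cupAt i l).1 D.1 =
      ins i 2 (ins (i + l + (i + l)) (i + l + n) (nest (i + l)) D.1) (nest 1) := by
    rw [h1, ins_ins_comm (s := 2) _ _ _ (by omega) h0]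
    congr 1
    omega
  have h3 : IsPlanar (i + l + n + 2 * (i + l))
      (ins (i + l + (i + l)) (i + l + n) (nest (i + l)) D.1) := by
    convert hN.ins D.2 le_rfl using 1
    omega
  obtain ⟨h4, h5⟩ := glue_ins_right (i := i + l) h3 (IsPlanar.nest 1) (p := i) (by omega) (by omega)
  obtain ⟨h6, h7⟩ := raw_nest_left D.2
  rw [h6] at h4
  rw [h7] at h5
  have e : i + 2 + l = i + l + 2 * 1 := by omega
  constructor
  · change glue (i + 2 + l) (i + l) (ins _ _ _ _) = _
    rw [h2, e]
    exact h4
  · change glueLoops (i + 2 + l) (i + l) (ins _ _ _ _) = _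
    rw [h2, e]
    exact h5

end KauffmanDiagram

section Generators
variable {d : ℂ}

theorem diagram_comp {a b c : ℕ} (D : KauffmanDiagram a b) (E : KauffmanDiagram b c) :
    diagram d E ≫ diagram d D = d ^ D.loops E • diagram d (D.comp E) := by
  refine (compHom_single d D E 1 1).trans ?_
  refine Eq.symm ((Finsupp.smul_single _ _ _).trans ?_)
  simp

theorem diagram_tensor {a b a' b' : ℕ} (D : KauffmanDiagram a b) (E : KauffmanDiagram a' b') :
    diagram d D ⊗ₘ diagram d E = diagram d (D.tensor E) := by
  refine (tensorMap_single D E 1 1).trans ?_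
  rw [mul_one]
  rfl

theorem single_eq_smul_diagram {m n : ℕ} (D : KauffmanDiagram m n) (x : ℂ) :
    (Finsupp.single D x : (⟨n⟩ : TL d) ⟶ ⟨m⟩) = x • diagram d D := by
  refine Eq.symm ((Finsupp.smul_single _ _ _).trans ?_)
  rw [smul_eq_mul, mul_one]

/-- The Temperley–Lieb category is generated by a single arc and its reflection. -/
theorem diagram_induction {P : ∀ X Y : TL d, (X ⟶ Y) → Prop}
    (id : ∀ X, P X X (𝟙 X))
    (comp : ∀ {X Y Z} (f : X ⟶ Y) (g : Y ⟶ Z), P X Y f → P Y Z g → P X Z (f ≫ g))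
    (tensor : ∀ {X Y X' Y'} (f : X ⟶ Y) (g : X' ⟶ Y'), P X Y f → P X' Y' g → P _ _ (f ⊗ₘ g))
    (cupArc : P _ _ (diagram d KauffmanDiagram.cupArc))
    (reflect : ∀ {m n : ℕ} (D : KauffmanDiagram m n), P _ _ (diagram d D) →
      P _ _ (diagram d D.reflect))
    {m n : ℕ} (D : KauffmanDiagram m n) : P _ _ (diagram d D) := by
  obtain ⟨N, hN⟩ : ∃ N, m + n = N := ⟨_, rfl⟩
  induction N using Nat.strong_induction_on generalizing m n with
  | _ N ih =>
  have upper : ∀ {m n : ℕ} (D : KauffmanDiagram m n) (i : ℕ), m + n = N → i + 2 ≤ m →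
      D.1 i = i + 1 → P _ _ (diagram d D) := by
    intro m n D i hN hi e
    obtain ⟨l, rfl⟩ := Nat.exists_eq_add_of_le hi
    have h := D.2.congr_card (show _ = i + l + n + 2 by omega)
    let E : KauffmanDiagram (i + l) n := ⟨cap i D.1, h.cap (by omega)⟩
    obtain ⟨h1, h2⟩ := KauffmanDiagram.cupAt_comp E
    have h3 : (KauffmanDiagram.cupAt i l).comp E = D :=
      Subtype.ext (h1.trans (cup_cap h (by omega) e))
    have h4 := diagram_comp (d := d) (KauffmanDiagram.cupAt i l) E
    rw [h2, h3, pow_zero, one_smul] at h4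
    rw [← h4]
    refine comp _ _ (ih _ (by omega) E rfl) ?_
    have h5 : diagram d (KauffmanDiagram.cupAt i l) =
        (𝟙 (⟨i⟩ : TL d) ⊗ₘ diagram d KauffmanDiagram.cupArc) ⊗ₘ 𝟙 (⟨l⟩ : TL d) := by
      refine Eq.symm ((congrArg (· ⊗ₘ 𝟙 (⟨l⟩ : TL d))
        (diagram_tensor (KauffmanDiagram.one i) KauffmanDiagram.cupArc)).trans ?_)
      exact diagram_tensor _ (KauffmanDiagram.one l)
    rw [h5]
    exact tensor _ _ (tensor _ _ (id _) cupArc) (id _)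
  rcases Nat.eq_zero_or_pos (m + n) with h0 | h0
  · obtain ⟨rfl, rfl⟩ : m = 0 ∧ n = 0 := by omega
    have : D = KauffmanDiagram.one 0 := Subtype.ext
      ((IsPlanar.zero_eq_id D.2).trans (IsPlanar.zero_eq_id (KauffmanDiagram.one 0).2).symm)
    subst this
    exact id _
  obtain ⟨i, hi, e⟩ := D.2.exists_adjacent h0
  -- The small arc lies between upper points, or between lower points, in which case one reflects,
  -- or it joins the last upper point to the next boundary point. Since lower points are numbered
  -- from right to left, it is then a vertical string on the far right and splits off as a tensor
  -- factor.
  rcases (by omega : i + 2 ≤ m ∨ m ≤ i ∨ m = i + 1) with hm | hm | hm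
  · exact upper D i hN hm e
  · rw [← D.reflect_reflect]
    refine reflect _ (upper D.reflect (m + n - 2 - i) (by omega) (by omega) ?_)
    have e' : D.1 (i + 1) = i := by rw [← e, D.2.invol]
    rw [D.reflect_val, rev, if_pos (by omega),
      show m + n - 1 - (m + n - 2 - i) = i + 1 by omega, e']
    omega
  · subst hm
    obtain ⟨b, rfl⟩ : ∃ b, n = b + 1 := ⟨n - 1, by omega⟩
    have h := D.2.congr_card (show _ = i + b + 2 by omega)
    let E : KauffmanDiagram i b := ⟨cap i D.1, h.cap (by omega)⟩
    have h1 : E.tensor (KauffmanDiagram.one 1) = D := Subtype.ext (cup_cap h (by omega) e)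
    rw [← h1, ← diagram_tensor]
    exact tensor _ _ (ih _ (by omega) E rfl) (id _)

theorem hom_eq_smul_diagram {m n : ℕ} (h : m + n = 2) (D : KauffmanDiagram m n)
    (f : (⟨n⟩ : TL d) ⟶ ⟨m⟩) : ∃ x : ℂ, f = x • diagram d D := by
  induction f using TL.hom_induction with
  | zero => exact ⟨0, (zero_smul _ _).symm⟩
  | add f g hf hg =>
    obtain ⟨x, rfl⟩ := hf
    obtain ⟨y, rfl⟩ := hg
    exact ⟨x + y, (add_smul _ _ _).symm⟩
  | single E x =>
    obtain rfl := KauffmanDiagram.eq_of_add_eq_two h D E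
    exact ⟨x, single_eq_smul_diagram D x⟩

theorem cupArc_comp_capArc : diagram d KauffmanDiagram.cupArc ≫ diagram d KauffmanDiagram.capArc =
    d • 𝟙 (⟨0⟩ : TL d) := by
  rw [diagram_comp]
  have h1 : KauffmanDiagram.capArc.loops KauffmanDiagram.cupArc = 1 := by decide
  have h2 : KauffmanDiagram.capArc.comp KauffmanDiagram.cupArc = KauffmanDiagram.one 0 := Subtype.ext
    ((IsPlanar.zero_eq_id (KauffmanDiagram.capArc.comp KauffmanDiagram.cupArc).2).trans
      (IsPlanar.zero_eq_id (KauffmanDiagram.one 0).2).symm)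
  rw [h1, h2, pow_one]
  rfl

theorem zigzag : (show (⟨1⟩ : TL d) ⟶ ⟨3⟩ from 𝟙 ⟨1⟩ ⊗ₘ diagram d KauffmanDiagram.cupArc) ≫
    (show (⟨3⟩ : TL d) ⟶ ⟨1⟩ from diagram d KauffmanDiagram.capArc ⊗ₘ 𝟙 ⟨1⟩) = 𝟙 _ := by
  have h1 := diagram_tensor (d := d) (KauffmanDiagram.one 1) KauffmanDiagram.cupArc
  have h2 := diagram_tensor (d := d) KauffmanDiagram.capArc (KauffmanDiagram.one 1)
  refine (congrArg₂ (fun (f : (⟨1⟩ : TL d) ⟶ ⟨3⟩) (g : (⟨3⟩ : TL d) ⟶ ⟨1⟩) => f ≫ g) h1 h2).trans ?_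
  refine (diagram_comp (a := 1) (b := 3) (c := 1) _ _).trans ?_
  have h3 : KauffmanDiagram.loops (a := 1) (b := 3) (c := 1)
    (KauffmanDiagram.capArc.tensor (KauffmanDiagram.one 1))
    ((KauffmanDiagram.one 1).tensor KauffmanDiagram.cupArc) = 0 := by decide
  rw [h3, pow_zero, one_smul]
  exact congrArg (diagram d) (KauffmanDiagram.eq_of_add_eq_two rfl _ (KauffmanDiagram.one 1))

theorem zigzag' : (show (⟨1⟩ : TL d) ⟶ ⟨3⟩ from diagram d KauffmanDiagram.cupArc ⊗ₘ 𝟙 ⟨1⟩) ≫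
    (show (⟨3⟩ : TL d) ⟶ ⟨1⟩ from 𝟙 ⟨1⟩ ⊗ₘ diagram d KauffmanDiagram.capArc) = 𝟙 _ := by
  have h1 := diagram_tensor (d := d) KauffmanDiagram.cupArc (KauffmanDiagram.one 1)
  have h2 := diagram_tensor (d := d) (KauffmanDiagram.one 1) KauffmanDiagram.capArc
  refine (congrArg₂ (fun (f : (⟨1⟩ : TL d) ⟶ ⟨3⟩) (g : (⟨3⟩ : TL d) ⟶ ⟨1⟩) => f ≫ g) h1 h2).trans ?_
  refine (diagram_comp (a := 1) (b := 3) (c := 1) _ _).trans ?_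
  have h3 : KauffmanDiagram.loops (a := 1) (b := 3) (c := 1)
    ((KauffmanDiagram.one 1).tensor KauffmanDiagram.capArc)
    (KauffmanDiagram.cupArc.tensor (KauffmanDiagram.one 1)) = 0 := by decide
  rw [h3, pow_zero, one_smul]
  exact congrArg (diagram d) (KauffmanDiagram.eq_of_add_eq_two rfl _ (KauffmanDiagram.one 1))

end Generators

end TemperleyLieb

/-! ### Classification of positive star operations on quotients, the zero ideal included. -/

namespace TemperleyLieb

open CategoryTheory MonoidalCategory

/-- A star operation on a quotient of the Temperley–Lieb category that has the algebraic properties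
of the star operation of a C*-tensor category. -/
structure PosStar {d : ℂ} (I : TensorIdeal (TL d)) where
  star : ∀ {X Y : TensorQuotient I}, (X ⟶ Y) → (Y ⟶ X)
  star_add : ∀ {X Y : TensorQuotient I} (f g : X ⟶ Y), star (f + g) = star f + star g
  star_smul : ∀ {X Y : TensorQuotient I} (c : ℂ) (f : X ⟶ Y),
    star (c • f) = (starRingEnd ℂ c) • star f
  star_star : ∀ {X Y : TensorQuotient I} (f : X ⟶ Y), star (star f) = f
  star_comp : ∀ {X Y Z : TensorQuotient I} (f : X ⟶ Y) (g : Y ⟶ Z),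
    star (f ≫ g) = star g ≫ star f
  star_tensor : ∀ {X Y X' Y' : TensorQuotient I} (f : X ⟶ Y) (g : X' ⟶ Y'),
    star (f ⊗ₘ g) = star f ⊗ₘ star g
  positive : ∀ {X Y : TensorQuotient I} (f : X ⟶ Y), ∃ g : X ⟶ X, f ≫ star f = g ≫ star g
  definite : ∀ {X Y : TensorQuotient I} (f : X ⟶ Y), f ≫ star f = 0 → f = 0

theorem TL.smul_tensor {d : ℂ} {X Y X' Y' : TL d} (r : ℂ) (f : X ⟶ Y) (g : X' ⟶ Y') :
    (r • f) ⊗ₘ g = r • (f ⊗ₘ g) :=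
  LinearMap.map_smul₂ (tensorMap Y.strands X.strands Y'.strands X'.strands) r f g

theorem TL.tensor_smul {d : ℂ} {X Y X' Y' : TL d} (r : ℂ) (f : X ⟶ Y) (g : X' ⟶ Y') :
    f ⊗ₘ (r • g) = r • (f ⊗ₘ g) :=
  (tensorMap Y.strands X.strands Y'.strands X'.strands f).map_smul r g

theorem smul_zigzag' {d : ℂ} (a b : ℂ) :
    (show (⟨1⟩ : TL d) ⟶ ⟨3⟩ from (a • diagram d KauffmanDiagram.cupArc) ⊗ₘ 𝟙 ⟨1⟩) ≫
      (show (⟨3⟩ : TL d) ⟶ ⟨1⟩ from 𝟙 ⟨1⟩ ⊗ₘ (b • diagram d KauffmanDiagram.capArc)) =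
        (a * b) • 𝟙 _ := by
  have key : ∀ (f : (⟨1⟩ : TL d) ⟶ ⟨3⟩) (g : (⟨3⟩ : TL d) ⟶ ⟨1⟩),
      (a • f) ≫ (b • g) = (a * b) • (f ≫ g) := fun f g => by
    rw [Linear.smul_comp, Linear.comp_smul, smul_smul]
  refine (congrArg₂ (fun (f : (⟨1⟩ : TL d) ⟶ ⟨3⟩) (g : (⟨3⟩ : TL d) ⟶ ⟨1⟩) => f ≫ g)
    (TL.smul_tensor a (diagram d KauffmanDiagram.cupArc) (𝟙 ⟨1⟩))
    (TL.tensor_smul b (𝟙 ⟨1⟩) (diagram d KauffmanDiagram.capArc))).trans ?_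
  exact (key _ _).trans (congrArg ((a * b) • ·) zigzag')

theorem CStarTensorStructure.definite {C : Type*} [Category C] [Preadditive C] [Linear ℂ C]
    [MonoidalCategory C] (s : CStarTensorStructure C) {X Y : C} (f : X ⟶ Y)
    (h : f ≫ s.star f = 0) : f = 0 := by
  obtain ⟨nrm, hn⟩ := s.exists_norm
  have h1 := hn.cstar f
  have h2 : nrm (0 : X ⟶ X) = 0 := by
    have := hn.smul 0 (0 : X ⟶ X)
    rwa [zero_smul, norm_zero, zero_mul] at this
  rw [h, h2] at h1
  exact hn.eq_zero f (pow_eq_zero_iff two_ne_zero |>.1 h1.symm)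

/-- The zero ideal. -/
noncomputable def zeroIdeal (d : ℂ) : TensorIdeal (TL d) where
  carrier X Y := ⊥
  comp_mem g hf := by
    rw [Submodule.mem_bot] at hf ⊢
    rw [hf, Limits.zero_comp]
  mem_comp f _ hg := by
    rw [Submodule.mem_bot] at hg ⊢
    rw [hg, Limits.comp_zero]
  tensor_mem g hf := by
    rw [Submodule.mem_bot] at hf ⊢
    rw [hf, TL.zero_tensor]
  mem_tensor f _ hg := by
    rw [Submodule.mem_bot] at hg ⊢
    rw [hg, TL.tensor_zero]

theorem homMk_zeroIdeal {d : ℂ} {X Y : TL d} {f g : X ⟶ Y} :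
    (TensorQuotient.homMk f : (⟨X⟩ : TensorQuotient (zeroIdeal d)) ⟶ ⟨Y⟩) =
      TensorQuotient.homMk g ↔ f = g := by
  rw [TensorQuotient.mk_eq_mk]
  exact (Submodule.mem_bot ℂ).trans sub_eq_zero

/-- The star operation of a C*-tensor category structure on a quotient. -/
def PosStar.ofQuotient {d : ℂ} {I : TensorIdeal (TL d)}
    (s : CStarTensorStructure (TensorQuotient I)) : PosStar I where
  star := s.star
  star_add := s.star_add
  star_smul := s.star_smul
  star_star := s.star_star
  star_comp := s.star_comp
  star_tensor := s.star_tensor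
  positive := s.positive
  definite := s.definite

/-- The star operation of a C*-tensor category structure on the Temperley–Lieb category. -/
noncomputable def PosStar.ofTL {d : ℂ} (s : CStarTensorStructure (TL d)) : PosStar (zeroIdeal d) where
  star {X Y} := Quotient.map s.star (by
    intro f g hfg
    have hfg := (Submodule.quotientRel_def _).1 hfg
    rw [sub_eq_zero.1 ((Submodule.mem_bot ℂ).1 hfg)])
  star_add f g := by
    obtain ⟨f, rfl⟩ := TensorQuotient.mk_surj f
    obtain ⟨g, rfl⟩ := TensorQuotient.mk_surj g
    exact congrArg TensorQuotient.homMk (s.star_add f g)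
  star_smul c f := by
    obtain ⟨f, rfl⟩ := TensorQuotient.mk_surj f
    exact congrArg TensorQuotient.homMk (s.star_smul c f)
  star_star f := by
    obtain ⟨f, rfl⟩ := TensorQuotient.mk_surj f
    exact congrArg TensorQuotient.homMk (s.star_star f)
  star_comp f g := by
    obtain ⟨f, rfl⟩ := TensorQuotient.mk_surj f
    obtain ⟨g, rfl⟩ := TensorQuotient.mk_surj g
    exact congrArg TensorQuotient.homMk (s.star_comp f g)
  star_tensor f g := by
    obtain ⟨f, rfl⟩ := TensorQuotient.mk_surj f
    obtain ⟨g, rfl⟩ := TensorQuotient.mk_surj g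
    exact congrArg TensorQuotient.homMk (s.star_tensor f g)
  positive f := by
    obtain ⟨f, rfl⟩ := TensorQuotient.mk_surj f
    obtain ⟨g, hg⟩ := s.positive f
    exact ⟨TensorQuotient.homMk g, congrArg TensorQuotient.homMk hg⟩
  definite f h := by
    obtain ⟨f, rfl⟩ := TensorQuotient.mk_surj f
    exact congrArg TensorQuotient.homMk (s.definite f (homMk_zeroIdeal.1 h))

namespace PosStar
variable {d : ℂ} {I : TensorIdeal (TL d)} (S : PosStar I)

/-- The class of `f'` is the adjoint of the class of `f`. -/
def Adj {X Y : TL d} (f : X ⟶ Y) (f' : Y ⟶ X) : Prop :=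
  S.star (TensorQuotient.homMk f : (⟨X⟩ : TensorQuotient I) ⟶ ⟨Y⟩) = TensorQuotient.homMk f'

variable {S} {X Y Z X' Y' : TL d}

theorem Adj.congr {f g : X ⟶ Y} {f' g' : Y ⟶ X} (h : S.Adj f f') (e : f = g) (e' : f' = g') :
    S.Adj g g' := by
  subst e e'
  exact h

theorem exists_adj (f : X ⟶ Y) : ∃ f', S.Adj f f' := by
  obtain ⟨g, hg⟩ := TensorQuotient.mk_surj (S.star (TensorQuotient.homMk f : (⟨X⟩ : TensorQuotient I) ⟶ ⟨Y⟩))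
  exact ⟨g, hg.symm⟩

theorem Adj.symm {f : X ⟶ Y} {f' : Y ⟶ X} (h : S.Adj f f') : S.Adj f' f := by
  unfold Adj at h ⊢
  rw [← h, S.star_star]

theorem Adj.smul {f : X ⟶ Y} {f' : Y ⟶ X} (h : S.Adj f f') (c : ℂ) :
    S.Adj (c • f) (starRingEnd ℂ c • f') :=
  (S.star_smul c _).trans (congrArg (starRingEnd ℂ c • ·) h)

theorem Adj.add {f g : X ⟶ Y} {f' g' : Y ⟶ X} (h : S.Adj f f') (h' : S.Adj g g') :
    S.Adj (f + g) (f' + g') :=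
  (S.star_add _ _).trans (congrArg₂ (· + ·) h h')

theorem Adj.comp {f : X ⟶ Y} {f' : Y ⟶ X} {g : Y ⟶ Z} {g' : Z ⟶ Y} (h : S.Adj f f')
    (h' : S.Adj g g') : S.Adj (f ≫ g) (g' ≫ f') :=
  (S.star_comp _ _).trans (congrArg₂ (· ≫ ·) h' h)

theorem Adj.tensor {f : X ⟶ Y} {f' : Y ⟶ X} {g : X' ⟶ Y'} {g' : Y' ⟶ X'} (h : S.Adj f f')
    (h' : S.Adj g g') : S.Adj (f ⊗ₘ g) (f' ⊗ₘ g') :=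
  (S.star_tensor _ _).trans (congrArg₂ (· ⊗ₘ ·) h h')

theorem adj_id (X : TL d) : S.Adj (𝟙 X) (𝟙 X) := by
  have h1 := S.star_comp (𝟙 (⟨X⟩ : TensorQuotient I)) (S.star (𝟙 (⟨X⟩ : TensorQuotient I)))
  rw [Category.id_comp, S.star_star, Category.id_comp] at h1
  exact h1.symm

theorem Adj.unique {f : X ⟶ Y} {f' f'' : Y ⟶ X} (h : S.Adj f f') (h' : S.Adj f f'') :
    f' - f'' ∈ I.carrier Y X :=
  TensorQuotient.mk_eq_mk.1 (Eq.trans (Eq.symm h) h')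

theorem eq_of_smul_sub_mem {f : X ⟶ Y} (hf : f ∉ I.carrier X Y) {x y : ℂ}
    (h : x • f - y • f ∈ I.carrier X Y) : x = y := by
  by_contra hne
  rw [← sub_smul] at h
  have := (I.carrier X Y).smul_mem (x - y)⁻¹ h
  rw [smul_smul, inv_mul_cancel₀ (sub_ne_zero.2 hne), one_smul] at this
  exact hf this

/-- Endomorphisms of the unit object are scalars, so a positive one is of the form |y|². If it is
zero, definiteness puts f into the ideal. -/
theorem Adj.nonneg (h0 : 𝟙 (⟨0⟩ : TL d) ∉ I.carrier _ _) {f : (⟨0⟩ : TL d) ⟶ Y} {f' : Y ⟶ ⟨0⟩}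
    (h : S.Adj f f') {x : ℂ} (hx : f ≫ f' = x • 𝟙 _) :
    ∃ r : ℝ, 0 ≤ r ∧ x = r ∧ (r = 0 → f ∈ I.carrier _ _) := by
  obtain ⟨g, hg⟩ := S.positive (TensorQuotient.homMk f : (⟨⟨0⟩⟩ : TensorQuotient I) ⟶ ⟨Y⟩)
  obtain ⟨g, rfl⟩ := TensorQuotient.mk_surj g
  obtain ⟨y, rfl⟩ : ∃ y : ℂ, g = y • 𝟙 (⟨0⟩ : TL d) := ⟨_, eq_smul_id_unit g⟩
  have h1 : S.Adj (y • 𝟙 (⟨0⟩ : TL d)) (starRingEnd ℂ y • 𝟙 _) := (adj_id _).smul y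
  unfold Adj at h h1
  rw [h, h1] at hg
  have h2 : (TensorQuotient.homMk (f ≫ f') : (⟨⟨0⟩⟩ : TensorQuotient I) ⟶ ⟨⟨0⟩⟩) =
    TensorQuotient.homMk ((y • 𝟙 (⟨0⟩ : TL d)) ≫ (starRingEnd ℂ y • 𝟙 (⟨0⟩ : TL d))) := hg
  have h3 : (y • 𝟙 (⟨0⟩ : TL d)) ≫ (starRingEnd ℂ y • 𝟙 (⟨0⟩ : TL d)) =
      ((Complex.normSq y : ℝ) : ℂ) • 𝟙 (⟨0⟩ : TL d) := by
    rw [Linear.smul_comp, Linear.comp_smul, smul_smul, Category.comp_id, Complex.mul_conj]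
  rw [hx, h3, TensorQuotient.mk_eq_mk] at h2
  have h4 := eq_of_smul_sub_mem h0 h2
  refine ⟨Complex.normSq y, Complex.normSq_nonneg y, h4, fun h5 => ?_⟩
  have h6 := S.definite (TensorQuotient.homMk f : (⟨⟨0⟩⟩ : TensorQuotient I) ⟶ ⟨Y⟩) (by
    rw [h]
    refine (congrArg TensorQuotient.homMk hx).trans ?_
    rw [h4, h5, Complex.ofReal_zero, zero_smul]
    rfl)
  exact (Submodule.Quotient.mk_eq_zero _).1 h6

/-- The zigzag identity would carry the arc's membership over to the identity of the object 1. -/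
theorem cupArc_notMem (h1 : 𝟙 (⟨1⟩ : TL d) ∉ I.carrier _ _) :
    diagram d KauffmanDiagram.cupArc ∉ I.carrier _ _ := by
  intro h
  refine h1 ?_
  rw [← zigzag]
  exact I.comp_mem _ (I.mem_tensor (𝟙 (⟨1⟩ : TL d)) h)

theorem capArc_notMem (h1 : 𝟙 (⟨1⟩ : TL d) ∉ I.carrier _ _) :
    diagram d KauffmanDiagram.capArc ∉ I.carrier _ _ := by
  intro h
  refine h1 ?_
  rw [← zigzag]
  exact I.mem_comp _ (I.tensor_mem (𝟙 (⟨1⟩ : TL d)) h)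

/-- The spaces Hom(0, 2) and Hom(2, 0) are one-dimensional, so the star exchanges the two arcs up to
scalars a and b. Three axioms determine what these can be. -/
theorem exists_adj_arcs (h0 : 𝟙 (⟨0⟩ : TL d) ∉ I.carrier _ _)
    (h1 : 𝟙 (⟨1⟩ : TL d) ∉ I.carrier _ _) : ∃ a r : ℝ, a ≠ 0 ∧ 0 < r ∧ d = ((a * r : ℝ) : ℂ) ∧
      S.Adj (diagram d KauffmanDiagram.cupArc)
        ((a : ℂ)⁻¹ • diagram d KauffmanDiagram.capArc) := by
  obtain ⟨f, hf⟩ := S.exists_adj (diagram d KauffmanDiagram.cupArc)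
  obtain ⟨b, rfl⟩ := hom_eq_smul_diagram rfl KauffmanDiagram.capArc f
  obtain ⟨f, hf'⟩ := S.exists_adj (diagram d KauffmanDiagram.capArc)
  obtain ⟨a, rfl⟩ := hom_eq_smul_diagram rfl KauffmanDiagram.cupArc f
  -- The star of one zigzag identity is ab times the other.
  have e1 : a * b = 1 := by
    have h2 := Adj.comp (X := ⟨1⟩) (Y := ⟨3⟩) (Z := ⟨1⟩) ((S.adj_id ⟨1⟩).tensor hf)
      (hf'.tensor (S.adj_id ⟨1⟩))
    have h3 : S.Adj (𝟙 (⟨1⟩ : TL d)) ((a * b) • 𝟙 (⟨1⟩ : TL d)) :=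
      h2.congr zigzag (smul_zigzag' a b)
    have h4 := (S.adj_id ⟨1⟩).unique h3
    rw [← one_smul ℂ (𝟙 (⟨1⟩ : TL d)), smul_smul, mul_one] at h4
    exact (eq_of_smul_sub_mem h1 h4).symm
  have ha : a ≠ 0 := left_ne_zero_of_mul_eq_one e1
  have hb : b = a⁻¹ := eq_inv_of_mul_eq_one_right e1
  -- Applying the star twice is the identity; compared with ab = 1 this makes a real.
  have e2 : starRingEnd ℂ a * b = 1 := by
    have h2 := hf'.symm.unique (hf.smul a)
    rw [smul_smul, ← one_smul ℂ (diagram d KauffmanDiagram.capArc), smul_smul, mul_one] at h2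
    exact (eq_of_smul_sub_mem (capArc_notMem h1) h2).symm
  obtain ⟨a, rfl⟩ : ∃ a' : ℝ, a = a' := by
    refine ⟨a.re, (Complex.conj_eq_iff_re.1 ?_).symm⟩
    rw [eq_inv_of_mul_eq_one_left e2, hb, inv_inv]
  -- Positivity of the arc composed with its adjoint, a loop times b, gives r = d/a ≥ 0.
  obtain ⟨r, hr, hx, hr0⟩ := hf.nonneg h0 (x := b * d) (by
    refine (Linear.comp_smul _ _ _ _ b _).trans ?_
    rw [cupArc_comp_capArc, smul_smul])
  refine ⟨a, r, Complex.ofReal_ne_zero.1 ha, lt_of_le_of_ne hr fun h => ?_, ?_, hb ▸ hf⟩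
  · exact cupArc_notMem h1 (hr0 h.symm)
  · push_cast
    rw [← hx, ← mul_assoc, e1, one_mul]

/-- The star operation is determined by its values on the arcs. -/
theorem adj_starTL {a : ℝ} (ha : a ≠ 0) (hd : starRingEnd ℂ d = d)
    (h : S.Adj (diagram d KauffmanDiagram.cupArc) ((a : ℂ)⁻¹ • diagram d KauffmanDiagram.capArc))
    (f : X ⟶ Y) : S.Adj f (starTL (a : ℂ) f) := by
  have ha' : (a : ℂ) ≠ 0 := Complex.ofReal_ne_zero.2 ha
  have hc : starRingEnd ℂ (a : ℂ) = a := Complex.conj_ofReal a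
  have key : ∀ {m n : ℕ} (D : KauffmanDiagram m n),
      S.Adj (diagram d D) (starTL (a : ℂ) (diagram d D)) := by
    intro m n D
    refine diagram_induction (P := fun X Y f => S.Adj f (starTL (a : ℂ) f)) ?_ ?_ ?_ ?_ ?_ D
    · intro X
      refine (S.adj_id X).congr rfl (Eq.symm ?_)
      exact starTL_eqToHom (rfl : X = X)
    · intro X Y Z f g hf hg
      exact (hf.comp hg).congr rfl (starTL_comp hd ha' f g).symm
    · intro X Y X' Y' f g hf hg
      exact (hf.tensor hg).congr rfl (starTL_tensor ha' f g).symm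
    · refine h.congr rfl ?_
      rw [starTL_diagram, KauffmanDiagram.cupArc_reflect, KauffmanDiagram.arcIndex_eq]
      norm_num
    -- The reflection of D is a multiple of the adjoint of D, whose own adjoint is D again.
    · intro m n D hD
      have h1 := hD.symm.smul ((a : ℂ) ^ D.arcIndex)⁻¹
      have e : ((a : ℂ) ^ D.arcIndex)⁻¹ • starTL (a : ℂ) (diagram d D) = diagram d D.reflect := by
        rw [starTL_diagram, smul_smul, inv_mul_cancel₀ (zpow_ne_zero _ ha'), one_smul]
      refine h1.congr e ?_
      rw [← e, starTL_smul, starTL_starTL hc ha']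
  induction f using TL.hom_induction with
  | zero =>
    rw [starTL_zero]
    unfold Adj
    have h0 := S.star_smul 0 (0 : (⟨X⟩ : TensorQuotient I) ⟶ ⟨Y⟩)
    rw [map_zero, zero_smul, zero_smul] at h0
    exact h0
  | add f g hf hg =>
    rw [starTL_add]
    exact hf.add hg
  | single D x =>
    refine ((key D).smul x).congr (single_eq_smul_diagram D x).symm ?_
    rw [← starTL_smul]
    exact congrArg (starTL (a : ℂ)) (single_eq_smul_diagram D x).symm

/-- A positive star operation exists only for special values of the parameter. -/
theorem exists_parameter (S : PosStar I) (h0 : 𝟙 (⟨0⟩ : TL d) ∉ I.carrier _ _)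
    (h1 : 𝟙 (⟨1⟩ : TL d) ∉ I.carrier _ _) : ∃ a c D : ℝ, 0 < a * c ∧ c * c = 1 ∧ 0 < D ∧
      d = ((c * D : ℝ) : ℂ) ∧ (∀ {X Y : TL d} (f : X ⟶ Y), S.Adj f (starTL (a : ℂ) f)) ∧
      (2 ≤ D ∨ (∃ n : ℕ, 3 ≤ n ∧ D = 2 * Real.cos (Real.pi / n)) ∧
        ∃ (X Y : TL d) (f : X ⟶ Y), f ∈ I.carrier X Y ∧ f ≠ 0) := by
  obtain ⟨a, r, ha, hr, rfl, h⟩ := S.exists_adj_arcs h0 h1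
  have hadj : ∀ {X Y : TL _} (f : X ⟶ Y), S.Adj f (starTL (a : ℂ) f) := fun f =>
    adj_starTL ha (Complex.conj_ofReal _) h f
  have hab : 0 < |a| := abs_pos.2 ha
  -- The parameter is written as d = cD with the sign c of a and D = |a| r.
  have hc : a / |a| * (a / |a|) = 1 := by
    rw [div_mul_div_comm, abs_mul_abs_self, div_self (mul_ne_zero ha ha)]
  have hd : a * r = a / |a| * (|a| * r) := by field_simp
  refine ⟨a, a / |a|, |a| * r, ?_, hc, by positivity, by rw [← hd], hadj, ?_⟩
  · rw [← mul_div_assoc, ← abs_mul_abs_self]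
    positivity
  rcases le_or_gt 2 (|a| * r) with h2 | h2
  · exact .inl h2
  obtain ⟨N, hN, hpos, hle, hzero⟩ := exists_qnum_nonpos (by positivity) h2
  obtain ⟨f, hf, hx⟩ := exists_markovTrace_eq_qnum hc hd (by omega) hpos
  -- The factor a^(-N) from the star and the sign c^N from the trace combine to |a|^(-N), so the
  -- sign of this scalar is that of [N + 1].
  have e : f ≫ starTL (a : ℂ) f =
      (((|a| ^ N)⁻¹ * qnum (|a| * r) N : ℝ) : ℂ) • 𝟙 (⟨0⟩ : TL _) := by
    refine (eq_smul_id_unit _).trans ?_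
    congr 1
    have e1 : f ≫ starTL (a : ℂ) f = (a : ℂ) ^ ((((0 : ℕ) : ℤ) - (2 * N : ℕ)) / 2) •
      (f ≫ (show (⟨2 * N⟩ : TL _) ⟶ ⟨0⟩ from revHom f)) := Linear.comp_smul _ _ _ _ _ _
    rw [e1, map_smul, hx, show (((0 : ℕ) : ℤ) - (2 * N : ℕ)) / 2 = -(N : ℤ) by omega, zpow_neg,
      zpow_natCast, smul_eq_mul]
    norm_cast
    rw [div_pow]
    have := pow_ne_zero N ha
    field_simp
  obtain ⟨t, ht, hx, ht0⟩ := (hadj f).nonneg h0 e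
  have hx : (|a| ^ N)⁻¹ * qnum (|a| * r) N = t := Complex.ofReal_injective hx
  -- Positivity leaves only [N + 1] = 0. Then f has zero square and lies in the ideal, although it
  -- is not zero.
  have hq : qnum (|a| * r) N = 0 := by
    refine le_antisymm hle ?_
    rw [← hx] at ht
    exact nonneg_of_mul_nonneg_right ht (by positivity)
  rw [hq, mul_zero] at hx
  exact .inr ⟨⟨N + 1, by omega, hzero hq⟩, _, _, f, ht0 hx.symm, hf⟩

end PosStar

end TemperleyLieb

/-! ### Uniqueness by rescaling. -/

namespace TemperleyLieb

open CategoryTheory MonoidalCategory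

section Rescale
variable {C : Type*} [Category C] [Preadditive C] [Linear ℂ C]

/-- Multiplication of the morphisms `X ⟶ Y` by `ρ ^ (gr X - gr Y)`. -/
noncomputable def rescale (gr : C → ℤ) {ρ : ℂ} (hρ : ρ ≠ 0) : C ⥤ C where
  obj X := X
  map {X Y} f := ρ ^ (gr X - gr Y) • f
  map_id X := by rw [sub_self, zpow_zero, one_smul]
  map_comp f g := by
    rw [Linear.smul_comp, Linear.comp_smul, smul_smul, ← zpow_add₀ hρ, sub_add_sub_cancel]

theorem rescale_isEquivalence (gr : C → ℤ) {ρ : ℂ} (hρ : ρ ≠ 0) :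
    (rescale gr hρ).IsEquivalence where
  faithful := ⟨fun {X Y} _ _ h =>
    (smul_right_inj (zpow_ne_zero (gr X - gr Y) hρ)).1 h⟩
  full := ⟨fun {X Y} (f : (X : C) ⟶ Y) => ⟨(ρ ^ (gr X - gr Y))⁻¹ • f,
    smul_inv_smul₀ (zpow_ne_zero (gr X - gr Y) hρ) f⟩⟩
  essSurj := ⟨fun X => ⟨X, ⟨Iso.refl X⟩⟩⟩

variable [MonoidalCategory C]

/-- Two C*-tensor category structures whose star operations differ by a change of scale are
equivalent. -/
theorem CStarTensorStructure.equivalent_of_rescale [MonoidalPreadditive C] [MonoidalLinear ℂ C]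
    (s t : CStarTensorStructure C) (gr : C → ℤ) (hgr : ∀ X Y, gr (X ⊗ Y) = gr X + gr Y) {ρ : ℂ}
    (hρ : ρ ≠ 0)
    (h : ∀ {X Y : C} (f : X ⟶ Y), ρ ^ (gr Y - gr X) • s.star f =
      t.star (ρ ^ (gr X - gr Y) • f)) : s.Equivalent t := by
  refine ⟨rescale gr hρ, rescale_isEquivalence gr hρ, ⟨rfl, fun X Y => rfl, ?_⟩, ?_, ?_, h⟩
  · intro X Y X' Y' f g
    have e : ρ ^ (gr (X ⊗ X') - gr (Y ⊗ Y')) • (f ⊗ₘ g) =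
        (ρ ^ (gr X - gr Y) • f) ⊗ₘ (ρ ^ (gr X' - gr Y') • g) := by
      simp only [MonoidalCategory.tensorHom_def, MonoidalLinear.smul_whiskerRight,
        MonoidalLinear.whiskerLeft_smul, Linear.smul_comp, Linear.comp_smul, smul_smul,
        ← zpow_add₀ hρ, hgr]
      congr 2
      ring
    exact e.trans ((Category.id_comp _).trans (Category.comp_id _)).symm
  · intro X Y f g
    exact smul_add _ _ _
  · intro X Y c f
    exact smul_comm (ρ ^ (gr X - gr Y)) c f

end Rescale

section Parameters
variable {d : ℂ}

theorem hom_eq_zero_of_not_even {X Y : TL d} (h : ¬ Even (X.strands + Y.strands)) (f : X ⟶ Y) :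
    f = 0 := by
  induction f using TL.hom_induction with
  | zero => rfl
  | add f g hf hg => rw [hf, hg, add_zero]
  | single D x =>
    refine absurd D.even ?_
    rwa [add_comm]

/-- Put X - Y = 2k on strand numbers; for odd difference there are no morphisms. The star operations
differ by (a/a')^k and the two rescaling factors by ρ^(4k), which explains the fourth power. -/
theorem rescale_starTL {a a' ρ : ℝ} (hρ : ρ ≠ 0)
    (h : ρ ^ 4 * a' = a) {X Y : TL d} (f : X ⟶ Y) :
    (ρ : ℂ) ^ ((Y.strands : ℤ) - X.strands) • starTL (a : ℂ) f =
      starTL (a' : ℂ) ((ρ : ℂ) ^ ((X.strands : ℤ) - Y.strands) • f) := by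
  rw [starTL_smul, map_zpow₀, Complex.conj_ofReal]
  by_cases he : Even (X.strands + Y.strands)
  swap
  · rw [hom_eq_zero_of_not_even he f, starTL_zero, starTL_zero, smul_zero, smul_zero]
  obtain ⟨k, hk⟩ : ∃ k : ℤ, (X.strands : ℤ) - Y.strands = 2 * k :=
    ⟨((X.strands : ℤ) - Y.strands) / 2, by obtain ⟨t, ht⟩ := he; omega⟩
  have e : (Y.strands : ℤ) - X.strands = -(2 * k) := by omega
  unfold starTL
  rw [e, hk, Int.mul_ediv_cancel_left _ two_ne_zero]
  refine (smul_smul _ _ _).trans (Eq.trans ?_ (smul_smul _ _ _).symm)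
  congr 1
  have h1 : (a : ℂ) = (ρ : ℂ) ^ (4 : ℤ) * a' := by
    rw [← h]; push_cast; rfl
  have h2 : (ρ : ℂ) ≠ 0 := Complex.ofReal_ne_zero.2 hρ
  rw [h1, mul_zpow, ← zpow_mul, ← mul_assoc, ← zpow_add₀ h2]
  congr 2
  ring

theorem exists_fourth_root {a : ℝ} (ha : 0 < a) : ∃ ρ : ℝ, ρ ≠ 0 ∧ ρ ^ 4 = a := by
  refine ⟨√(√a), by positivity, ?_⟩
  rw [show 4 = 2 * 2 from rfl, pow_mul, Real.sq_sqrt (by positivity), Real.sq_sqrt ha.le]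

theorem id_ne_zero (X : TL d) : 𝟙 X ≠ 0 := fun h =>
  one_ne_zero (Finsupp.single_eq_zero.1 (show Finsupp.single (KauffmanDiagram.one X.strands) (1 : ℂ) = 0 from h))

theorem CStarTensorStructure.exists_parameter_TL (s : CStarTensorStructure (TL d)) :
    ∃ a c D : ℝ, 0 < a * c ∧ c * c = 1 ∧ 0 < D ∧ d = ((c * D : ℝ) : ℂ) ∧
      (∀ {X Y : TL d} (f : X ⟶ Y), s.star f = starTL (a : ℂ) f) ∧ 2 ≤ D := by
  obtain ⟨a, c, D, h1, h2, h3, h4, h5, h6⟩ := (PosStar.ofTL s).exists_parameter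
    (fun h => id_ne_zero _ ((Submodule.mem_bot ℂ).1 h))
    (fun h => id_ne_zero _ ((Submodule.mem_bot ℂ).1 h))
  refine ⟨a, c, D, h1, h2, h3, h4, fun f => homMk_zeroIdeal.1 (h5 f), ?_⟩
  rcases h6 with h6 | ⟨-, X, Y, f, hf, hf0⟩
  · exact h6
  · exact absurd ((Submodule.mem_bot ℂ).1 hf) hf0

/-- If the ideal contained the identity of 1, it would contain that of 2. Between the two arcs this
becomes a loop, d times the identity of the unit object. For this reason d = 0 is excluded. -/
theorem id_one_notMem {I : TensorIdeal (TL d)} (hd : d ≠ 0)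
    (h0 : 𝟙 (⟨0⟩ : TL d) ∉ I.carrier _ _) : 𝟙 (⟨1⟩ : TL d) ∉ I.carrier _ _ := by
  intro h
  have h2 : 𝟙 (⟨2⟩ : TL d) ∈ I.carrier _ _ := by
    have e : 𝟙 (⟨1⟩ : TL d) ⊗ₘ 𝟙 (⟨1⟩ : TL d) = 𝟙 (⟨2⟩ : TL d) := id_tensorHom_id _ _
    exact (congrArg (· ∈ I.carrier (⟨2⟩ : TL d) ⟨2⟩) e).mp
      (I.tensor_mem (𝟙 (⟨1⟩ : TL d)) h)
  have h3 := I.comp_mem (diagram d KauffmanDiagram.capArc)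
    (I.mem_comp (diagram d KauffmanDiagram.cupArc) h2)
  rw [Category.comp_id, cupArc_comp_capArc] at h3
  have := (I.carrier _ _).smul_mem d⁻¹ h3
  rw [smul_smul, inv_mul_cancel₀ hd, one_smul] at this
  exact h0 this

theorem CStarTensorStructure.exists_parameter_quotient {I : TensorIdeal (TL d)}
    (s : CStarTensorStructure (TensorQuotient I)) (hd : d ≠ 0)
    (h0 : 𝟙 (⟨0⟩ : TL d) ∉ I.carrier _ _) :
    ∃ a c D : ℝ, 0 < a * c ∧ c * c = 1 ∧ 0 < D ∧ d = ((c * D : ℝ) : ℂ) ∧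
      (∀ {X Y : TL d} (f : X ⟶ Y),
        s.star (TensorQuotient.homMk f : (⟨X⟩ : TensorQuotient I) ⟶ ⟨Y⟩) =
          TensorQuotient.homMk (starTL (a : ℂ) f)) ∧
      (2 ≤ D ∨ ∃ n : ℕ, 3 ≤ n ∧ D = 2 * Real.cos (Real.pi / n)) := by
  obtain ⟨a, c, D, h1, h2, h3, h4, h5, h6⟩ := (PosStar.ofQuotient s).exists_parameter h0
    (id_one_notMem hd h0)
  exact ⟨a, c, D, h1, h2, h3, h4, h5, h6.imp id fun h => h.1⟩

/-- Both a and a' have the sign of d, so their quotient is positive and has a real fourth root. -/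
theorem exists_scale {a c D a' c' D' : ℝ} (h : 0 < a * c) (hD : 0 < D) (h' : 0 < a' * c')
    (hD' : 0 < D') (e : ((c * D : ℝ) : ℂ) = ((c' * D' : ℝ) : ℂ)) :
    ∃ ρ : ℝ, ρ ≠ 0 ∧ ρ ^ 4 * a' = a := by
  have e := Complex.ofReal_injective e
  have ha := left_ne_zero_of_mul h.ne'
  have ha' := left_ne_zero_of_mul h'.ne'
  have hpos : 0 < a / a' := by
    have h1 : 0 < (a * c) * (a' * c') * (D * D') := by positivity
    have h2 : (a * c) * (a' * c') * (D * D') = (a / a') * (a' * (c * D)) ^ 2 := by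
      have : (a * c) * (a' * c') * (D * D') = a * a' * (c * D) * (c' * D') := by ring
      rw [this, ← e]
      field_simp
    rw [h2] at h1
    exact pos_of_mul_pos_left h1 (sq_nonneg _)
  obtain ⟨ρ, h1, h2⟩ := exists_fourth_root hpos
  exact ⟨ρ, h1, by rw [h2, div_mul_cancel₀ _ ha']⟩

theorem CStarTensorStructure.equivalent_TL (s t : CStarTensorStructure (TL d)) :
    s.Equivalent t := by
  obtain ⟨a, c, D, h1, -, h3, h4, h5, -⟩ := s.exists_parameter_TL
  obtain ⟨a', c', D', h1', -, h3', h4', h5', -⟩ := t.exists_parameter_TL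
  obtain ⟨ρ, hρ, e⟩ := exists_scale h1 h3 h1' h3' (h4.symm.trans h4')
  refine s.equivalent_of_rescale t (fun X => X.strands) (fun X Y => Nat.cast_add _ _)
    (Complex.ofReal_ne_zero.2 hρ) fun f => ?_
  rw [h5, h5']
  exact rescale_starTL hρ e f

theorem mem_of_id_unit_mem {I : TensorIdeal (TL d)} (h0 : 𝟙 (⟨0⟩ : TL d) ∈ I.carrier _ _)
    {X Y : TL d} (f : X ⟶ Y) : f ∈ I.carrier X Y := by
  have h1 := TL.leftUnitor_naturality f
  have h2 : f = (λ_ X).inv ≫ (𝟙 (𝟙_ (TL d)) ⊗ₘ f) ≫ (λ_ Y).hom := by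
    rw [h1, Iso.inv_hom_id_assoc]
  rw [h2]
  exact I.mem_comp _ (I.comp_mem _ (I.tensor_mem _ h0))

theorem CStarTensorStructure.equivalent_quotient {I : TensorIdeal (TL d)} (hd : d ≠ 0)
    (s t : CStarTensorStructure (TensorQuotient I)) : s.Equivalent t := by
  by_cases h0 : 𝟙 (⟨0⟩ : TL d) ∈ I.carrier _ _
  -- If the unit object vanishes, all morphisms do, and any two structures coincide.
  · refine s.equivalent_of_rescale t (fun X => X.obj.strands) (fun X Y => Nat.cast_add _ _)
      one_ne_zero fun {X Y} f => ?_
    have : ∀ {X Y : TensorQuotient I} (f : X ⟶ Y), f = 0 := fun f => by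
      obtain ⟨f, rfl⟩ := TensorQuotient.mk_surj f
      exact (Submodule.Quotient.mk_eq_zero _).2 (mem_of_id_unit_mem h0 f)
    rw [this (t.star _)]
    exact this _
  obtain ⟨a, c, D, h1, -, h3, h4, h5, -⟩ := s.exists_parameter_quotient hd h0
  obtain ⟨a', c', D', h1', -, h3', h4', h5', -⟩ := t.exists_parameter_quotient hd h0
  obtain ⟨ρ, hρ, e⟩ := exists_scale h1 h3 h1' h3' (h4.symm.trans h4')
  refine s.equivalent_of_rescale t (fun X => X.obj.strands) (fun X Y => Nat.cast_add _ _)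
    (Complex.ofReal_ne_zero.2 hρ) fun f => ?_
  obtain ⟨f, rfl⟩ := TensorQuotient.mk_surj f
  refine (congrArg (_ • ·) (h5 f)).trans (Eq.trans ?_ (h5' _).symm)
  exact congrArg TensorQuotient.homMk (rescale_starTL hρ e f)

end Parameters

/-! ### Existence for the admissible parameters. -/

section Existence
variable {c D : ℝ}

theorem div_norm_eq (hc : c * c = 1) (hD : 0 < D) :
    ((c * D : ℝ) : ℂ) / (‖((c * D : ℝ) : ℂ)‖ : ℂ) = c := by
  have h1 : |c| = 1 := by
    rcases mul_self_eq_one_iff.1 hc with rfl | rfl <;> simp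
  rw [Complex.norm_real, Real.norm_eq_abs, abs_mul, h1, one_mul, abs_of_pos hD]
  push_cast
  rw [mul_div_assoc, div_self (Complex.ofReal_ne_zero.2 hD.ne'), mul_one]

theorem exists_cstarTL (hc : c * c = 1) (hD : 2 ≤ D) :
    ∃ s : CStarTensorStructure (TL ((c * D : ℝ) : ℂ)), ∀ (m n : ℕ) (E : KauffmanDiagram m n),
      s.star (diagram ((c * D : ℝ) : ℂ) E) =
        (((c * D : ℝ) : ℂ) / (‖((c * D : ℝ) : ℂ)‖ : ℂ)) ^ E.arcIndex •
          diagram ((c * D : ℝ) : ℂ) E.reflect := by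
  obtain ⟨G, h1, h2, h3⟩ := exists_weights_of_two_le hc rfl hD
  have hne : G.verts.Nonempty := ⟨0, h2 ▸ le_refl (0 : ℤ)⟩
  refine ⟨G.cstarTL h3 hne (G.kerIdeal_eq_bot fun u hu => by rw [h2]; exact hu), fun m n E => ?_⟩
  rw [div_norm_eq hc (by linarith)]
  exact (starTL_diagram E).trans (by rw [h1])

theorem exists_cstarReduced (hc : c * c = 1) (hD0 : 0 < D)
    (hD : 2 ≤ D ∨ ∃ n : ℕ, 3 ≤ n ∧ D = 2 * Real.cos (Real.pi / n)) :
    IsTensorCategory (ReducedTL ((c * D : ℝ) : ℂ)) ∧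
    ∃ s : CStarTensorStructure (ReducedTL ((c * D : ℝ) : ℂ)),
      ∀ (m n : ℕ) (E : KauffmanDiagram m n),
        s.star (TensorQuotient.homMk (diagram ((c * D : ℝ) : ℂ) E)) =
          (((c * D : ℝ) : ℂ) / (‖((c * D : ℝ) : ℂ)‖ : ℂ)) ^ E.arcIndex •
            TensorQuotient.homMk (diagram ((c * D : ℝ) : ℂ) E.reflect) := by
  obtain ⟨G, h1, hne, h3⟩ : ∃ G : WalkWeights (c * D), G.c = c ∧ G.verts.Nonempty ∧
      ∀ u ∈ G.verts, 0 < G.lam u := by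
    rcases hD with hD | ⟨n, hn, hD⟩
    · obtain ⟨G, h1, h2, h3⟩ := exists_weights_of_two_le hc rfl hD
      exact ⟨G, h1, ⟨0, h2 ▸ le_refl (0 : ℤ)⟩, h3⟩
    · exact exists_weights_of_cos hc rfl hn hD
  have hI := G.negligibleIdeal_eq h3 hne
  refine ⟨isTensorCategory_quotient _ ?_, G.cstarQuotient h3 hne _ hI, fun m n E => ?_⟩
  · rw [hI]
    exact G.id_unit_notMem_kerIdeal h3 hne
  · rw [div_norm_eq hc hD0]
    exact congrArg TensorQuotient.homMk ((starTL_diagram E).trans (by rw [h1]))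

end Existence

/-! ### The parameter in terms of q. -/

section Numbers

theorem exists_add_inv_iff {d : ℂ} :
    (∃ c D : ℝ, c * c = 1 ∧ 2 ≤ D ∧ d = ((c * D : ℝ) : ℂ)) ↔
      ∃ q : ℝ, 0 < q ∧ (d = (q : ℂ) + (q : ℂ)⁻¹ ∨ d = -((q : ℂ) + (q : ℂ)⁻¹)) := by
  constructor
  · rintro ⟨c, D, hc, hD, rfl⟩
    have h0 : 0 ≤ D ^ 2 - 4 := by nlinarith
    have h1 := Real.sq_sqrt h0
    have h2 := Real.sqrt_nonneg (D ^ 2 - 4)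
    have hq : 0 < (D + √(D ^ 2 - 4)) / 2 := by positivity
    -- The larger root of q² - Dq + 1, which is real because D ≥ 2.
    refine ⟨(D + √(D ^ 2 - 4)) / 2, hq, ?_⟩
    have e : (D + √(D ^ 2 - 4)) / 2 + ((D + √(D ^ 2 - 4)) / 2)⁻¹ = D := by
      field_simp
      nlinarith
    rcases mul_self_eq_one_iff.1 hc with rfl | rfl
    · left; nth_rw 1 [← e]; push_cast; ring
    · right; nth_rw 1 [← e]; push_cast; ring
  · rintro ⟨q, hq, h⟩
    have h2 : 2 ≤ q + q⁻¹ := by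
      have : q + q⁻¹ - 2 = (q - 1) ^ 2 / q := by field_simp; ring
      have := div_nonneg (sq_nonneg (q - 1)) hq.le
      linarith
    rcases h with rfl | rfl
    · exact ⟨1, q + q⁻¹, by norm_num, h2, by push_cast; ring⟩
    · exact ⟨-1, q + q⁻¹, by norm_num, h2, by push_cast; ring⟩

theorem exp_add_inv (n : ℕ) : Complex.exp (Complex.I * (Real.pi : ℂ) / (n : ℂ)) +
    (Complex.exp (Complex.I * (Real.pi : ℂ) / (n : ℂ)))⁻¹ =
      ((2 * Real.cos (Real.pi / n) : ℝ) : ℂ) := by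
  push_cast
  rw [Complex.two_cos, ← Complex.exp_neg]
  congr 2 <;> ring

theorem exists_add_inv_iff' {d : ℂ} :
    (∃ c D : ℝ, c * c = 1 ∧ 0 < D ∧ (2 ≤ D ∨ ∃ n : ℕ, 3 ≤ n ∧ D = 2 * Real.cos (Real.pi / n)) ∧
      d = ((c * D : ℝ) : ℂ)) ↔
      ∃ q : ℂ, ((∃ r : ℝ, 0 < r ∧ q = (r : ℂ)) ∨
        ∃ n : ℕ, 3 ≤ n ∧ q = Complex.exp (Complex.I * (Real.pi : ℂ) / (n : ℂ))) ∧
          (d = q + q⁻¹ ∨ d = -(q + q⁻¹)) := by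
  constructor
  · rintro ⟨c, D, hc, -, hD | ⟨n, hn, hD⟩, hd⟩
    · obtain ⟨q, hq, h⟩ := exists_add_inv_iff.1 ⟨c, D, hc, hD, hd⟩
      exact ⟨q, .inl ⟨q, hq, rfl⟩, h⟩
    · refine ⟨_, .inr ⟨n, hn, rfl⟩, ?_⟩
      rw [exp_add_inv, ← hD, hd]
      rcases mul_self_eq_one_iff.1 hc with rfl | rfl
      · left; simp
      · right; simp
  · rintro ⟨q, ⟨r, hr, rfl⟩ | ⟨n, hn, rfl⟩, h⟩
    · obtain ⟨c, D, hc, hD, hd⟩ := exists_add_inv_iff.2 ⟨r, hr, h⟩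
      exact ⟨c, D, hc, by linarith, .inl hD, hd⟩
    · have hn' : (3 : ℝ) ≤ n := by exact_mod_cast hn
      have hpi := Real.pi_pos
      have hpos : 0 < 2 * Real.cos (Real.pi / n) := by
        refine mul_pos two_pos (Real.cos_pos_of_mem_Ioo ⟨?_, ?_⟩)
        · have : 0 < Real.pi / n := by positivity
          linarith
        · exact div_lt_div_of_pos_left hpi two_pos (by linarith)
      rw [exp_add_inv] at h
      rcases h with rfl | rfl
      · exact ⟨1, _, by norm_num, hpos, .inr ⟨n, hn, rfl⟩, by simp⟩
      · exact ⟨-1, _, by norm_num, hpos, .inr ⟨n, hn, rfl⟩, by simp⟩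

end Numbers

/-- If the identity of the unit object were zero there, the zero endomorphism would be both 0 and 1
times it, against the uniqueness of the scalar. -/
theorem IsTensorCategory.id_unit_notMem {d : ℂ} {I : TensorIdeal (TL d)}
    (h : IsTensorCategory (TensorQuotient I)) : 𝟙 (⟨0⟩ : TL d) ∉ I.carrier _ _ := by
  intro h0
  obtain ⟨x, -, hx⟩ := h.end_unit 0
  have h1 : 𝟙 (𝟙_ (TensorQuotient I)) = 0 := (Submodule.Quotient.mk_eq_zero _).2 h0
  have h2 := hx 0 (zero_smul _ _).symm
  have h3 := hx 1 (Eq.symm ((congrArg ((1 : ℂ) • ·) h1).trans (smul_zero _)))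
  exact zero_ne_one (h2.trans h3.symm)

end TemperleyLieb

theorem mainTheorem3 (d : ℂ) :
    (TemperleyLieb.IsCStarTensorCategory (TemperleyLieb.TL d) ↔
      ∃ q : ℝ, 0 < q ∧ (d = (q : ℂ) + (q : ℂ)⁻¹ ∨ d = -((q : ℂ) + (q : ℂ)⁻¹))) ∧
    (d ≠ 0 →
      (TemperleyLieb.IsCStarTensorCategory (TemperleyLieb.ReducedTL d) ↔
        ∃ q : ℂ, ((∃ r : ℝ, 0 < r ∧ q = (r : ℂ)) ∨
            ∃ n : ℕ, 3 ≤ n ∧ q = Complex.exp (Complex.I * (Real.pi : ℂ) / (n : ℂ))) ∧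
          (d = q + q⁻¹ ∨ d = -(q + q⁻¹)))) ∧
    (∀ s t : TemperleyLieb.CStarTensorStructure (TemperleyLieb.TL d), s.Equivalent t) ∧
    (d ≠ 0 → ∀ s t : TemperleyLieb.CStarTensorStructure (TemperleyLieb.ReducedTL d),
      s.Equivalent t) ∧
    (TemperleyLieb.IsCStarTensorCategory (TemperleyLieb.TL d) →
      ∃ s : TemperleyLieb.CStarTensorStructure (TemperleyLieb.TL d),
        ∀ (m n : ℕ) (D : TemperleyLieb.KauffmanDiagram m n),
          s.star (TemperleyLieb.diagram d D) =
            (d / (‖d‖ : ℂ)) ^ D.arcIndex • TemperleyLieb.diagram d D.reflect) ∧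
    (d ≠ 0 → TemperleyLieb.IsCStarTensorCategory (TemperleyLieb.ReducedTL d) →
      ∃ s : TemperleyLieb.CStarTensorStructure (TemperleyLieb.ReducedTL d),
        ∀ (m n : ℕ) (D : TemperleyLieb.KauffmanDiagram m n),
          s.star (TemperleyLieb.TensorQuotient.homMk (TemperleyLieb.diagram d D)) =
            (d / (‖d‖ : ℂ)) ^ D.arcIndex •
              TemperleyLieb.TensorQuotient.homMk (TemperleyLieb.diagram d D.reflect)) := by
  have hred (hd : d ≠ 0)
      (h : TemperleyLieb.IsCStarTensorCategory (TemperleyLieb.ReducedTL d)) :=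
    h.2.some.exists_parameter_quotient hd h.1.id_unit_notMem
  refine ⟨⟨?_, fun h => ?_⟩, fun hd => ⟨fun h => ?_, fun h => ?_⟩,
    fun s t => s.equivalent_TL t, fun hd s t => s.equivalent_quotient hd t, ?_, fun hd h => ?_⟩
  · rintro ⟨-, ⟨s⟩⟩
    obtain ⟨a, c, D, -, hc, -, hd, -, hD⟩ := s.exists_parameter_TL
    exact TemperleyLieb.exists_add_inv_iff.1 ⟨c, D, hc, hD, hd⟩
  · obtain ⟨c, D, hc, hD, rfl⟩ := TemperleyLieb.exists_add_inv_iff.2 h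
    obtain ⟨s, -⟩ := TemperleyLieb.exists_cstarTL hc hD
    exact ⟨TemperleyLieb.isTensorCategory_TL _, ⟨s⟩⟩
  · obtain ⟨a, c, D, -, hc, hD0, hd, -, hD⟩ := hred hd h
    exact TemperleyLieb.exists_add_inv_iff'.1 ⟨c, D, hc, hD0, hD, hd⟩
  · obtain ⟨c, D, hc, hD0, hD, rfl⟩ := TemperleyLieb.exists_add_inv_iff'.2 h
    obtain ⟨h1, s, -⟩ := TemperleyLieb.exists_cstarReduced hc hD0 hD
    exact ⟨h1, ⟨s⟩⟩
  · rintro ⟨-, ⟨s⟩⟩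
    obtain ⟨a, c, D, -, hc, -, rfl, -, hD⟩ := s.exists_parameter_TL
    -- The given structure serves only to show that d is admissible; the normalized one is
    -- constructed afresh from the path model.
    exact TemperleyLieb.exists_cstarTL hc hD
  · obtain ⟨a, c, D, -, hc, hD0, rfl, -, hD⟩ := hred hd h
    exact (TemperleyLieb.exists_cstarReduced hc hD0 hD).2
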